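/- Let $\mathcal H$ be a complex Hilbert space, $(S_t)_{t\in\mathbb R}$ a strongly continuous one-parameter unitary group on $\mathcal H$, and $\hat n$ a bounded positive operator on $\mathcal H$ with $S_{-t}\hat nS_t=\hat n$ for all $t$. Let $\mathcal A_{\rm CCR}$ be the algebra of polynomials in the creation and annihilation operators $A^+(f)$, $A(g)$ ($f,g\in\mathcal H$), with $[A(f),A^+(g)]=\langle f,g\rangle$, and for $\varepsilon>0$ let $\omega_{\varepsilon\hat n}$ be the mean-zero gauge-invariant Gaussian state on it with $\omega_{\varepsilon\hat n}(A^+(f)A(g))=\varepsilon\langle g,\hat nf\rangle$. For a trace class operator $T=\sum_k|f_k\rangle\langle g_k|$ (with $\sum_k\|f_k\|^2<\infty$, $\sum_k\|g_k\|^2<\infty$) let $N(T)=\sum_kA^+(f_k)A(g_k)$ be its second quantization (correlation functions of such operators are the limits of those of the finite partial sums), and for $\omega\in\mathbb R$ put $$N_{T,\omega,\varepsilon}(t)=\frac{e^{-it\omega/\varepsilon}}{\varepsilon}\,N(S_{t/\varepsilon}TS_{-t/\varepsilon}).$$ Let $n\ge1$, let $T_1,\dots,T_n$ be trace class, $\omega_1,\dots,\omega_n\in\mathbb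 R$, $\tilde\omega_l=\omega_l+\dots+\omega_n$. For $I=\{i_1<\dots<i_m\}\subseteq\{1,\dots,n\}$ put $W_\varepsilon(t_I)=\omega_{\varepsilon\hat n}(N_{T_{i_1},\omega_{i_1},\varepsilon}(t_{i_1})\cdots N_{T_{i_m},\omega_{i_m},\varepsilon}(t_{i_m}))$, and let the truncated correlation functions $W^T_\varepsilon$ be defined inductively by $W_\varepsilon(t_I)=\sum_\pi\prod_{J\in\pi}W^T_\varepsilon(t_J)$, the sum being over all partitions $\pi$ of $I$ into nonempty blocks. Let $P_E=(2\pi)^{-1}\int S_te^{-itE}\,dt$: for $f,g\in\mathcal H$ the matrix element $\langle g,P_Ef\rangle$ is the integrable function of $E$ which equals $(2\pi)^{-1}\int\langle g,S_tf\rangle e^{-itE}\,dt$ in the sense of distributions in $E$, if there is one. Assume that $P_E$ exists on the vectors that occur, and is integrable enough for the limit below to be meaningful: there are expansions $T_l=\sum_k|f_{l,k}\rangle\langle g_{l,k}|$ as above such that for every $l$ the functions $\langle f_{l,k},P_Ef_{l,k}\rangle$ and $\langle g_{l,k},P_Eg_{l,k}\rangle$ exist and $$\int\Bigl(\sum_k\langle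 f_{l,k},P_Ef_{l,k}\rangle\Bigr)^n dE<\infty,\qquad \int\Bigl(\sum_k\langle g_{l,k},P_Eg_{l,k}\rangle\Bigr)^n dE<\infty .$$ Then, for any such expansions, the series $$\mathrm{Tr}\bigl[\hat nP_{E+\tilde\omega_1}T_1P_{E+\tilde\omega_2}T_2\cdots P_{E+\tilde\omega_n}T_n\bigr]=\sum_{k_1,\dots,k_n}\langle g_{n,k_n},P_{E+\tilde\omega_1}\hat nf_{1,k_1}\rangle\prod_{l=2}^n\langle g_{l-1,k_{l-1}},P_{E+\tilde\omega_l}f_{l,k_l}\rangle$$ converges absolutely for almost every $E$, its sum is integrable in $E$, and, in the sense of (tempered) distributions in $t_1,\dots,t_n$, $$\lim_{\varepsilon\to0^+}W^T_{\varepsilon}(t_1,\dots,t_n)=(2\pi)^{n-1}\delta(t_2-t_1)\cdots\delta(t_n-t_{n-1})\,\delta_{\tilde\omega_1,0}\int dE\,\mathrm{Tr}\bigl[\hat nP_{E+\tilde\omega_1}T_1P_{E+\tilde\omega_2}T_2\cdots P_{E+\tilde\omega_n}T_n\bigr],$$ where $\delta_{\tilde\omega_1,0}$ is the Kronecker symbol.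 -/

import Mathlib

open MeasureTheory Filter Topology

noncomputable section

namespace LowDensity

variable {H : Type*} [NormedAddCommGroup H] [InnerProductSpace ℂ H]

/-! ### The CCR algebra over the one-particle space

The algebra of polynomials in the creation operators `A⁺(f)` (generator `Sum.inl f`) and the
annihilation operators `A(g)` (generator `Sum.inr g`), modulo linearity of `A⁺`, antilinearity
of `A` and the canonical commutation relations. -/

/-- Defining relations of the CCR algebra. -/
inductive CCRRel (H : Type*) [NormedAddCommGroup H] [InnerProductSpace ℂ H] :
    FreeAlgebra ℂ (H ⊕ H) → FreeAlgebra ℂ (H ⊕ H) → Prop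
  | cre_add (f g : H) : CCRRel H (FreeAlgebra.ι ℂ (Sum.inl (f + g)))
      (FreeAlgebra.ι ℂ (Sum.inl f) + FreeAlgebra.ι ℂ (Sum.inl g))
  | cre_smul (c : ℂ) (f : H) : CCRRel H (FreeAlgebra.ι ℂ (Sum.inl (c • f)))
      (c • FreeAlgebra.ι ℂ (Sum.inl f))
  | ann_add (f g : H) : CCRRel H (FreeAlgebra.ι ℂ (Sum.inr (f + g)))
      (FreeAlgebra.ι ℂ (Sum.inr f) + FreeAlgebra.ι ℂ (Sum.inr g))
  | ann_smul (c : ℂ) (f : H) : CCRRel H (FreeAlgebra.ι ℂ (Sum.inr (c • f)))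
      ((starRingEnd ℂ) c • FreeAlgebra.ι ℂ (Sum.inr f))
  | cre_cre (f g : H) : CCRRel H
      (FreeAlgebra.ι ℂ (Sum.inl f) * FreeAlgebra.ι ℂ (Sum.inl g))
      (FreeAlgebra.ι ℂ (Sum.inl g) * FreeAlgebra.ι ℂ (Sum.inl f))
  | ann_ann (f g : H) : CCRRel H
      (FreeAlgebra.ι ℂ (Sum.inr f) * FreeAlgebra.ι ℂ (Sum.inr g))
      (FreeAlgebra.ι ℂ (Sum.inr g) * FreeAlgebra.ι ℂ (Sum.inr f))
  | ann_cre (f g : H) : CCRRel H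
      (FreeAlgebra.ι ℂ (Sum.inr f) * FreeAlgebra.ι ℂ (Sum.inl g))
      (FreeAlgebra.ι ℂ (Sum.inl g) * FreeAlgebra.ι ℂ (Sum.inr f)
        + algebraMap ℂ (FreeAlgebra ℂ (H ⊕ H)) (inner ℂ f g))

/-- The algebra of polynomials in the creation and annihilation operators over `H`. -/
abbrev CCR (H : Type*) [NormedAddCommGroup H] [InnerProductSpace ℂ H] : Type _ :=
  RingQuot (CCRRel H)

/-- The field operator of a symbol: `A⁺(f)` for `Sum.inl f` and `A(g)` for `Sum.inr g`. -/
def fieldOp (x : H ⊕ H) : CCR H := RingQuot.mkAlgHom ℂ (CCRRel H) (FreeAlgebra.ι ℂ x)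

/-- The creation operator `A⁺(f)`. -/
def creation (f : H) : CCR H := fieldOp (Sum.inl f)

/-- The annihilation operator `A(g)`. -/
def annihilation (g : H) : CCR H := fieldOp (Sum.inr g)

/-! ### The gauge-invariant mean-zero Gaussian state -/

/-- Two-point function of the gauge-invariant Gaussian state with density operator `nhat`:
`ω(A⁺(f) A(g)) = ⟨g, nhat f⟩`, `ω(A(g) A⁺(f)) = ⟨g, f⟩ + ⟨g, nhat f⟩`, and
`ω(A⁺ A⁺) = ω(A A) = 0`. -/
def twoPoint (nhat : H →L[ℂ] H) : H ⊕ H → H ⊕ H → ℂ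
  | Sum.inl f, Sum.inr g => inner ℂ g (nhat f)
  | Sum.inr g, Sum.inl f => inner ℂ g f + inner ℂ g (nhat f)
  | _, _ => 0

/-- The sum over all pair partitions of a word of field operators of the product of the two-point
functions of the pairs (each pair in the order in which it occurs in the word), organised by the
partner of the first letter.  It vanishes on words of odd length. -/
def wickSum (nhat : H →L[ℂ] H) : List (H ⊕ H) → ℂ
  | [] => 1
  | x :: l => ∑ i : Fin l.length, twoPoint nhat x (l.get i) * wickSum nhat (l.eraseIdx i)
termination_by l => l.length
decreasing_by
  have := i.isLt
  rw [List.length_eraseIdx_of_lt this]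
  simp only [List.length_cons]
  omega

/-- `Φ` is the mean-zero gauge-invariant Gaussian functional with two-point function
`ω(A⁺(f) A(g)) = ⟨g, nhat f⟩`: all its moments are given by sums over pair partitions. -/
def IsGaussian (nhat : H →L[ℂ] H) (Φ : CCR H →ₗ[ℂ] ℂ) : Prop :=
  ∀ l : List (H ⊕ H), Φ ((l.map fieldOp).prod) = wickSum nhat l

section Existence

/-! The Gaussian functional exists: it is the vacuum functional of a representation of the CCR
algebra on the polynomial algebra over `H × H'`. -/

variable (nhat : H →L[ℂ] H)

/-- The one-particle space of the representation. -/
abbrev OneP (H : Type*) [NormedAddCommGroup H] [InnerProductSpace ℂ H] : Type _ :=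
  H × (H →L[ℂ] ℂ)

/-- Polynomials over the one-particle space of the representation. -/
abbrev Pol (H : Type*) [NormedAddCommGroup H] [InnerProductSpace ℂ H] : Type _ :=
  SymmetricAlgebra ℂ (OneP H)

/-- Algebra map to the dual numbers whose second component is the directional derivative. -/
def dualHom (lam : OneP H →ₗ[ℂ] ℂ) : Pol H →ₐ[ℂ] TrivSqZeroExt (Pol H) (Pol H) :=
  SymmetricAlgebra.lift
    ((TrivSqZeroExt.inlAlgHom ℂ (Pol H) (Pol H)).toLinearMap ∘ₗ SymmetricAlgebra.ι ℂ (OneP H)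
      + ((TrivSqZeroExt.inrHom (Pol H) (Pol H)).restrictScalars ℂ) ∘ₗ
        (Algebra.linearMap ℂ (Pol H)) ∘ₗ lam)

/-- The directional derivative on polynomials. -/
def der (lam : OneP H →ₗ[ℂ] ℂ) : Pol H →ₗ[ℂ] Pol H :=
  ((TrivSqZeroExt.sndHom (Pol H) (Pol H)).restrictScalars ℂ) ∘ₗ (dualHom lam).toLinearMap

theorem dualHom_fst (lam : OneP H →ₗ[ℂ] ℂ) (p : Pol H) : (dualHom lam p).fst = p := by
  have : (TrivSqZeroExt.fstHom ℂ (Pol H) (Pol H)).comp (dualHom lam) = AlgHom.id ℂ (Pol H) := by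
    apply SymmetricAlgebra.algHom_ext
    ext v <;> simp [dualHom]
  exact congr($this p)

theorem der_ι (lam : OneP H →ₗ[ℂ] ℂ) (v : OneP H) :
    der lam (SymmetricAlgebra.ι ℂ _ v) = algebraMap ℂ (Pol H) (lam v) := by
  simp [der, dualHom, Algebra.algebraMap_eq_smul_one]

theorem der_mul (lam : OneP H →ₗ[ℂ] ℂ) (p q : Pol H) :
    der lam (p * q) = p * der lam q + der lam p * q := by
  simp [der, dualHom_fst, mul_comm]

theorem der_algebraMap (lam : OneP H →ₗ[ℂ] ℂ) (c : ℂ) :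
    der lam (algebraMap ℂ (Pol H) c) = 0 := by
  have h := der_mul lam (1 : Pol H) 1
  simp only [mul_one, one_mul, left_eq_add] at h
  rw [Algebra.algebraMap_eq_smul_one, map_smul, h, smul_zero]

theorem der_comm (lam mu : OneP H →ₗ[ℂ] ℂ) (p : Pol H) :
    der lam (der mu p) = der mu (der lam p) := by
  induction p using SymmetricAlgebra.induction with
  | algebraMap r => simp [der_algebraMap]
  | ι x => simp [der_ι, der_algebraMap]
  | mul a b ha hb => simp only [der_mul, map_add, ha, hb]; ring
  | add a b ha hb => simp only [map_add, ha, hb]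

/-- The vector created by a field operator in the representation. -/
def vec : H ⊕ H → OneP H
  | Sum.inl f => (f, 0)
  | Sum.inr g => (0, innerSL ℂ g)

/-- The functional along which a field operator differentiates in the representation. -/
def func : H ⊕ H → (OneP H →ₗ[ℂ] ℂ)
  | Sum.inl f => (ContinuousLinearMap.apply ℂ ℂ (nhat f)).toLinearMap ∘ₗ LinearMap.snd ℂ _ _
  | Sum.inr g => (innerSL ℂ g + (innerSL ℂ g).comp nhat).toLinearMap ∘ₗ LinearMap.fst ℂ _ _

theorem func_vec (x y : H ⊕ H) : func nhat x (vec y) = twoPoint nhat x y := by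
  rcases x with f | f <;> rcases y with g | g <;> simp [func, vec, twoPoint]

/-- A field operator in the representation: multiplication plus differentiation. -/
def rep (x : H ⊕ H) : Module.End ℂ (Pol H) :=
  LinearMap.mulLeft ℂ (SymmetricAlgebra.ι ℂ _ (vec x)) + der (func nhat x)

theorem rep_apply (x : H ⊕ H) (p : Pol H) :
    rep nhat x p = SymmetricAlgebra.ι ℂ _ (vec x) * p + der (func nhat x) p := rfl

theorem der_rep (lam : OneP H →ₗ[ℂ] ℂ) (x : H ⊕ H) (p : Pol H) :
    der lam (rep nhat x p) = rep nhat x (der lam p) + lam (vec x) • p := by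
  rw [rep_apply, rep_apply, map_add, der_mul, der_ι, der_comm, Algebra.smul_def]
  ring

theorem rep_rep (x y : H ⊕ H) (p : Pol H) :
    rep nhat x (rep nhat y p)
      = rep nhat y (rep nhat x p) + (twoPoint nhat x y - twoPoint nhat y x) • p := by
  rw [rep_apply nhat x, der_rep, rep_apply nhat x, map_add, func_vec, rep_apply nhat y,
    rep_apply nhat y (_ * _), der_mul, der_ι, func_vec, sub_smul, Algebra.smul_def,
    Algebra.smul_def]
  ring

theorem der_add_func (lam mu : OneP H →ₗ[ℂ] ℂ) (p : Pol H) :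
    der (lam + mu) p = der lam p + der mu p := by
  induction p using SymmetricAlgebra.induction with
  | algebraMap r => simp [der_algebraMap]
  | ι x => simp [der_ι]
  | mul a b ha hb => simp only [der_mul, ha, hb]; ring
  | add a b ha hb => simp only [map_add, ha, hb]; ring

theorem der_smul_func (c : ℂ) (lam : OneP H →ₗ[ℂ] ℂ) (p : Pol H) :
    der (c • lam) p = c • der lam p := by
  induction p using SymmetricAlgebra.induction with
  | algebraMap r => simp [der_algebraMap]
  | ι x => simp [der_ι, Algebra.smul_def]
  | mul a b ha hb => simp only [der_mul, ha, hb, Algebra.smul_def]; ring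
  | add a b ha hb => simp only [map_add, ha, hb, smul_add]

theorem rep_add (x y z : H ⊕ H) (hv : vec x = vec y + vec z)
    (hf : func nhat x = func nhat y + func nhat z) : rep nhat x = rep nhat y + rep nhat z := by
  ext1 p
  change rep nhat x p = rep nhat y p + rep nhat z p
  simp only [rep_apply, hv, hf, der_add_func, map_add]
  ring

theorem rep_smul (x y : H ⊕ H) (c : ℂ) (hv : vec x = c • vec y)
    (hf : func nhat x = c • func nhat y) : rep nhat x = c • rep nhat y := by
  ext1 p
  change rep nhat x p = c • rep nhat y p
  simp only [rep_apply, hv, hf, der_smul_func, map_smul, Algebra.smul_def]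
  ring

/-- The representation of the CCR algebra. -/
def repHom : CCR H →ₐ[ℂ] Module.End ℂ (Pol H) :=
  RingQuot.liftAlgHom ℂ ⟨FreeAlgebra.lift ℂ (rep nhat), by
    intro a b h
    induction h with
    | cre_add f g =>
      simpa using rep_add nhat (Sum.inl (f + g)) (Sum.inl f) (Sum.inl g)
        (by simp [vec]) (by ext <;> simp [func])
    | cre_smul c f =>
      simpa using rep_smul nhat (Sum.inl (c • f)) (Sum.inl f) c
        (Prod.ext rfl (by ext; simp [vec])) (by ext <;> simp [func])
    | ann_add f g =>
      simpa using rep_add nhat (Sum.inr (f + g)) (Sum.inr f) (Sum.inr g)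
        (by simp [vec]) (by ext <;> simp [func]; ring)
    | ann_smul c f =>
      simpa using rep_smul nhat (Sum.inr (c • f)) (Sum.inr f) ((starRingEnd ℂ) c)
        (Prod.ext (smul_zero _).symm (map_smulₛₗ (innerSL ℂ) c f)) (by ext <;> simp [func]; ring)
    | cre_cre f g =>
      ext1 p
      simpa [twoPoint] using rep_rep nhat (Sum.inl f) (Sum.inl g) p
    | ann_ann f g =>
      ext1 p
      simpa [twoPoint] using rep_rep nhat (Sum.inr f) (Sum.inr g) p
    | ann_cre f g =>
      ext1 p
      simpa [twoPoint, Algebra.algebraMap_eq_smul_one] using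
        rep_rep nhat (Sum.inr f) (Sum.inl g) p⟩

theorem repHom_fieldOp (x : H ⊕ H) : repHom nhat (fieldOp x) = rep nhat x := by
  simp [repHom, fieldOp]

/-- The vacuum functional of the representation. -/
def vacuum : CCR H →ₗ[ℂ] ℂ :=
  (SymmetricAlgebra.algebraMapInv (R := ℂ) (M := OneP H)).toLinearMap ∘ₗ
    (LinearMap.applyₗ (1 : Pol H)) ∘ₗ (repHom nhat).toLinearMap

theorem vacuum_word (l : List (H ⊕ H)) :
    vacuum nhat ((l.map fieldOp).prod)
      = SymmetricAlgebra.algebraMapInv ((l.map (rep nhat)).prod 1) := by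
  have : repHom nhat ((l.map fieldOp).prod) = (l.map (rep nhat)).prod := by
    rw [map_list_prod, List.map_map]
    congr 1
    exact List.map_congr_left fun x _ => repHom_fieldOp nhat x
  simp [vacuum, this]

theorem der_word (lam : OneP H →ₗ[ℂ] ℂ) (l : List (H ⊕ H)) :
    der lam ((l.map (rep nhat)).prod 1)
      = ∑ i : Fin l.length, lam (vec (l.get i)) • (((l.eraseIdx i).map (rep nhat)).prod 1) := by
  induction l with
  | nil => simpa using der_algebraMap lam 1
  | cons x l ih =>
    refine Eq.trans ?_ (Fin.sum_univ_succ (n := l.length) (fun i => lam (vec ((x :: l).get i)) •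
      ((((x :: l).eraseIdx i).map (rep nhat)).prod 1))).symm
    rw [List.map_cons, List.prod_cons, Module.End.mul_apply, der_rep, ih, map_sum, add_comm]
    simp

theorem isGaussian_vacuum : IsGaussian nhat (vacuum nhat) := by
  have key : ∀ (m : ℕ) (l : List (H ⊕ H)), l.length = m →
      SymmetricAlgebra.algebraMapInv ((l.map (rep nhat)).prod 1) = wickSum nhat l := by
    intro m
    induction m using Nat.strong_induction_on with
    | _ m ih =>
      intro l hl
      cases l with
      | nil => simp [wickSum]
      | cons x l =>
        rw [List.map_cons, List.prod_cons, Module.End.mul_apply, rep_apply, der_word, map_add,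
          map_mul, SymmetricAlgebra.algebraMapInv_ι, zero_mul, zero_add, map_sum, wickSum]
        refine Finset.sum_congr rfl fun i _ => ?_
        rw [map_smul, func_vec, smul_eq_mul, ih _ _ _ rfl]
        rw [List.length_eraseIdx_of_lt i.isLt, ← hl, List.length_cons]
        have := i.isLt
        omega
  intro l
  rw [vacuum_word, key _ l rfl]

end Existence

theorem exists_isGaussian (nhat : H →L[ℂ] H) : ∃ Φ : CCR H →ₗ[ℂ] ℂ, IsGaussian nhat Φ :=
  ⟨_, isGaussian_vacuum nhat⟩

/-- A linear functional on the CCR algebra is determined by its values on words, so there is only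
one Gaussian functional with a given two-point function. -/
theorem isGaussian_unique {nhat : H →L[ℂ] H} {Φ Ψ : CCR H →ₗ[ℂ] ℂ} (h : IsGaussian nhat Φ)
    (h' : IsGaussian nhat Ψ) : Φ = Ψ := by
  have key : ∀ (a : FreeAlgebra ℂ (H ⊕ H)) (u : CCR H),
      (∀ l : List (H ⊕ H), Φ (u * (l.map fieldOp).prod) = Ψ (u * (l.map fieldOp).prod)) →
      ∀ l : List (H ⊕ H), Φ (u * RingQuot.mkAlgHom ℂ (CCRRel H) a * (l.map fieldOp).prod)
        = Ψ (u * RingQuot.mkAlgHom ℂ (CCRRel H) a * (l.map fieldOp).prod) := by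
    intro a
    induction a using FreeAlgebra.induction with
    | grade0 r =>
      intro u hu l
      simp only [Algebra.algebraMap_eq_smul_one, map_smul, map_one, mul_smul_comm, smul_mul_assoc,
        mul_one, hu l]
    | grade1 x =>
      intro u hu l
      simpa [fieldOp, mul_assoc] using hu (x :: l)
    | mul a b ha hb =>
      intro u hu l
      simpa [mul_assoc] using hb _ (ha u hu) l
    | add a b ha hb =>
      intro u hu l
      simp only [map_add, mul_add, add_mul, ha u hu l, hb u hu l]
  ext x
  obtain ⟨a, rfl⟩ := RingQuot.mkAlgHom_surjective ℂ (CCRRel H) x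
  simpa using key a 1 (fun l => by rw [one_mul, h l, h' l]) []

/-- The mean-zero gauge-invariant Gaussian state `ω_nhat` on the CCR algebra with
`ω_nhat(A⁺(f) A(g)) = ⟨g, nhat f⟩`. -/
def gaussianState (nhat : H →L[ℂ] H) : CCR H →ₗ[ℂ] ℂ := Classical.choose (exists_isGaussian nhat)

theorem isGaussian_gaussianState (nhat : H →L[ℂ] H) : IsGaussian nhat (gaussianState nhat) :=
  Classical.choose_spec (exists_isGaussian nhat)

/-! ### Trace class operators and second quantization -/

/-- `T = ∑ₖ |f k⟩⟨g k|` with `∑ ‖f k‖² < ∞` and `∑ ‖g k‖² < ∞`. -/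
structure IsNuclearExpansion (T : H →L[ℂ] H) (f g : ℕ → H) : Prop where
  summable_left : Summable fun k => ‖f k‖ ^ 2
  summable_right : Summable fun k => ‖g k‖ ^ 2
  hasSum : ∀ x, HasSum (fun k => inner ℂ (g k) x • f k) (T x)

/-- Trace class operators on a Hilbert space: the operators with a nuclear expansion. -/
def IsTraceClass (T : H →L[ℂ] H) : Prop := ∃ f g : ℕ → H, IsNuclearExpansion T f g

open Classical in
/-- Some nuclear expansion of a trace class operator. -/
def nuclearExpansion (T : H →L[ℂ] H) : (ℕ → H) × (ℕ → H) :=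
  if h : ∃ p : (ℕ → H) × (ℕ → H), IsNuclearExpansion T p.1 p.2 then h.choose else 0

/-- The second quantization `N(T_M) = ∑_{k < M} A⁺(f k) A(g k)` of the finite rank truncation
`T_M = ∑_{k < M} |f k⟩⟨g k|` of a trace class operator `T`. -/
def numberOp (T : H →L[ℂ] H) (M : ℕ) : CCR H :=
  ∑ k ∈ Finset.range M,
    creation ((nuclearExpansion T).1 k) * annihilation ((nuclearExpansion T).2 k)

/-! ### The one-particle evolution and the spectral projections `P_E` -/

/-- `S` is a strongly continuous one-parameter unitary group. -/
structure IsUnitaryGroup [CompleteSpace H] (S : ℝ → H →L[ℂ] H) : Prop where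
  map_zero : S 0 = 1
  map_add : ∀ s t, S (s + t) = S s * S t
  mem_unitary : ∀ t, S t ∈ unitary (H →L[ℂ] H)
  continuous : ∀ x, Continuous fun t => S t x

/-- The function `E ↦ ρ E` is the matrix element `⟨g, P_E f⟩` of
`P_E = (2π)⁻¹ ∫ S_t e^{-itE} dt`, where the integral over `t` is understood in the sense of
distributions in `E`. -/
def IsEnergyElement (S : ℝ → H →L[ℂ] H) (g f : H) (ρ : ℝ → ℂ) : Prop :=
  Integrable ρ ∧ ∀ φ : SchwartzMap ℝ ℂ,
    ∫ E : ℝ, ρ E * φ E =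
      (2 * (Real.pi : ℂ))⁻¹ *
        ∫ t : ℝ, inner ℂ g (S t f) * ∫ E : ℝ, Complex.exp (-(Complex.I * t * E)) * φ E

open Classical in
/-- The matrix element `⟨g, P_E f⟩`, a function of `E` defined up to null sets
(`0` if it does not exist as an integrable function). -/
def energyElement (S : ℝ → H →L[ℂ] H) (E : ℝ) (g f : H) : ℂ :=
  if h : ∃ ρ : ℝ → ℂ, IsEnergyElement S g f ρ then h.choose E else 0

/-- The matrix elements `⟨f k, P_E f k⟩` exist and their sum over `k` is in `L^n(dE)`. -/
def HasEnergyDensity (S : ℝ → H →L[ℂ] H) (n : ℕ) (f : ℕ → H) : Prop :=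
  (∀ k, ∃ ρ : ℝ → ℂ, IsEnergyElement S (f k) (f k) ρ) ∧
    ∫⁻ E : ℝ, (∑' k, ‖energyElement S E (f k) (f k)‖ₑ) ^ n < ⊤

/-! ### Correlation functions -/

/-- The rescaled number operator
`N_{T,ω,ε}(t) = ε⁻¹ e^{-itω/ε} N(S_{t/ε} T S_{-t/ε})`, truncated at rank `M`. -/
def rescaledNumberOp (S : ℝ → H →L[ℂ] H) (T : H →L[ℂ] H) (ω ε t : ℝ) (M : ℕ) : CCR H :=
  (Complex.exp (-(Complex.I * t * ω / ε)) / ε) • numberOp (S (t / ε) * T * S (-t / ε)) M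

/-- The correlation function `ω_{ε nhat}(N_{i₁}(t_{i₁}) ⋯ N_{iₘ}(t_{iₘ}))` of the operators
`N_l(t_l) = N_{T_l,ω_l,ε}(t_l)`, where `i₁ < ⋯ < iₘ` are the elements of `I`.  The second
quantization of a trace class operator is the limit of those of its finite rank truncations. -/
def correlation (S : ℝ → H →L[ℂ] H) (nhat : H →L[ℂ] H) {n : ℕ} (T : Fin n → H →L[ℂ] H)
    (ω : Fin n → ℝ) (ε : ℝ) (t : Fin n → ℝ) (I : Finset (Fin n)) : ℂ :=
  limUnder atTop fun M : ℕ => gaussianState ((ε : ℂ) • nhat)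
    (((I.sort (· ≤ ·)).map fun l => rescaledNumberOp S (T l) (ω l) ε (t l) M).prod)

/-- Truncation of a family `W` indexed by finite sets, by induction:
`W I = ∑_π ∏_{B ∈ π} Wᵀ B`, the sum being over all partitions `π` of `I` into nonempty blocks. -/
def truncated {ι : Type*} [DecidableEq ι] (W : Finset ι → ℂ) (I : Finset ι) : ℂ :=
  W I - ∑ π : {π : Finpartition I // 2 ≤ π.parts.card},
    ∏ B : {B : Finset ι // B ∈ π.1.parts}, truncated W B.1
termination_by I.card
decreasing_by
  refine Finset.card_lt_card (lt_of_le_of_ne (π.1.le B.2) fun h => ?_)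
  have h1 : π.1.parts ⊆ {I} := by
    intro C hC
    rw [Finset.mem_singleton]
    by_contra hne
    have hd : Disjoint C B.1 := π.1.disjoint hC B.2 (fun hCB => hne (hCB.trans h))
    rw [h] at hd
    exact π.1.ne_bot hC (disjoint_self.mp (hd.mono_right (π.1.le hC)))
  have h2 := Finset.card_le_card h1
  have h3 := π.2
  simp only [Finset.card_singleton] at h2
  omega

/-- The truncated correlation function `Wᵀ_ε(t₁, …, tₙ)`. -/
def truncatedCorrelation (S : ℝ → H →L[ℂ] H) (nhat : H →L[ℂ] H) {n : ℕ}
    (T : Fin n → H →L[ℂ] H) (ω : Fin n → ℝ) (ε : ℝ) (t : Fin n → ℝ) : ℂ :=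
  truncated (correlation S nhat T ω ε t) Finset.univ

/-! ### The limit -/

/-- The partial sums `ω̃_l = ω_l + ω_{l+1} + ⋯ + ω_n`. -/
def tailFreq {n : ℕ} (ω : Fin n → ℝ) (l : Fin n) : ℝ := ∑ k ∈ Finset.Ici l, ω k

/-- The term with indices `k` of the expansion of `Tr[nhat P_{E+ω̃₁} T₁ ⋯ P_{E+ω̃ₙ} Tₙ]` for
`T_l = ∑ₖ |f l k⟩⟨g l k|`:
`⟨gₙ, nhat P_{E+ω̃₁} f₁⟩ ⟨g₁, P_{E+ω̃₂} f₂⟩ ⋯ ⟨gₙ₋₁, P_{E+ω̃ₙ} fₙ⟩`, where `nhat` commutes with `P_E`.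
The positions `1, …, n` are `0, …, n - 1` here, and `l - 1` is cyclic. -/
def traceTerm (S : ℝ → H →L[ℂ] H) (nhat : H →L[ℂ] H) {n : ℕ} [NeZero n] (ω : Fin n → ℝ)
    (f g : Fin n → ℕ → H) (E : ℝ) (k : Fin n → ℕ) : ℂ :=
  ∏ l : Fin n, energyElement S (E + tailFreq ω l) (g (l - 1) (k (l - 1)))
    (if l = 0 then nhat (f l (k l)) else f l (k l))

/-- `Tr[nhat P_{E+ω̃₁} T₁ P_{E+ω̃₂} T₂ ⋯ P_{E+ω̃ₙ} Tₙ]` for `T_l = ∑ₖ |f l k⟩⟨g l k|`. -/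
def traceDensity (S : ℝ → H →L[ℂ] H) (nhat : H →L[ℂ] H) {n : ℕ} [NeZero n] (ω : Fin n → ℝ)
    (f g : Fin n → ℕ → H) (E : ℝ) : ℂ :=
  ∑' k : Fin n → ℕ, traceTerm S nhat ω f g E k

end LowDensity

end

/-!
The truncated correlation functions of the quadratic operators `N_l = N_{T_l,ω_l,ε}(t_l)` in a
gauge-invariant Gaussian state are sums over cycles.  By Wick's theorem the moment of
`∏ A⁺(f_l) A(g_l)` is a sum over the permutations of the labels (`wickSum_sorted`), where the
contraction of `A(g_q)` with `A⁺(f_p)` is `⟨g_q, (1 + ε nhat) f_p⟩` for `q < p` and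
`⟨g_q, ε nhat f_p⟩` for `q ≥ p`.  Splitting off the cycle through one label gives a recursion
(`matchingMoment_insert`) which is also the recursion that determines the truncated functions
(`truncated_eq_of_expansion`).  The contribution of a cycle is a trace of a product of the operators
`S_{t/ε} T_l S_{-t/ε}`, so it is continuous in the trace class operators and does not depend on the
chosen nuclear expansions (`IsNuclearExpansion.tsum_inner_eq`).  Hence `Wᵀ_ε(t)` is a finite sum of
cyclic sums `∑_k ∏_l ⟨S_{t_{l-1}/ε} g_{l-1}, S_{t_l/ε} f'_l⟩`, with `f'_l` equal to `f_l` or to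
`nhat f_l`, over the cyclic orders of the labels, each with the factor `ε^{r-n}`, where `r` is the
number of factors `nhat` (`truncatedCorrelation_eq_sum`).

Every cycle has at least one descent, so `r ≥ 1`, and `r = 1` occurs only for the cycle in the
increasing order with all factors `nhat` but one dropped.  Since `ε^{1-n}` times the integral of a
cyclic sum against a Schwartz function converges (`cyclicSum_limit`), all other terms vanish in the
limit.

For the convergence, `⟨g, S_t f⟩` is the Fourier transform of the density `⟨g, P_E f⟩`, so that the
integral against a Schwartz function `φ` is, with `Ψ(x) = ∑_k ∏_l ⟨g_{l-1}, P_{x_l} f_l⟩`,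
`ε^{1-n} ∫ Ψ(x) φ̂((x_l - x_{l+1} - ω_l)/ε) dx`.  The substitution `x_l = E + ω̃_l + ε v_l` turns it
into an integral over `v` of `φ̂` against `∫ Ψ(E + ω̃ + ε v) dE`.  The latter is a bounded continuous
function of the translation vector: the Cauchy–Schwarz inequality
`|⟨g, P_E f⟩|² ≤ ⟨g, P_E g⟩ ⟨f, P_E f⟩` (`IsEnergyElement.ae_norm_sq_le`) bounds `Ψ` by a product of
functions in `Lⁿ`, one of each variable, and translations are continuous in `Lⁿ`
(`IsChainKernel.continuous_integral_translate`).  The differences `x_l - x_{l+1} - ω_l` add up to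
`-ω̃_1`, so `φ̂` moves off to infinity unless `ω̃_1 = 0`; in that case the remaining integral of `φ̂`
over the hyperplane of sum zero is `(2π)^{n-1} ∫ φ(s, …, s) ds`
(`integral_phaseIntegral_cyclicDiff`), and `v` drops out of `Ψ` (`IsChainKernel.tendsto_integral`).
-/

noncomputable section

namespace LowDensity

/-! ### Densities of the energy distribution -/

section

open scoped FourierTransform ComplexConjugate

section FourierWeight

/-- The function `ψ` with `φ E = ∫ ψ t e^{itE} dt`, for a Schwartz function `φ`. -/
def fourierWeight (φ : SchwartzMap ℝ ℂ) (t : ℝ) : ℂ :=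
  (2 * (Real.pi : ℂ))⁻¹ * ∫ E : ℝ, Complex.exp (-(Complex.I * t * E)) * φ E

theorem fourierWeight_eq (φ : SchwartzMap ℝ ℂ) (t : ℝ) :
    fourierWeight φ t = (2 * (Real.pi : ℂ))⁻¹ * (𝓕 φ : SchwartzMap ℝ ℂ) ((2 * Real.pi)⁻¹ * t) := by
  rw [fourierWeight, SchwartzMap.fourier_coe, Real.fourier_real_eq_integral_exp_smul]
  congr 1
  refine integral_congr_ae (Eventually.of_forall fun E => ?_)
  simp only [smul_eq_mul]
  congr 2
  have : (Real.pi : ℂ) ≠ 0 := by exact_mod_cast Real.pi_ne_zero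
  push_cast
  field_simp

theorem integrable_fourierWeight (φ : SchwartzMap ℝ ℂ) : Integrable (fourierWeight φ) := by
  rw [show fourierWeight φ = _ from funext (fourierWeight_eq φ)]
  exact ((SchwartzMap.integrable (𝓕 φ : SchwartzMap ℝ ℂ)).comp_mul_left'
    (inv_ne_zero (by positivity : (2 * Real.pi) ≠ 0))).const_mul _

theorem integral_mul_fourierWeight (d : ℝ → ℂ) (φ : SchwartzMap ℝ ℂ) :
    ∫ t, d t * fourierWeight φ t = ∫ s, d (2 * Real.pi * s) * (𝓕 φ : SchwartzMap ℝ ℂ) s := by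
  have h := Measure.integral_comp_mul_left
    (fun t => d t * (𝓕 φ : SchwartzMap ℝ ℂ) ((2 * Real.pi)⁻¹ * t)) (2 * Real.pi)
  have hpi : (2 * Real.pi) ≠ 0 := by positivity
  simp only [inv_mul_cancel_left₀ hpi] at h
  rw [h, abs_of_pos (by positivity), ← integral_smul]
  refine integral_congr_ae (Eventually.of_forall fun t => ?_)
  simp only [fourierWeight_eq, Complex.real_smul]
  push_cast
  ring

theorem integral_fourierWeight_mul_exp (φ : SchwartzMap ℝ ℂ) (E : ℝ) :
    ∫ t : ℝ, fourierWeight φ t * Complex.exp (Complex.I * t * E) = φ E := by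
  simp_rw [mul_comm (fourierWeight φ _)]
  rw [integral_mul_fourierWeight (fun t : ℝ => Complex.exp (Complex.I * t * E))]
  have h := congr($(FourierTransform.fourierInv_fourier_eq (F := SchwartzMap ℝ ℂ) φ) E)
  rw [SchwartzMap.fourierInv_coe, Real.fourierInv_eq'] at h
  rw [← h]
  refine integral_congr_ae (Eventually.of_forall fun t => ?_)
  simp only [smul_eq_mul]
  congr 2
  simp
  ring

end FourierWeight

theorem norm_exp_I (t E : ℝ) : ‖Complex.exp (Complex.I * t * E)‖ = 1 := by
  rw [show Complex.I * t * E = ((t * E : ℝ) : ℂ) * Complex.I by push_cast; ring]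
  exact Complex.norm_exp_ofReal_mul_I _

theorem integrable_mul_exp {ρ : ℝ → ℂ} (hρ : Integrable ρ) (t : ℝ) :
    Integrable fun E : ℝ => ρ E * Complex.exp (Complex.I * t * E) := by
  refine hρ.mul_bdd (c := 1) (by fun_prop) (Eventually.of_forall fun E => ?_)
  rw [norm_exp_I]

theorem continuous_integral_mul_exp {ρ : ℝ → ℂ} (hρ : Integrable ρ) :
    Continuous fun t : ℝ => ∫ E : ℝ, ρ E * Complex.exp (Complex.I * t * E) := by
  refine continuous_of_dominated (bound := fun E => ‖ρ E‖)
    (fun t => (integrable_mul_exp hρ t).aestronglyMeasurable)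
    (fun t => Eventually.of_forall fun E => ?_) hρ.norm (Eventually.of_forall fun E => by fun_prop)
  rw [norm_mul, norm_exp_I, mul_one]

theorem integral_integral_mul_exp {ρ ψ : ℝ → ℂ} (hρ : Integrable ρ) (hψ : Integrable ψ) :
    ∫ t : ℝ, ψ t * ∫ E : ℝ, ρ E * Complex.exp (Complex.I * t * E)
      = ∫ E : ℝ, ρ E * ∫ t : ℝ, ψ t * Complex.exp (Complex.I * t * E) := by
  simp_rw [← integral_const_mul]
  rw [integral_integral_swap]
  · refine integral_congr_ae (Eventually.of_forall fun E => ?_)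
    refine integral_congr_ae (Eventually.of_forall fun t => ?_)
    ring
  · have h : Integrable (fun p : ℝ × ℝ => ψ p.1 * ρ p.2) (volume.prod volume) := hψ.mul_prod hρ
    have h2 := h.mul_bdd (c := 1) (g := fun p : ℝ × ℝ => Complex.exp (Complex.I * p.1 * p.2))
      (by fun_prop) (Eventually.of_forall fun p => by rw [norm_exp_I])
    refine h2.congr (Eventually.of_forall fun p => ?_)
    simp only [Function.uncurry]
    ring

variable {H : Type*} [NormedAddCommGroup H] [InnerProductSpace ℂ H]

theorem IsEnergyElement.integral_mul {S : ℝ → H →L[ℂ] H} {g f : H} {ρ : ℝ → ℂ}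
    (h : IsEnergyElement S g f ρ) (φ : SchwartzMap ℝ ℂ) :
    ∫ E, ρ E * φ E = ∫ t, inner ℂ g (S t f) * fourierWeight φ t := by
  rw [h.2 φ, ← integral_const_mul]
  refine integral_congr_ae (Eventually.of_forall fun t => ?_)
  simp only [fourierWeight]
  ring

/-- The fundamental lemma of the calculus of variations for Schwartz functions. -/
theorem ae_eq_zero_of_integral_schwartz {d : ℝ → ℂ} (hd : LocallyIntegrable d)
    (h : ∀ φ : SchwartzMap ℝ ℂ, ∫ E, d E * φ E = 0) : ∀ᵐ E, d E = 0 := by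
  refine ae_eq_zero_of_integral_contDiff_smul_eq_zero hd fun χ h1 h2 => ?_
  have h3 : HasCompactSupport fun x => (χ x : ℂ) := h2.comp_left (g := Complex.ofReal) (by simp)
  have h4 : ContDiff ℝ (⊤ : ℕ∞) fun x => (χ x : ℂ) := Complex.ofRealCLM.contDiff.comp h1
  have := h (h3.toSchwartzMap h4)
  rw [← this]
  refine integral_congr_ae (Eventually.of_forall fun t => ?_)
  simp [mul_comm]

theorem IsEnergyElement.ae_eq {S : ℝ → H →L[ℂ] H} {g f : H} {ρ ρ' : ℝ → ℂ}
    (h : IsEnergyElement S g f ρ) (h' : IsEnergyElement S g f ρ') : ρ =ᵐ[volume] ρ' := by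
  have := ae_eq_zero_of_integral_schwartz (d := fun E => ρ E - ρ' E)
    (h.1.sub h'.1).locallyIntegrable fun φ => by
      simp_rw [sub_mul]
      have hφ : ∃ C, ∀ E, ‖φ E‖ ≤ C := by
        obtain ⟨C, hC⟩ := φ.decay 0 0
        exact ⟨C, fun E => by simpa using hC.2 E⟩
      obtain ⟨C, hC⟩ := hφ
      rw [integral_sub (h.1.mul_bdd φ.continuous.aestronglyMeasurable (Eventually.of_forall hC))
        (h'.1.mul_bdd φ.continuous.aestronglyMeasurable (Eventually.of_forall hC)),
        h.integral_mul, h'.integral_mul, sub_self]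
  filter_upwards [this] with E hE using sub_eq_zero.mp hE

variable [CompleteSpace H]

theorem IsUnitaryGroup.norm_apply {S : ℝ → H →L[ℂ] H} (hS : IsUnitaryGroup S) (t : ℝ) (x : H) :
    ‖S t x‖ = ‖x‖ :=
  ContinuousLinearMap.norm_map_of_mem_unitary (hS.mem_unitary t) x

theorem IsUnitaryGroup.inner_apply {S : ℝ → H →L[ℂ] H} (hS : IsUnitaryGroup S) (s t : ℝ)
    (x y : H) : inner ℂ (S s x) (S t y) = inner ℂ x (S (t - s) y) := by
  rw [show S t y = S s (S (t - s) y) by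
    rw [← mul_apply_eq_comp, ← hS.map_add, add_sub_cancel]]
  exact ContinuousLinearMap.inner_map_map_of_mem_unitary (hS.mem_unitary s) _ _

/-- The density of `⟨g, P_E f⟩` is the function with Fourier transform `t ↦ ⟨g, S_t f⟩`.  The
identity of distributions holds at every `t` since both sides are continuous. -/
theorem isEnergyElement_iff {S : ℝ → H →L[ℂ] H} (hS : IsUnitaryGroup S) {g f : H} {ρ : ℝ → ℂ} :
    IsEnergyElement S g f ρ ↔ Integrable ρ ∧
      ∀ t : ℝ, inner ℂ g (S t f) = ∫ E : ℝ, ρ E * Complex.exp (Complex.I * t * E) := by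
  have key : ∀ {ρ : ℝ → ℂ}, Integrable ρ → ∀ φ : SchwartzMap ℝ ℂ,
      ∫ E, ρ E * φ E = ∫ t : ℝ, (∫ E : ℝ, ρ E * Complex.exp (Complex.I * t * E))
        * fourierWeight φ t := by
    intro ρ hρ φ
    simp_rw [mul_comm _ (fourierWeight φ _)]
    rw [integral_integral_mul_exp hρ (integrable_fourierWeight φ)]
    simp_rw [integral_fourierWeight_mul_exp]
  have hcont : Continuous fun t => inner ℂ g (S t f) := continuous_const.inner (hS.continuous f)
  constructor
  · intro h
    refine ⟨h.1, ?_⟩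
    have hc := continuous_integral_mul_exp h.1
    set k : ℝ → ℂ := fun t => ∫ E : ℝ, ρ E * Complex.exp (Complex.I * t * E) with hk
    have hd : Continuous fun s : ℝ => inner ℂ g (S (2 * Real.pi * s) f) - k (2 * Real.pi * s) :=
      (hcont.sub hc).comp (continuous_const.mul continuous_id)
    have hz := ae_eq_zero_of_integral_schwartz hd.locallyIntegrable fun φ => by
      obtain ⟨φ', rfl⟩ : ∃ φ' : SchwartzMap ℝ ℂ, 𝓕 φ' = φ :=
        ⟨_, FourierTransform.fourier_fourierInv_eq (E := SchwartzMap ℝ ℂ) φ⟩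
      rw [← integral_mul_fourierWeight (fun s => inner ℂ g (S s f) - k s)]
      simp_rw [sub_mul]
      have hi := integrable_fourierWeight φ'
      rw [integral_sub, ← h.integral_mul, key h.1, sub_self]
      · refine hi.bdd_mul (c := ‖g‖ * ‖f‖) hcont.aestronglyMeasurable
          (Eventually.of_forall fun t => ?_)
        rw [← hS.norm_apply t f]
        exact norm_inner_le_norm _ _
      · refine hi.bdd_mul (c := ∫ E, ‖ρ E‖) hc.aestronglyMeasurable
          (Eventually.of_forall fun t => ?_)
        refine (norm_integral_le_integral_norm _).trans_eq ?_
        simp_rw [norm_mul, norm_exp_I, mul_one]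
    have := Continuous.ae_eq_iff_eq volume hd continuous_const |>.mp hz
    intro t
    have h2 := congrFun this ((2 * Real.pi)⁻¹ * t)
    simp only [mul_inv_cancel_left₀ (by positivity : (2 * Real.pi) ≠ 0)] at h2
    exact sub_eq_zero.mp h2
  · rintro ⟨h1, h2⟩
    refine ⟨h1, fun φ => ?_⟩
    rw [key h1 φ, ← integral_const_mul]
    refine integral_congr_ae (Eventually.of_forall fun t => ?_)
    simp only [fourierWeight, h2 t]
    ring

end

/-! ### Positivity, domination and existence of the energy densities -/

section

open scoped FourierTransform ComplexConjugate ComplexOrder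

variable {H : Type*} [NormedAddCommGroup H] [InnerProductSpace ℂ H]

/-- The vector `φ(h) f = ∫ ψ(t) S_t f dt` for the generator `h` of `S` and a Schwartz function
`φ` with Fourier weight `ψ`. -/
def smeared (S : ℝ → H →L[ℂ] H) (φ : SchwartzMap ℝ ℂ) (f : H) : H :=
  ∫ t : ℝ, fourierWeight φ t • S t f

section

variable [CompleteSpace H]

theorem integrable_fourierWeight_smul {S : ℝ → H →L[ℂ] H} (hS : IsUnitaryGroup S)
    (φ : SchwartzMap ℝ ℂ) (f : H) : Integrable fun t : ℝ => fourierWeight φ t • S t f := by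
  refine (integrable_fourierWeight φ).smul_bdd ‖f‖
    (hS.continuous f).aestronglyMeasurable (Eventually.of_forall fun t => ?_)
  rw [hS.norm_apply]

/-- `⟨φ(h) g, φ(h) f⟩ = ∫ ⟨g, P_E f⟩ |φ(E)|² dE`. -/
theorem inner_smeared_smeared {S : ℝ → H →L[ℂ] H} (hS : IsUnitaryGroup S) {g f : H} {ρ : ℝ → ℂ}
    (h : IsEnergyElement S g f ρ) (φ : SchwartzMap ℝ ℂ) :
    inner ℂ (smeared S φ g) (smeared S φ f) = ∫ E, ρ E * (φ E * conj (φ E)) := by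
  obtain ⟨h1, h2⟩ := (isEnergyElement_iff hS).1 h
  have hφ : ∃ C, ∀ E, ‖φ E‖ ≤ C := by
    obtain ⟨C, hC⟩ := φ.decay 0 0
    exact ⟨C, fun E => by simpa using hC.2 E⟩
  obtain ⟨C, hC⟩ := hφ
  have h3 : Integrable fun E => ρ E * φ E :=
    h1.mul_bdd φ.continuous.aestronglyMeasurable (Eventually.of_forall hC)
  have hstep : ∀ s : ℝ, inner ℂ (S s g) (smeared S φ f)
      = conj (∫ E, conj (ρ E * φ E) * Complex.exp (Complex.I * s * E)) := by
    intro s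
    rw [smeared, ← integral_inner (integrable_fourierWeight_smul hS φ f), ← integral_conj]
    simp_rw [inner_smul_right, hS.inner_apply, h2]
    have := integral_integral_mul_exp (ρ := fun E => ρ E * Complex.exp (Complex.I * (-s : ℝ) * E))
      (integrable_mul_exp h1 (-s)) (integrable_fourierWeight φ)
    simp_rw [integral_fourierWeight_mul_exp] at this
    have e : (∫ t : ℝ, fourierWeight φ t *
        ∫ E : ℝ, ρ E * Complex.exp (Complex.I * ((t - s : ℝ) : ℂ) * E))
        = ∫ t : ℝ, fourierWeight φ t * ∫ E : ℝ, ρ E * Complex.exp (Complex.I * (-s : ℝ) * E)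
          * Complex.exp (Complex.I * t * E) := by
      refine integral_congr_ae (Eventually.of_forall fun t => ?_)
      simp only [mul_assoc, ← Complex.exp_add]
      congr 2
      ext E
      congr 2
      push_cast
      ring
    rw [e, this]
    refine integral_congr_ae (Eventually.of_forall fun E => ?_)
    simp only [map_mul, Complex.conj_conj, ← Complex.exp_conj, Complex.conj_I,
      Complex.conj_ofReal, Complex.ofReal_neg]
    rw [mul_right_comm]
    congr 2
    ring
  rw [← inner_conj_symm, show inner ℂ (smeared S φ f) (smeared S φ g) = _ from
    (integral_inner (integrable_fourierWeight_smul hS φ g) (smeared S φ f)).symm, ← integral_conj]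
  simp_rw [inner_smul_right]
  have : ∀ t : ℝ, inner ℂ (smeared S φ f) (S t g)
      = ∫ E, conj (ρ E * φ E) * Complex.exp (Complex.I * t * E) := fun t => by
    rw [← inner_conj_symm, hstep, Complex.conj_conj]
  change ∫ t, conj (fourierWeight φ t * inner ℂ (smeared S φ f) (S t g)) = _
  rw [integral_conj]
  simp_rw [this]
  have h4 : Integrable fun E => conj (ρ E * φ E) :=
    (Complex.conjCLE.toContinuousLinearMap.integrable_comp h3 :)
  rw [integral_integral_mul_exp h4 (integrable_fourierWeight φ), ← integral_conj]
  simp_rw [integral_fourierWeight_mul_exp]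
  refine integral_congr_ae (Eventually.of_forall fun E => ?_)
  simp only [map_mul, Complex.conj_conj]
  ring

end

/-- Smooth cutoffs whose squares approximate the indicator function of a closed ball. -/
theorem exists_schwartz_tendsto_setIntegral (x : ℝ) {r : ℝ} (hr : 0 < r) :
    ∃ φ : ℕ → SchwartzMap ℝ ℂ, ∀ ρ : ℝ → ℂ, Integrable ρ →
      Tendsto (fun k => ∫ E, ρ E * (φ k E * conj (φ k E))) atTop
        (𝓝 (∫ E in Metric.closedBall x r, ρ E)) := by
  have hpos : ∀ k : ℕ, (0 : ℝ) < 1 / ((k : ℝ) + 1) := fun k => Nat.one_div_pos_of_nat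
  let χ : ℕ → ContDiffBump x := fun k => ⟨r, r + 1 / ((k : ℝ) + 1), hr, by linarith [hpos k]⟩
  have h3 : ∀ k, HasCompactSupport fun E => (χ k E : ℂ) := fun k =>
    (χ k).hasCompactSupport.comp_left (g := Complex.ofReal) (by simp)
  have h4 : ∀ k, ContDiff ℝ (⊤ : ℕ∞) fun E => (χ k E : ℂ) := fun k =>
    Complex.ofRealCLM.contDiff.comp (χ k).contDiff
  refine ⟨fun k => (h3 k).toSchwartzMap (h4 k), fun ρ hρ => ?_⟩
  rw [← integral_indicator Metric.isClosed_closedBall.measurableSet]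
  have hval : ∀ k E, ρ E * ((h3 k).toSchwartzMap (h4 k) E
      * conj ((h3 k).toSchwartzMap (h4 k) E)) = ρ E * ((χ k E : ℝ) ^ 2 : ℝ) := by
    intro k E
    simp [pow_two]
  simp_rw [hval]
  refine tendsto_integral_of_dominated_convergence (fun E => ‖ρ E‖)
    (fun k => hρ.aestronglyMeasurable.mul
      (Complex.continuous_ofReal.comp ((χ k).continuous.pow 2)).aestronglyMeasurable)
    hρ.norm (fun k => Eventually.of_forall fun E => ?_) (Eventually.of_forall fun E => ?_)
  · rw [norm_mul]
    refine mul_le_of_le_one_right (norm_nonneg _) ?_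
    rw [Complex.norm_real, Real.norm_eq_abs, abs_of_nonneg (by positivity)]
    exact pow_le_one₀ (χ k).nonneg (χ k).le_one
  · by_cases hE : E ∈ Metric.closedBall x r
    · rw [Set.indicator_of_mem hE]
      refine tendsto_const_nhds.congr fun k => ?_
      rw [(χ k).one_of_mem_closedBall hE]
      simp
    · rw [Set.indicator_of_notMem hE]
      refine tendsto_const_nhds.congr' ?_
      have hE' : 0 < dist E x - r := by simpa using hE
      filter_upwards [(tendsto_one_div_add_atTop_nhds_zero_nat (𝕜 := ℝ)).eventually_lt_const hE']
        with k hk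
      rw [(χ k).zero_of_le_dist]
      · simp
      · change r + 1 / ((k : ℝ) + 1) ≤ _
        linarith

theorem ae_tendsto_average_closedBall {ρ : ℝ → ℂ} (hρ : Integrable ρ) :
    ∀ᵐ x, Tendsto (fun k : ℕ => ⨍ E in Metric.closedBall x (1 / ((k : ℝ) + 1)), ρ E) atTop
      (𝓝 (ρ x)) := by
  filter_upwards [IsUnifLocDoublingMeasure.ae_tendsto_average volume hρ.locallyIntegrable 1]
    with x hx
  refine hx (fun _ => x) _ ?_ (Eventually.of_forall fun k => ?_)
  · refine tendsto_nhdsWithin_iff.2 ⟨tendsto_one_div_add_atTop_nhds_zero_nat, ?_⟩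
    exact Eventually.of_forall fun k => Set.mem_Ioi.2 Nat.one_div_pos_of_nat
  · rw [one_mul]
    exact Metric.mem_closedBall_self Nat.one_div_pos_of_nat.le

variable [CompleteSpace H]

/-- The average of the density over a small ball is a limit of the numbers `‖φ(h) f‖²`, with
`|φ|²` tending to the indicator function of the ball. -/
theorem IsEnergyElement.ae_nonneg {S : ℝ → H →L[ℂ] H} (hS : IsUnitaryGroup S) {f : H} {ρ : ℝ → ℂ}
    (h : IsEnergyElement S f f ρ) : ∀ᵐ E, 0 ≤ ρ E := by
  filter_upwards [ae_tendsto_average_closedBall h.1] with x hx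
  refine ge_of_tendsto' hx fun k => ?_
  obtain ⟨φ, hφ⟩ := exists_schwartz_tendsto_setIntegral x (r := 1 / ((k : ℝ) + 1))
    Nat.one_div_pos_of_nat
  rw [setAverage_eq, Complex.real_smul]
  refine mul_nonneg (by exact_mod_cast inv_nonneg.2 measureReal_nonneg) ?_
  refine ge_of_tendsto' (hφ ρ h.1) fun j => ?_
  rw [← inner_smeared_smeared hS h]
  rw [inner_self_eq_norm_sq_to_K]
  have h0 : (0 : ℂ) ≤ ((‖smeared S (φ j) f‖ ^ 2 : ℝ) : ℂ) := Complex.zero_le_real.2 (sq_nonneg _)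
  rwa [Complex.ofReal_pow] at h0

/-- The Cauchy–Schwarz inequality for the form `(g, f) ↦ ⟨g, P_E f⟩`. -/
theorem IsEnergyElement.ae_norm_sq_le {S : ℝ → H →L[ℂ] H} (hS : IsUnitaryGroup S) {g f : H}
    {ρ ρf ρg : ℝ → ℂ} (h : IsEnergyElement S g f ρ) (hf : IsEnergyElement S f f ρf)
    (hg : IsEnergyElement S g g ρg) : ∀ᵐ E, ‖ρ E‖ ^ 2 ≤ ‖ρg E‖ * ‖ρf E‖ := by
  filter_upwards [ae_tendsto_average_closedBall h.1, ae_tendsto_average_closedBall hf.1,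
    ae_tendsto_average_closedBall hg.1] with x hx hxf hxg
  refine le_of_tendsto_of_tendsto' (hx.norm.pow 2) (hxg.norm.mul hxf.norm) fun k => ?_
  obtain ⟨φ, hφ⟩ := exists_schwartz_tendsto_setIntegral x (r := 1 / ((k : ℝ) + 1))
    Nat.one_div_pos_of_nat
  simp only [setAverage_eq, norm_smul]
  rw [mul_pow, mul_mul_mul_comm, ← pow_two]
  refine mul_le_mul_of_nonneg_left ?_ (sq_nonneg _)
  refine le_of_tendsto_of_tendsto' ((hφ ρ h.1).norm.pow 2)
    ((hφ ρg hg.1).norm.mul (hφ ρf hf.1).norm) fun j => ?_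
  rw [← inner_smeared_smeared hS h, ← inner_smeared_smeared hS hf, ← inner_smeared_smeared hS hg]
  simp only [inner_self_eq_norm_sq_to_K, norm_pow, RCLike.norm_ofReal, abs_norm]
  rw [← mul_pow]
  exact pow_le_pow_left₀ (norm_nonneg _) (norm_inner_le_norm _ _) 2

/-- An operator that commutes with the group increases energy densities by at most the square of
its norm, because `φ(h) K f = K φ(h) f`. -/
theorem IsEnergyElement.ae_norm_le_of_commute {S : ℝ → H →L[ℂ] H} (hS : IsUnitaryGroup S) {f : H}
    {K : H →L[ℂ] H} (hK : ∀ t x, S t (K x) = K (S t x)) {ρ ρ' : ℝ → ℂ}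
    (h : IsEnergyElement S f f ρ) (h' : IsEnergyElement S (K f) (K f) ρ') :
    ∀ᵐ E, ‖ρ' E‖ ≤ ‖K‖ ^ 2 * ‖ρ E‖ := by
  filter_upwards [ae_tendsto_average_closedBall h.1, ae_tendsto_average_closedBall h'.1]
    with x hx hx'
  refine le_of_tendsto_of_tendsto' hx'.norm (hx.norm.const_mul _) fun k => ?_
  obtain ⟨φ, hφ⟩ := exists_schwartz_tendsto_setIntegral x (r := 1 / ((k : ℝ) + 1))
    Nat.one_div_pos_of_nat
  simp only [setAverage_eq, norm_smul]
  rw [mul_left_comm]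
  refine mul_le_mul_of_nonneg_left ?_ (norm_nonneg _)
  refine le_of_tendsto_of_tendsto' (hφ ρ' h'.1).norm ((hφ ρ h.1).norm.const_mul _) fun j => ?_
  rw [← inner_smeared_smeared hS h, ← inner_smeared_smeared hS h']
  have : smeared S (φ j) (K f) = K (smeared S (φ j) f) := by
    rw [smeared, smeared, ← ContinuousLinearMap.integral_comp_comm _
      (integrable_fourierWeight_smul hS (φ j) f)]
    simp [hK]
  simp only [inner_self_eq_norm_sq_to_K, norm_pow, RCLike.norm_ofReal, abs_norm, this]
  rw [← mul_pow]
  exact pow_le_pow_left₀ (norm_nonneg _) (K.le_opNorm _) 2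

/-- A matrix element of `P_E` exists if one of its two vectors has an energy density: the vectors
`∑ c_t S_t f` form a copy of the trigonometric polynomials in `L²(⟨f, P_E f⟩ dE)`, on which the
functional `⟨g, ·⟩` is represented by a square integrable function. -/
theorem exists_isEnergyElement {S : ℝ → H →L[ℂ] H} (hS : IsUnitaryGroup S) {f : H} {ρ : ℝ → ℂ}
    (h : IsEnergyElement S f f ρ) (g : H) : ∃ ρ', IsEnergyElement S g f ρ' := by
  obtain ⟨h1, h2⟩ := (isEnergyElement_iff hS).1 h
  set w : ℝ → NNReal := fun E => ‖(h1.1.mk ρ) E‖₊ with hw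
  have hwm : Measurable w := h1.1.stronglyMeasurable_mk.measurable.nnnorm
  have hwρ : ∀ᵐ E, ((w E : ℝ) : ℂ) = ρ E := by
    filter_upwards [h1.1.ae_eq_mk, h.ae_nonneg hS] with E h3 h4
    rw [hw, coe_nnnorm, ← h3, Complex.norm_of_nonneg' h4]
  set ν : Measure ℝ := volume.withDensity fun E => (w E : ENNReal) with hν
  have hνint : ∀ u : ℝ → ℂ, ∫ E, u E ∂ν = ∫ E, ρ E * u E := by
    intro u
    rw [hν, integral_withDensity_eq_integral_smul hwm]
    refine integral_congr_ae ?_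
    filter_upwards [hwρ] with E hE
    rw [NNReal.smul_def, Complex.real_smul, hE]
  have hfin : IsFiniteMeasure ν := by
    refine ⟨?_⟩
    rw [hν, withDensity_apply _ MeasurableSet.univ, Measure.restrict_univ]
    have := h1.2
    rw [hasFiniteIntegral_iff_enorm] at this
    refine lt_of_le_of_lt (lintegral_mono_ae ?_) this
    filter_upwards [h1.1.ae_eq_mk] with E h3
    rw [hw, h3]
    rfl
  have hmem : ∀ t : ℝ, MemLp (fun E : ℝ => Complex.exp (Complex.I * t * E)) 2 ν := fun t =>
    MemLp.of_bound (by fun_prop) 1 (Eventually.of_forall fun E => (norm_exp_I t E).le)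
  let P : (ℝ →₀ ℂ) →ₗ[ℂ] Lp ℂ 2 ν := Finsupp.linearCombination ℂ fun t => (hmem t).toLp
  let Q : (ℝ →₀ ℂ) →ₗ[ℂ] H := Finsupp.linearCombination ℂ fun t => S t f
  have hbasic : ∀ s t : ℝ, inner ℂ ((hmem s).toLp) ((hmem t).toLp) = inner ℂ (S s f) (S t f) := by
    intro s t
    rw [L2.inner_def, hS.inner_apply, h2, ← hνint]
    refine integral_congr_ae ?_
    filter_upwards [(hmem s).coeFn_toLp, (hmem t).coeFn_toLp] with E h3 h4
    rw [h3, h4]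
    simp only [RCLike.inner_apply, ← Complex.exp_conj, ← Complex.exp_add, map_mul,
      Complex.conj_I, Complex.conj_ofReal]
    congr 1
    push_cast
    ring
  have hPQ : ∀ c, ‖Q c‖ = ‖P c‖ := by
    intro c
    have : inner ℂ (Q c) (Q c) = inner ℂ (P c) (P c) := by
      simp only [P, Q, Finsupp.linearCombination_apply, Finsupp.sum, sum_inner, inner_sum,
        inner_smul_left, inner_smul_right, hbasic]
    rw [inner_self_eq_norm_sq_to_K, inner_self_eq_norm_sq_to_K] at this
    have h5 : ‖Q c‖ ^ 2 = ‖P c‖ ^ 2 := by exact_mod_cast this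
    exact (pow_left_inj₀ (norm_nonneg _) (norm_nonneg _) two_ne_zero).1 h5
  let Λ : (ℝ →₀ ℂ) →ₗ[ℂ] ℂ := (innerSL ℂ g).toLinearMap ∘ₗ Q
  have hΛ : ∃ C, ∀ c, ‖Λ c‖ ≤ C * ‖P c‖ := ⟨‖g‖, fun c => by
    rw [← hPQ]
    exact norm_inner_le_norm _ _⟩
  obtain ⟨L, hL, -⟩ := exists_extension_norm_eq _ (Λ.compLeftInverse P)
  obtain ⟨u, hu⟩ := (InnerProductSpace.toDual ℂ (Lp ℂ 2 ν)).surjective L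
  have hrep : ∀ t : ℝ, inner ℂ g (S t f) = inner ℂ u ((hmem t).toLp) := by
    intro t
    have h3 := hL ⟨P (Finsupp.single t 1), LinearMap.mem_range_self _ _⟩
    rw [LinearMap.compLeftInverse_apply_of_bdd _ _ hΛ (Finsupp.single t 1) _ rfl, ← hu,
      InnerProductSpace.toDual_apply_apply] at h3
    simpa [Λ, P, Q] using h3.symm
  refine ⟨fun E => ρ E * conj (u E), (isEnergyElement_iff hS).2 ⟨?_, fun t => ?_⟩⟩
  · have h3 : Integrable (fun E => conj (u E)) ν :=
      (Complex.conjCLE.toContinuousLinearMap.integrable_comp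
        ((Lp.memLp u).integrable (by norm_num)) :)
    refine ((integrable_withDensity_iff_integrable_smul hwm).1 h3).congr ?_
    filter_upwards [hwρ] with E hE
    rw [NNReal.smul_def, Complex.real_smul, hE]
  · rw [hrep, L2.inner_def]
    rw [show (∫ E : ℝ, ρ E * conj (u E) * Complex.exp (Complex.I * t * E))
      = ∫ E : ℝ, ρ E * (conj (u E) * Complex.exp (Complex.I * t * E)) by
        congr 1; ext E; ring, ← hνint]
    refine integral_congr_ae ?_
    filter_upwards [(hmem t).coeFn_toLp] with E h4
    rw [h4, RCLike.inner_apply, mul_comm]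

end

/-! ### Products of sums, integrals and `Lⁿ` functions -/

section

open scoped ENNReal

theorem tsum_pi_prod {κ : Type*} : ∀ {n : ℕ} (q : Fin n → κ → ℝ≥0∞),
    ∑' k : Fin n → κ, ∏ l, q l (k l) = ∏ l, ∑' j, q l j
  | 0, q => by simp
  | n + 1, q => by
    rw [← (Fin.consEquiv fun _ : Fin (n + 1) => κ).tsum_eq, ENNReal.tsum_prod', Fin.prod_univ_succ,
      ← tsum_pi_prod fun l => q l.succ, ← ENNReal.tsum_mul_right]
    refine tsum_congr fun j => ?_
    rw [← ENNReal.tsum_mul_left]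
    refine tsum_congr fun k => ?_
    simp [Fin.consEquiv, Fin.prod_univ_succ]

theorem enorm_finset_prod {ι : Type*} (s : Finset ι) (u : ι → ℂ) :
    ‖∏ l ∈ s, u l‖ₑ = ∏ l ∈ s, ‖u l‖ₑ := by
  simp only [enorm, nnnorm_prod, ENNReal.ofNNReal_finsetProd]

theorem lintegral_pi_prod : ∀ {n : ℕ} (q : Fin n → ℝ → ℝ≥0∞), (∀ l, Measurable (q l)) →
    ∫⁻ x : Fin n → ℝ, ∏ l, q l (x l) = ∏ l, ∫⁻ y, q l y
  | 0, q, _ => by simp [volume_pi]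
  | n + 1, q, hq => by
    rw [← (volume_preserving_piFinSuccAbove (fun _ : Fin (n + 1) => ℝ) 0).symm.lintegral_comp_emb
      (MeasurableEquiv.measurableEmbedding _)]
    simp_rw [MeasurableEquiv.piFinSuccAbove_symm_apply, Fin.insertNthEquiv,
        Fin.prod_univ_succ, Fin.insertNth_zero]
    simp only [Equiv.coe_fn_mk, Fin.cons_zero, Fin.cons_succ, cast_eq]
    rw [Measure.volume_eq_prod, lintegral_prod_mul (f := q 0)
      (g := fun y : Fin n → ℝ => ∏ l : Fin n, q l.succ (y l)) (hq 0).aemeasurable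
      (Finset.measurable_prod _ fun l _ => (hq l.succ).comp (measurable_pi_apply l)).aemeasurable,
      lintegral_pi_prod _ fun l => hq l.succ]

theorem tsum_rpow_half_mul_le (x y : ℕ → ℝ≥0∞) :
    ∑' j, x j ^ (1 / 2 : ℝ) * y j ^ (1 / 2 : ℝ)
      ≤ (∑' j, x j) ^ (1 / 2 : ℝ) * (∑' j, y j) ^ (1 / 2 : ℝ) := by
  have := ENNReal.lintegral_mul_norm_pow_le (μ := Measure.count) (f := x) (g := y)
    (measurable_of_countable _).aemeasurable (measurable_of_countable _).aemeasurable
    (p := 1 / 2) (q := 1 / 2) (by norm_num) (by norm_num) (by norm_num)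
  simpa only [lintegral_count] using this

/-- The Cauchy–Schwarz inequality in each index of a cyclic sum. -/
theorem tsum_cyclic_prod_le {n : ℕ} [NeZero n] (α β : Fin n → ℕ → ℝ≥0∞) :
    ∑' k : Fin n → ℕ, ∏ l, β l (k (l - 1)) ^ (1 / 2 : ℝ) * α l (k l) ^ (1 / 2 : ℝ)
      ≤ ∏ l, (∑' j, β l j) ^ (1 / 2 : ℝ) * (∑' j, α l j) ^ (1 / 2 : ℝ) := by
  have hre : ∀ k : Fin n → ℕ, ∏ l, β l (k (l - 1)) ^ (1 / 2 : ℝ) * α l (k l) ^ (1 / 2 : ℝ)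
      = ∏ l, β (l + 1) (k l) ^ (1 / 2 : ℝ) * α l (k l) ^ (1 / 2 : ℝ) := by
    intro k
    rw [Finset.prod_mul_distrib, Finset.prod_mul_distrib,
      ← Equiv.prod_comp (Equiv.addRight (1 : Fin n)) fun l => β l (k (l - 1)) ^ (1 / 2 : ℝ)]
    simp
  simp_rw [hre]
  rw [tsum_pi_prod fun l j => β (l + 1) j ^ (1 / 2 : ℝ) * α l j ^ (1 / 2 : ℝ)]
  refine (Finset.prod_le_prod' fun l _ => tsum_rpow_half_mul_le _ _).trans_eq ?_
  rw [Finset.prod_mul_distrib, Finset.prod_mul_distrib,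
    ← Equiv.prod_comp (Equiv.addRight (1 : Fin n)) fun l => (∑' j, β l j) ^ (1 / 2 : ℝ)]
  simp

section Multilinear

variable {n : ℕ} [hn : NeZero n]

/-- The hypothesis on the exponent under which `Lⁿ` is a normed space. -/
theorem one_le_natCast_of_neZero : Fact ((1 : ℝ≥0∞) ≤ n) :=
  ⟨by exact_mod_cast NeZero.one_le⟩

/-- Hölder's inequality for `n` functions in `Lⁿ`. -/
theorem lintegral_prod_enorm_le {X : Type*} [MeasurableSpace X] {μ : Measure X}
    {u : Fin n → X → ℂ} (hu : ∀ l, AEStronglyMeasurable (u l) μ) :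
    ∫⁻ E, ∏ l, ‖u l E‖ₑ ∂μ ≤ ∏ l, eLpNorm (u l) n μ := by
  have hn0 : (n : ℝ) ≠ 0 := by exact_mod_cast hn.out
  have h := ENNReal.lintegral_prod_norm_pow_le (μ := μ) Finset.univ
    (f := fun l E => ‖u l E‖ₑ ^ (n : ℝ)) (fun l _ => (hu l).enorm.pow_const _)
    (p := fun _ : Fin n => (1 / n : ℝ)) (by simp [hn0]) (fun _ _ => by positivity)
  simp_rw [← ENNReal.rpow_mul, mul_one_div_cancel hn0, ENNReal.rpow_one] at h
  refine h.trans_eq (Finset.prod_congr rfl fun l _ => ?_)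
  rw [eLpNorm_eq_lintegral_rpow_enorm_toReal (by exact_mod_cast hn.out) (by simp)]
  simp

theorem integrable_prod_of_memLp {X : Type*} [MeasurableSpace X] {μ : Measure X}
    {u : Fin n → X → ℂ} (hu : ∀ l, MemLp (u l) n μ) : Integrable (fun E => ∏ l, u l E) μ := by
  refine ⟨Finset.aestronglyMeasurable_fun_prod _ fun l _ => (hu l).1, ?_⟩
  rw [hasFiniteIntegral_iff_enorm]
  simp_rw [enorm_finset_prod]
  exact (lintegral_prod_enorm_le fun l => (hu l).1).trans_lt
    (ENNReal.prod_lt_top fun l _ => (hu l).2)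

variable [Fact ((1 : ℝ≥0∞) ≤ n)]

/-- The integral of a product of `n` functions, as a multilinear map on `Lⁿ`. -/
def integralProd : ContinuousMultilinearMap ℂ (fun _ : Fin n => Lp ℂ (n : ℝ≥0∞) (volume (α := ℝ)))
    ℂ :=
  MultilinearMap.mkContinuous
    { toFun := fun v => ∫ E, ∏ l, v l E
      map_update_add' := by
        intro _ v i x y
        rw [← integral_add (integrable_prod_of_memLp fun l => Lp.memLp _)
          (integrable_prod_of_memLp fun l => Lp.memLp _)]
        refine integral_congr_ae ?_
        filter_upwards [Lp.coeFn_add x y] with E hE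
        have h : ∀ z : Lp ℂ (n : ℝ≥0∞) (volume (α := ℝ)),
            ∏ l, (Function.update v i z l) E = z E * ∏ l ∈ Finset.univ \ {i}, v l E := by
          intro z
          rw [← Finset.mul_prod_erase _ _ (Finset.mem_univ i), Function.update_self,
            ← Finset.sdiff_singleton_eq_erase]
          congr 1
          refine Finset.prod_congr rfl fun l hl => ?_
          rw [Function.update_of_ne (by simpa using hl)]
        rw [h, h, h, hE, Pi.add_apply, add_mul]
      map_update_smul' := by
        intro _ v i c x
        rw [← integral_smul]
        refine integral_congr_ae ?_
        filter_upwards [Lp.coeFn_smul c x] with E hE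
        have h : ∀ z : Lp ℂ (n : ℝ≥0∞) (volume (α := ℝ)),
            ∏ l, (Function.update v i z l) E = z E * ∏ l ∈ Finset.univ \ {i}, v l E := by
          intro z
          rw [← Finset.mul_prod_erase _ _ (Finset.mem_univ i), Function.update_self,
            ← Finset.sdiff_singleton_eq_erase]
          congr 1
          refine Finset.prod_congr rfl fun l hl => ?_
          rw [Function.update_of_ne (by simpa using hl)]
        rw [h, h, hE, Pi.smul_apply, smul_mul_assoc] }
    1 (by
      intro v
      rw [one_mul]
      refine (norm_integral_le_lintegral_norm _).trans ?_
      simp_rw [Lp.norm_def, ← ENNReal.toReal_prod]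
      refine ENNReal.toReal_mono (ENNReal.prod_ne_top fun l _ => (Lp.memLp _).2.ne) ?_
      refine le_trans (le_of_eq ?_) (lintegral_prod_enorm_le fun l => (Lp.memLp (v l)).1)
      refine lintegral_congr fun E => ?_
      rw [ofReal_norm]
      simp [enorm_finset_prod])

theorem integralProd_apply (v : Fin n → Lp ℂ (n : ℝ≥0∞) (volume (α := ℝ))) :
    integralProd v = ∫ E, ∏ l, v l E := rfl

end Multilinear

/-- Translations are continuous in `Lⁿ`, and the integral of a product is continuous on `Lⁿ`. -/
theorem continuous_integral_prod_translate {n : ℕ} [hn : NeZero n] {u : Fin n → ℝ → ℂ}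
    (hu : ∀ l, MemLp (u l) n) : Continuous fun c : Fin n → ℝ => ∫ E, ∏ l, u l (E + c l) := by
  have : Fact ((1 : ℝ≥0∞) ≤ n) := one_le_natCast_of_neZero
  have hmp : ∀ c : ℝ, MeasurePreserving (fun E : ℝ => E + c) := measurePreserving_add_right volume
  have h1 : ∀ l, Continuous fun c : ℝ => Lp.compMeasurePreserving (fun E : ℝ => E + c) (hmp c)
      ((hu l).toLp) := by
    intro l
    exact Continuous.compMeasurePreservingLp (p := (n : ℝ≥0∞))
      (g := ContinuousMap.curry ⟨fun p : ℝ × ℝ => p.2 + p.1, by fun_prop⟩)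
      continuous_const (ContinuousMap.continuous _) hmp (by simp)
  have h2 : Continuous fun c : Fin n → ℝ => integralProd fun l =>
      Lp.compMeasurePreserving (fun E : ℝ => E + c l) (hmp (c l)) ((hu l).toLp) :=
    integralProd.cont.comp (continuous_pi fun l => (h1 l).comp (continuous_apply l))
  refine h2.congr fun c => ?_
  rw [integralProd_apply]
  refine integral_congr_ae ?_
  have h3 : ∀ᵐ E : ℝ, ∀ l, Lp.compMeasurePreserving (fun E : ℝ => E + c l) (hmp (c l))
      ((hu l).toLp) E = u l (E + c l) := by
    rw [ae_all_iff]
    intro l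
    filter_upwards [Lp.coeFn_compMeasurePreserving ((hu l).toLp) (hmp (c l)),
      (hmp (c l)).quasiMeasurePreserving.ae (hu l).coeFn_toLp] with E h4 h5
    rw [h4, Function.comp_apply, h5]
  filter_upwards [h3] with E hE
  exact Finset.prod_congr rfl fun l _ => hE l

end

/-! ### Chain kernels and their traces -/

section

open scoped ENNReal

/-- The finite box of multi-indices below `K`. -/
def box (n K : ℕ) : Finset (Fin n → ℕ) := Fintype.piFinset fun _ => Finset.range K

theorem mem_box {n K : ℕ} {k : Fin n → ℕ} : k ∈ box n K ↔ ∀ l, k l < K := by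
  simp [box]

theorem tendsto_box (n : ℕ) : Tendsto (box n) atTop atTop := by
  refine tendsto_atTop_finset_of_monotone (fun K L h k hk => ?_) fun k => ?_
  · exact mem_box.2 fun l => (mem_box.1 hk l).trans_le h
  · exact ⟨(Finset.univ.sup k) + 1, mem_box.2 fun l =>
      Nat.lt_succ_of_le (Finset.le_sup (f := k) (Finset.mem_univ l))⟩

/-- Kernels `ρ l j k` of an energy variable, dominated by `√(β l j) √(α l k)`, where
`∑ j, β l j` and `∑ k, α l k` are finite and belong to `L¹` and to `Lⁿ`. -/
structure IsChainKernel {n : ℕ} (ρ : Fin n → ℕ → ℕ → ℝ → ℂ) (α β : Fin n → ℕ → ℝ → ℝ≥0∞) :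
    Prop where
  measurable : ∀ l j k, Measurable (ρ l j k)
  measurable_left : ∀ l j, Measurable (β l j)
  measurable_right : ∀ l k, Measurable (α l k)
  enorm_le : ∀ l j k E, ‖ρ l j k E‖ₑ ≤ β l j E ^ (1 / 2 : ℝ) * α l k E ^ (1 / 2 : ℝ)
  left_lt_top : ∀ l E, ∑' j, β l j E < ⊤
  right_lt_top : ∀ l E, ∑' k, α l k E < ⊤
  left_one : ∀ l, ∫⁻ E, ∑' j, β l j E < ⊤
  right_one : ∀ l, ∫⁻ E, ∑' k, α l k E < ⊤
  left_pow : ∀ l, ∫⁻ E, (∑' j, β l j E) ^ n < ⊤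
  right_pow : ∀ l, ∫⁻ E, (∑' k, α l k E) ^ n < ⊤

/-- The cyclic product `∏_l ρ l (k (l - 1)) (k l) (x l)`. -/
def chain {n : ℕ} [NeZero n] (ρ : Fin n → ℕ → ℕ → ℝ → ℂ) (x : Fin n → ℝ) (k : Fin n → ℕ) : ℂ :=
  ∏ l, ρ l (k (l - 1)) (k l) (x l)

/-- The trace `∑_k ∏_l ρ l (k (l - 1)) (k l) (x l)`. -/
def chainSum {n : ℕ} [NeZero n] (ρ : Fin n → ℕ → ℕ → ℝ → ℂ) (x : Fin n → ℝ) : ℂ :=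
  ∑' k, chain ρ x k

/-- The function `√(∑ j, β l j) √(∑ k, α l k)`. -/
def envelope {n : ℕ} (α β : Fin n → ℕ → ℝ → ℝ≥0∞) (l : Fin n) (E : ℝ) : ℝ≥0∞ :=
  (∑' j, β l j E) ^ (1 / 2 : ℝ) * (∑' k, α l k E) ^ (1 / 2 : ℝ)

/-- The bound of `∫ ∏_l envelope α β l (E + c l) dE` by Hölder's inequality. -/
def holderBound {n : ℕ} (α β : Fin n → ℕ → ℝ → ℝ≥0∞) : ℝ≥0∞ :=
  ∏ l, (∫⁻ E, (∑' j, β l j E) ^ n) ^ (1 / (2 * n) : ℝ)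
    * (∫⁻ E, (∑' k, α l k E) ^ n) ^ (1 / (2 * n) : ℝ)

/-- The densities `α` without those of index `k < K` at the position `j`. -/
def tailDensity {n : ℕ} (α : Fin n → ℕ → ℝ → ℝ≥0∞) (j : Fin n) (K : ℕ) (l : Fin n) (k : ℕ)
    (E : ℝ) : ℝ≥0∞ :=
  if l = j ∧ k < K then 0 else α l k E

theorem measurable_envelope {n : ℕ} {α β : Fin n → ℕ → ℝ → ℝ≥0∞}
    (hα : ∀ l k, Measurable (α l k)) (hβ : ∀ l j, Measurable (β l j)) (l : Fin n) :
    Measurable (envelope α β l) :=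
  ((Measurable.tsum fun j => hβ l j).pow_const _).mul
    ((Measurable.tsum fun j => hα l j).pow_const _)

/-- Hölder's inequality for the `2n` functions `(∑ j, β l j)^{1/2}` and `(∑ k, α l k)^{1/2}`, which
belong to `L²ⁿ`. -/
theorem lintegral_prod_envelope_le {n : ℕ} [hn : NeZero n] {α β : Fin n → ℕ → ℝ → ℝ≥0∞}
    (hα : ∀ l k, Measurable (α l k)) (hβ : ∀ l j, Measurable (β l j)) (c : Fin n → ℝ) :
    ∫⁻ E, ∏ l, envelope α β l (E + c l) ≤ holderBound α β := by
  have hn0 : (n : ℝ) ≠ 0 := by exact_mod_cast hn.out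
  have hA : ∀ l, Measurable fun E => (∑' k, α l k E) ^ n := fun l =>
    (Measurable.tsum fun j => hα l j).pow_const _
  have hB : ∀ l, Measurable fun E => (∑' k, β l k E) ^ n := fun l =>
    (Measurable.tsum fun j => hβ l j).pow_const _
  have h := ENNReal.lintegral_prod_norm_pow_le (μ := (volume : Measure ℝ))
    (Finset.univ : Finset (Fin n × Bool))
    (f := fun p E => if p.2 then (∑' j, β p.1 j (E + c p.1)) ^ n
      else (∑' k, α p.1 k (E + c p.1)) ^ n)
    (fun p _ => by
      rcases p with ⟨l, b | b⟩
      · exact ((hA l).comp (measurable_add_const (c l))).aemeasurable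
      · exact ((hB l).comp (measurable_add_const (c l))).aemeasurable)
    (p := fun _ => (1 / (2 * n) : ℝ))
    (by simp; field_simp) (fun _ _ => by positivity)
  simp only [Fintype.prod_prod_type, Fintype.prod_bool, if_true, Bool.false_eq_true, if_false] at h
  have hpow : ∀ y : ℝ≥0∞, (y ^ n) ^ (1 / (2 * n) : ℝ) = y ^ (1 / 2 : ℝ) := by
    intro y
    rw [← ENNReal.rpow_natCast, ← ENNReal.rpow_mul]
    congr 1
    field_simp
  simp only [hpow] at h
  refine h.trans_eq (Finset.prod_congr rfl fun l _ => ?_)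
  rw [lintegral_add_right_eq_self (fun E => (∑' j, β l j E) ^ n),
    lintegral_add_right_eq_self (fun E => (∑' j, α l j E) ^ n)]

section

variable {n : ℕ} {ρ : Fin n → ℕ → ℕ → ℝ → ℂ} {α β : Fin n → ℕ → ℝ → ℝ≥0∞}

namespace IsChainKernel

theorem envelope_lt_top (h : IsChainKernel ρ α β) (l : Fin n) (E : ℝ) :
    envelope α β l E < ⊤ :=
  ENNReal.mul_lt_top (ENNReal.rpow_lt_top_of_nonneg (by norm_num) (h.left_lt_top l E).ne)
    (ENNReal.rpow_lt_top_of_nonneg (by norm_num) (h.right_lt_top l E).ne)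

theorem envelope_measurable (h : IsChainKernel ρ α β) (l : Fin n) : Measurable (envelope α β l) :=
  measurable_envelope h.measurable_right h.measurable_left l

theorem holderBound_lt_top (h : IsChainKernel ρ α β) : holderBound α β < ⊤ :=
  ENNReal.prod_lt_top fun l _ => ENNReal.mul_lt_top
    (ENNReal.rpow_lt_top_of_nonneg (by positivity) (h.left_pow l).ne)
    (ENNReal.rpow_lt_top_of_nonneg (by positivity) (h.right_pow l).ne)

theorem lintegral_envelope_lt_top (h : IsChainKernel ρ α β) (l : Fin n) :
    ∫⁻ E, envelope α β l E < ⊤ := by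
  refine (ENNReal.lintegral_mul_norm_pow_le (p := 1 / 2) (q := 1 / 2)
    (Measurable.tsum fun j => h.measurable_left l j).aemeasurable
    (Measurable.tsum fun j => h.measurable_right l j).aemeasurable
    (by norm_num) (by norm_num) (by norm_num)).trans_lt ?_
  exact ENNReal.mul_lt_top (ENNReal.rpow_lt_top_of_nonneg (by norm_num) (h.left_one l).ne)
    (ENNReal.rpow_lt_top_of_nonneg (by norm_num) (h.right_one l).ne)

end IsChainKernel

variable [hn : NeZero n]

theorem tsum_enorm_chain_le
    (h : ∀ l j k E, ‖ρ l j k E‖ₑ ≤ β l j E ^ (1 / 2 : ℝ) * α l k E ^ (1 / 2 : ℝ))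
    (x : Fin n → ℝ) : ∑' k, ‖chain ρ x k‖ₑ ≤ ∏ l, envelope α β l (x l) := by
  refine le_trans (ENNReal.tsum_le_tsum fun k => ?_)
    (tsum_cyclic_prod_le (fun l k => α l k (x l)) (fun l j => β l j (x l)))
  rw [chain, enorm_finset_prod]
  exact Finset.prod_le_prod' fun l _ => h l _ _ _

theorem summable_of_tsum_enorm_lt_top {ι : Type*} {u : ι → ℂ} (h : ∑' k, ‖u k‖ₑ < ⊤) :
    Summable u := by
  refine Summable.of_nnnorm ?_
  exact ENNReal.tsum_coe_ne_top_iff_summable.1 h.ne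

namespace IsChainKernel

theorem summable (h : IsChainKernel ρ α β) (x : Fin n → ℝ) : Summable (chain ρ x) :=
  summable_of_tsum_enorm_lt_top ((tsum_enorm_chain_le h.enorm_le x).trans_lt
    (ENNReal.prod_lt_top fun l _ => h.envelope_lt_top l _))

theorem enorm_chainSum_le (h : IsChainKernel ρ α β) (x : Fin n → ℝ) :
    ‖chainSum ρ x‖ₑ ≤ ∏ l, envelope α β l (x l) :=
  (enorm_tsum_le_tsum_enorm).trans (tsum_enorm_chain_le h.enorm_le x)

theorem measurable_chain (h : IsChainKernel ρ α β) (k : Fin n → ℕ) :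
    Measurable fun x => chain ρ x k :=
  Finset.measurable_prod _ fun l _ => (h.measurable l _ _).comp (measurable_pi_apply l)

theorem measurable_chainSum (h : IsChainKernel ρ α β) : Measurable (chainSum ρ) := by
  refine measurable_of_tendsto_metrizable
    (f := fun K x => ∑ k ∈ box n K, chain ρ x k)
    (fun K => Finset.measurable_sum _ fun k _ => h.measurable_chain k) ?_
  rw [tendsto_pi_nhds]
  exact fun x => (h.summable x).hasSum.comp (tendsto_box n)

theorem lintegral_tsum_chain_lt_top (h : IsChainKernel ρ α β) :
    ∑' k, ∫⁻ x, ‖chain ρ x k‖ₑ < ⊤ := by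
  rw [← lintegral_tsum fun k => (h.measurable_chain k).enorm.aemeasurable]
  refine (lintegral_mono fun x => tsum_enorm_chain_le h.enorm_le x).trans_lt ?_
  rw [lintegral_pi_prod _ h.envelope_measurable]
  exact ENNReal.prod_lt_top fun l _ => h.lintegral_envelope_lt_top l

theorem integrable_chainSum (h : IsChainKernel ρ α β) : Integrable (chainSum ρ) := by
  refine ⟨h.measurable_chainSum.aestronglyMeasurable, ?_⟩
  rw [hasFiniteIntegral_iff_enorm]
  refine (lintegral_mono h.enorm_chainSum_le).trans_lt ?_
  rw [lintegral_pi_prod _ h.envelope_measurable]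
  exact ENNReal.prod_lt_top fun l _ => h.lintegral_envelope_lt_top l

theorem lintegral_enorm_chainSum_le (h : IsChainKernel ρ α β) (c : Fin n → ℝ) :
    ∫⁻ E : ℝ, ‖chainSum ρ fun l => E + c l‖ₑ ≤ holderBound α β :=
  (lintegral_mono fun _ => h.enorm_chainSum_le _).trans
    (lintegral_prod_envelope_le h.measurable_right h.measurable_left c)

theorem integrable_chainSum_translate (h : IsChainKernel ρ α β) (c : Fin n → ℝ) :
    Integrable fun E : ℝ => chainSum ρ fun l => E + c l := by
  refine ⟨(h.measurable_chainSum.comp (by fun_prop)).aestronglyMeasurable, ?_⟩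
  rw [hasFiniteIntegral_iff_enorm]
  exact (h.lintegral_enorm_chainSum_le c).trans_lt h.holderBound_lt_top

theorem memLp (h : IsChainKernel ρ α β) (l : Fin n) (j k : ℕ) : MemLp (ρ l j k) n := by
  have hn0 : (n : ℝ) ≠ 0 := by exact_mod_cast hn.out
  refine ⟨(h.measurable l j k).aestronglyMeasurable, ?_⟩
  rw [eLpNorm_lt_top_iff_lintegral_rpow_enorm_lt_top (by exact_mod_cast hn.out) (by simp)]
  have hle : ∀ E, ‖ρ l j k E‖ₑ ^ (n : ℝ) ≤
      ((∑' j, β l j E) ^ n) ^ (1 / 2 : ℝ) * ((∑' k, α l k E) ^ n) ^ (1 / 2 : ℝ) := by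
    intro E
    refine (ENNReal.rpow_le_rpow (h.enorm_le l j k E) (Nat.cast_nonneg n)).trans ?_
    rw [ENNReal.mul_rpow_of_nonneg _ _ (Nat.cast_nonneg n)]
    simp only [← ENNReal.rpow_natCast, ← ENNReal.rpow_mul]
    rw [mul_comm (n : ℝ)]
    exact mul_le_mul' (ENNReal.rpow_le_rpow (ENNReal.le_tsum j) (by positivity))
      (ENNReal.rpow_le_rpow (ENNReal.le_tsum k) (by positivity))
  refine (lintegral_mono hle).trans_lt ?_
  refine (ENNReal.lintegral_mul_norm_pow_le (p := 1 / 2) (q := 1 / 2)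
    ((Measurable.tsum fun j => h.measurable_left l j).pow_const _).aemeasurable
    ((Measurable.tsum fun j => h.measurable_right l j).pow_const _).aemeasurable
    (by norm_num) (by norm_num) (by norm_num)).trans_lt ?_
  exact ENNReal.mul_lt_top (ENNReal.rpow_lt_top_of_nonneg (by norm_num) (h.left_pow l).ne)
    (ENNReal.rpow_lt_top_of_nonneg (by norm_num) (h.right_pow l).ne)

/-- A multi-index outside of the box exceeds it at some position `j`; dropping the densities of index
below `K` at this position bounds the sum of these terms. -/
theorem enorm_chainSum_sub_le (h : IsChainKernel ρ α β) (K : ℕ) (x : Fin n → ℝ) :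
    ‖chainSum ρ x - ∑ k ∈ box n K, chain ρ x k‖ₑ
      ≤ ∑ j, ∏ l, envelope (tailDensity α j K) β l (x l) := by
  classical
  rw [chainSum, ← (h.summable x).sum_add_tsum_subtype_compl (box n K), add_sub_cancel_left]
  refine enorm_tsum_le_tsum_enorm.trans ?_
  rw [show (∑' k : {k // k ∉ box n K}, ‖chain ρ x k‖ₑ) = _ from
    tsum_subtype {k | k ∉ box n K} fun k => ‖chain ρ x k‖ₑ]
  have hle : ∀ k, Set.indicator {k | k ∉ box n K} (fun k => ‖chain ρ x k‖ₑ) k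
      ≤ ∑ j, ∏ l, β l (k (l - 1)) (x l) ^ (1 / 2 : ℝ)
        * tailDensity α j K l (k l) (x l) ^ (1 / 2 : ℝ) := by
    intro k
    by_cases hk : k ∈ box n K
    · rw [Set.indicator_of_notMem (by simpa using hk)]
      exact zero_le
    · rw [Set.indicator_of_mem (by simpa using hk)]
      rw [mem_box] at hk
      push Not at hk
      obtain ⟨j, hj⟩ := hk
      refine le_trans ?_ (Finset.single_le_sum (fun _ _ => zero_le) (Finset.mem_univ j))
      rw [chain, enorm_finset_prod]
      refine Finset.prod_le_prod' fun l _ => ?_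
      rw [tailDensity, if_neg]
      · exact h.enorm_le _ _ _ _
      · rintro ⟨rfl, h2⟩
        omega
  refine (ENNReal.tsum_le_tsum hle).trans ?_
  rw [Summable.tsum_finsetSum fun _ _ => ENNReal.summable]
  exact Finset.sum_le_sum fun j _ =>
    tsum_cyclic_prod_le (fun l k => tailDensity α j K l k (x l)) (fun l j => β l j (x l))

theorem measurable_tailDensity (h : IsChainKernel ρ α β) (j : Fin n) (K : ℕ) (l : Fin n) (k : ℕ) :
    Measurable (tailDensity α j K l k) := by
  unfold tailDensity
  split_ifs
  · exact measurable_const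
  · exact h.measurable_right l k
theorem tendsto_holderBound_tail (h : IsChainKernel ρ α β) (j : Fin n) :
    Tendsto (fun K => holderBound (tailDensity α j K) β) atTop (𝓝 0) := by
  have hn0 : n ≠ 0 := hn.out
  have hpos : (0 : ℝ) < 1 / (2 * n) := by
    have : (0 : ℝ) < n := by exact_mod_cast Nat.pos_of_ne_zero hn0
    positivity
  have htail : ∀ E, Tendsto (fun K => ∑' k, tailDensity α j K j k E) atTop (𝓝 0) := by
    intro E
    have h1 := (ENNReal.tendsto_tsum_compl_atTop_zero (h.right_lt_top j E).ne).comp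
      tendsto_finset_range
    refine h1.congr fun K => ?_
    rw [Function.comp_apply, show (∑' k : {k // k ∉ Finset.range K}, α j k E) = _ from
      tsum_subtype {k | k ∉ Finset.range K} fun k => α j k E]
    refine tsum_congr fun k => ?_
    by_cases hk : k < K
    · rw [Set.indicator_of_notMem (by simpa using hk), tailDensity,
        if_pos ⟨rfl, hk⟩]
    · rw [Set.indicator_of_mem (by simpa using hk), tailDensity,
        if_neg (by tauto)]
  have hle : ∀ K l k E, tailDensity α j K l k E ≤ α l k E := by
    intro K l k E
    rw [tailDensity]
    split_ifs
    · exact zero_le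
    · exact le_rfl
  have hm := h.measurable_tailDensity j
  have hint : Tendsto (fun K => ∫⁻ E, (∑' k, tailDensity α j K j k E) ^ n) atTop (𝓝 0) := by
    have := tendsto_lintegral_of_dominated_convergence (μ := volume)
      (F := fun K E => (∑' k, tailDensity α j K j k E) ^ n) (f := fun _ => 0)
      (fun E => (∑' k, α j k E) ^ n)
      (fun K => (Measurable.tsum fun k => hm K j k).pow_const _)
      (fun K => Eventually.of_forall fun E => pow_le_pow_left' (ENNReal.tsum_le_tsum (hle K j · E)) _)
      (h.right_pow j).ne
      (Eventually.of_forall fun E => by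
        simpa [hn0] using ENNReal.Tendsto.pow (n := n) (htail E))
    simpa using this
  have hone : Tendsto (fun K => (∫⁻ E, (∑' k, tailDensity α j K j k E) ^ n) ^ (1 / (2 * n) : ℝ))
      atTop (𝓝 0) := by
    have := hint.ennrpow_const (1 / (2 * n) : ℝ)
    rwa [ENNReal.zero_rpow_of_pos hpos] at this
  set C : ℝ≥0∞ := (∫⁻ E, (∑' i, β j i E) ^ n) ^ (1 / (2 * n) : ℝ)
    * ∏ l ∈ Finset.univ.erase j, (∫⁻ E, (∑' i, β l i E) ^ n) ^ (1 / (2 * n) : ℝ)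
      * (∫⁻ E, (∑' k, α l k E) ^ n) ^ (1 / (2 * n) : ℝ) with hC
  have hCtop : C ≠ ⊤ := by
    refine ENNReal.mul_ne_top (ENNReal.rpow_lt_top_of_nonneg hpos.le (h.left_pow j).ne).ne ?_
    exact ENNReal.prod_ne_top fun l _ => ENNReal.mul_ne_top
      (ENNReal.rpow_lt_top_of_nonneg hpos.le (h.left_pow l).ne).ne
      (ENNReal.rpow_lt_top_of_nonneg hpos.le (h.right_pow l).ne).ne
  have hlim : Tendsto (fun K => C * (∫⁻ E, (∑' k, tailDensity α j K j k E) ^ n)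
      ^ (1 / (2 * n) : ℝ)) atTop (𝓝 0) := by
    simpa using ENNReal.Tendsto.const_mul hone (Or.inr hCtop)
  refine tendsto_of_tendsto_of_tendsto_of_le_of_le tendsto_const_nhds hlim (fun _ => zero_le)
    fun K => ?_
  rw [holderBound, ← Finset.mul_prod_erase _ _ (Finset.mem_univ j), hC]
  rw [mul_right_comm]
  refine mul_le_mul' (mul_le_mul' le_rfl
    (Finset.prod_le_prod' fun l _ => mul_le_mul' le_rfl ?_)) le_rfl
  refine ENNReal.rpow_le_rpow (lintegral_mono fun E => ?_) hpos.le
  exact pow_le_pow_left' (ENNReal.tsum_le_tsum (hle K l · E)) _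

/-- The finite partial sums of the chain sum have a continuous integral by
`continuous_integral_prod_translate`, and they converge uniformly in the translation vector. -/
theorem continuous_integral_translate (h : IsChainKernel ρ α β) :
    Continuous fun c : Fin n → ℝ => ∫ E : ℝ, chainSum ρ fun l => E + c l := by
  have hint : ∀ (k : Fin n → ℕ) (c : Fin n → ℝ), Integrable fun E : ℝ =>
      chain ρ (fun l => E + c l) k := by
    intro k c
    exact integrable_prod_of_memLp (u := fun l E => ρ l (k (l - 1)) (k l) (E + c l)) fun l =>
      (h.memLp l _ _).comp_measurePreserving (measurePreserving_add_right volume (c l))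
  have hcont : ∀ K, Continuous fun c : Fin n → ℝ =>
      ∫ E : ℝ, ∑ k ∈ box n K, chain ρ (fun l => E + c l) k := by
    intro K
    simp_rw [fun c => integral_finsetSum (box n K) fun k _ => hint k c]
    exact continuous_finsetSum _ fun k _ =>
      continuous_integral_prod_translate fun l => h.memLp l (k (l - 1)) (k l)
  have hm := h.measurable_tailDensity
  have hbound : Tendsto (fun K => ∑ j, holderBound (tailDensity α j K) β) atTop (𝓝 0) := by
    simpa using tendsto_finsetSum Finset.univ fun j _ => h.tendsto_holderBound_tail j
  have hunif : TendstoUniformly (fun K (c : Fin n → ℝ) =>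
      ∫ E : ℝ, ∑ k ∈ box n K, chain ρ (fun l => E + c l) k)
      (fun c => ∫ E : ℝ, chainSum ρ fun l => E + c l) atTop := by
    rw [EMetric.tendstoUniformly_iff]
    intro ε hε
    filter_upwards [hbound.eventually_lt_const hε] with K hK c
    refine lt_of_le_of_lt ?_ hK
    rw [edist_eq_enorm_sub, ← integral_sub (h.integrable_chainSum_translate c)
      (integrable_finsetSum _ fun k _ => hint k c)]
    refine (enorm_integral_le_lintegral_enorm _).trans ?_
    refine (lintegral_mono fun E => h.enorm_chainSum_sub_le K _).trans ?_
    have hmeas : ∀ j, Measurable fun E : ℝ =>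
        ∏ l, envelope (tailDensity α j K) β l (E + c l) := fun j =>
      Finset.measurable_prod _ fun l _ =>
        (measurable_envelope (hm j K) h.measurable_left l).comp (measurable_add_const (c l))
    rw [lintegral_finsetSum _ fun j _ => hmeas j]
    exact Finset.sum_le_sum fun j _ => lintegral_prod_envelope_le (hm j K) h.measurable_left c
  exact hunif.continuous (Frequently.of_forall hcont)

end IsChainKernel

end

end

/-! ### The Fourier integral in the energy differences -/

section

open scoped FourierTransform

/-- The Fourier integral `∫ φ(t) e^{i u·t} dt` over `ℝⁿ`. -/
def phaseIntegral {n : ℕ} (φ : (Fin n → ℝ) → ℂ) (u : Fin n → ℝ) : ℂ :=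
  ∫ t : Fin n → ℝ, φ t * Complex.exp (Complex.I * (∑ l, u l * t l : ℝ))

theorem phaseIntegral_eq_fourier {n : ℕ} (φ : (Fin n → ℝ) → ℂ) (u : Fin n → ℝ) :
    phaseIntegral φ u = 𝓕 (fun x : EuclideanSpace ℝ (Fin n) => φ (WithLp.ofLp x))
      (WithLp.toLp 2 ((-(2 * Real.pi)⁻¹) • u)) := by
  rw [Real.fourier_eq', phaseIntegral,
    ← (PiLp.volume_preserving_ofLp (Fin n)).integral_comp
      (MeasurableEquiv.toLp 2 (Fin n → ℝ)).symm.measurableEmbedding]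
  refine integral_congr_ae (Eventually.of_forall fun x => ?_)
  simp only [smul_eq_mul]
  rw [mul_comm, PiLp.inner_apply]
  congr 2
  have : (Real.pi : ℂ) ≠ 0 := by exact_mod_cast Real.pi_ne_zero
  simp only [RCLike.inner_apply, conj_trivial, Pi.smul_apply, smul_eq_mul]
  rw [mul_comm Complex.I, mul_eq_mul_right_iff]
  left
  rw [Complex.ofReal_inj, Finset.mul_sum]
  refine Finset.sum_congr rfl fun l _ => ?_
  field_simp

theorem exists_schwartz_phaseIntegral {n : ℕ} (φ : SchwartzMap (Fin n → ℝ) ℂ) :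
    ∃ Φ : SchwartzMap (Fin n → ℝ) ℂ, ∀ u, Φ u = phaseIntegral φ u := by
  have h0 : -(2 * Real.pi)⁻¹ ≠ 0 := neg_ne_zero.2 (by positivity)
  let e : EuclideanSpace ℝ (Fin n) ≃L[ℝ] (Fin n → ℝ) := EuclideanSpace.equiv (Fin n) ℝ
  let L : (Fin n → ℝ) ≃L[ℝ] EuclideanSpace ℝ (Fin n) :=
    (ContinuousLinearEquiv.smulLeft (Units.mk0 _ h0)).trans e.symm
  let φ' : SchwartzMap (EuclideanSpace ℝ (Fin n)) ℂ :=
    SchwartzMap.compCLMOfContinuousLinearEquiv ℂ e φ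
  refine ⟨SchwartzMap.compCLMOfContinuousLinearEquiv ℂ L (𝓕 φ'), fun u => ?_⟩
  rw [phaseIntegral_eq_fourier, SchwartzMap.compCLMOfContinuousLinearEquiv_apply,
    Function.comp_apply, SchwartzMap.fourier_coe]
  rfl

theorem integral_cons {m : ℕ} (G : (Fin (m + 1) → ℝ) → ℂ) (hG : Integrable G) :
    ∫ x, G x = ∫ s : ℝ, ∫ y : Fin m → ℝ, G (Fin.cons s y) := by
  have h := (volume_preserving_piFinSuccAbove (fun _ : Fin (m + 1) => ℝ) 0).symm
  rw [← h.integral_comp (MeasurableEquiv.measurableEmbedding _), Measure.volume_eq_prod,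
    integral_prod]
  · simp only [MeasurableEquiv.piFinSuccAbove_symm_apply, Fin.insertNthEquiv, Fin.insertNth_zero,
      Equiv.coe_fn_mk, cast_eq]
  · exact (h.integrable_comp_emb (MeasurableEquiv.measurableEmbedding _)).2 hG

theorem measurePreserving_cons (m : ℕ) :
    MeasurePreserving (fun p : ℝ × (Fin m → ℝ) => (Fin.cons p.1 p.2 : Fin (m + 1) → ℝ))
      (volume.prod volume) volume := by
  have h := (volume_preserving_piFinSuccAbove (fun _ : Fin (m + 1) => ℝ) 0).symm
  rw [Measure.volume_eq_prod] at h
  have heq : (fun p : ℝ × (Fin m → ℝ) => (Fin.cons p.1 p.2 : Fin (m + 1) → ℝ))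
      = (MeasurableEquiv.piFinSuccAbove (fun _ : Fin (m + 1) => ℝ) 0).symm := by
    funext p
    simp only [MeasurableEquiv.piFinSuccAbove_symm_apply, Fin.insertNthEquiv, Fin.insertNth_zero,
      Equiv.coe_fn_mk, cast_eq]
  rw [heq]
  exact h

theorem measurePreserving_cons_add (m : ℕ) :
    MeasurePreserving (fun p : ℝ × (Fin m → ℝ) =>
      (Fin.cons p.1 (fun j => p.2 j + p.1) : Fin (m + 1) → ℝ)) (volume.prod volume) volume := by
  refine (measurePreserving_cons m).comp ((MeasurePreserving.id volume).skew_product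
    (g := fun (s : ℝ) (y : Fin m → ℝ) => fun j => y j + s) (by fun_prop)
    (Eventually.of_forall fun s => ?_))
  exact (measurePreserving_add_right volume (fun _ : Fin m => s)).map_eq

/-- Fourier inversion at the origin on `ℝᵐ`. -/
theorem integral_phaseIntegral {m : ℕ} {χ : (Fin m → ℝ) → ℂ} (hc : Continuous χ)
    (hi : Integrable χ) (hi' : Integrable (phaseIntegral χ)) :
    ∫ u, phaseIntegral χ u = (2 * (Real.pi : ℂ)) ^ m * χ 0 := by
  have h0 : -(2 * Real.pi)⁻¹ ≠ 0 := neg_ne_zero.2 (by positivity)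
  set χ' : EuclideanSpace ℝ (Fin m) → ℂ := fun x => χ (WithLp.ofLp x) with hχ'
  have hmp := PiLp.volume_preserving_ofLp (Fin m)
  have hme := (MeasurableEquiv.toLp 2 (Fin m → ℝ)).symm.measurableEmbedding
  have hmp' := PiLp.volume_preserving_toLp (Fin m)
  have hme' := (MeasurableEquiv.toLp 2 (Fin m → ℝ)).measurableEmbedding
  have hint : Integrable χ' := (hmp.integrable_comp_emb hme).2 hi
  have hcont : Continuous χ' := hc.comp (PiLp.continuous_ofLp 2 _)
  have heq : phaseIntegral χ
      = fun u => (fun w => 𝓕 χ' (WithLp.toLp 2 w)) ((-(2 * Real.pi)⁻¹) • u) :=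
    funext fun u => phaseIntegral_eq_fourier χ u
  have hint' : Integrable (𝓕 χ') := by
    rw [heq] at hi'
    exact (hmp'.integrable_comp_emb hme').1 ((integrable_comp_smul_iff volume _ h0).1 hi')
  have hinv := congrFun (hcont.fourierInv_fourier_eq hint hint') 0
  rw [Real.fourierInv_eq'] at hinv
  simp only [inner_zero_right, mul_zero, Complex.ofReal_zero, zero_mul, Complex.exp_zero,
    one_smul] at hinv
  rw [heq, Measure.integral_comp_smul,
    show (∫ w, 𝓕 χ' (WithLp.toLp 2 w)) = ∫ x, 𝓕 χ' x from hmp'.integral_comp hme' _, hinv]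
  rw [Module.finrank_fintype_fun_eq_card, Fintype.card_fin, ← inv_pow, inv_neg, inv_inv, abs_pow,
    abs_neg, abs_of_pos (by positivity), Complex.real_smul]
  push_cast
  rfl

/-- The cyclic differences `V l - V (l + 1)` of `V = (0, v)`. -/
def cyclicDiff {m : ℕ} (v : Fin m → ℝ) (l : Fin (m + 1)) : ℝ :=
  (Fin.cons 0 v : Fin (m + 1) → ℝ) l - (Fin.cons 0 v : Fin (m + 1) → ℝ) (l + 1)

theorem sum_cyclicDiff {m : ℕ} (v : Fin m → ℝ) : ∑ l, cyclicDiff v l = 0 := by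
  simp only [cyclicDiff, Finset.sum_sub_distrib]
  rw [sub_eq_zero]
  exact (Equiv.sum_comp (Equiv.addRight (1 : Fin (m + 1)))
    (fun l => (Fin.cons 0 v : Fin (m + 1) → ℝ) l)).symm

/-- The first `m` cyclic differences other than the one at `0` depend on `v` through a unitriangular
matrix. -/
theorem measurePreserving_cyclicDiff (m : ℕ) :
    MeasurePreserving (fun (v : Fin m → ℝ) (j : Fin m) => cyclicDiff v j.succ) := by
  let D : Matrix (Fin m) (Fin m) ℝ := fun i j =>
    (if j = i then 1 else 0) - (if j.succ = i.succ + 1 then 1 else 0)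
  have hD : ∀ v : Fin m → ℝ, Matrix.toLin' D v = fun j => cyclicDiff v j.succ := by
    intro v
    ext i
    rw [Matrix.toLin'_apply, Matrix.mulVec, dotProduct, cyclicDiff]
    simp only [D, sub_mul, ite_mul, one_mul, zero_mul, Finset.sum_sub_distrib, Finset.sum_ite_eq',
      Finset.mem_univ, if_true, Fin.cons_succ]
    congr 1
    rcases Fin.eq_zero_or_eq_succ (i.succ + 1) with h | ⟨j, h⟩
    · rw [h, Fin.cons_zero]
      exact Finset.sum_eq_zero fun j _ => if_neg (Fin.succ_ne_zero j)
    · rw [h, Fin.cons_succ]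
      simp [Fin.succ_inj]
  have hdet : D.det = 1 := by
    have hnext : ∀ i j : Fin m, j.succ = i.succ + 1 → i < j := by
      intro i j h
      have h2 := congrArg Fin.val h
      rw [Fin.val_add_one] at h2
      split_ifs at h2 with h3
      · simp at h2
      · simp only [Fin.val_succ] at h2
        exact Fin.lt_def.2 (by omega)
    rw [Matrix.det_of_isUpperTriangular]
    · refine Finset.prod_eq_one fun i _ => ?_
      simp only [D, if_true]
      rw [if_neg fun h => lt_irrefl _ (hnext i i h), sub_zero]
    · intro i j hij
      simp only [id] at hij
      simp only [D]
      rw [if_neg hij.ne, if_neg fun h => lt_asymm hij (hnext i j h), sub_zero]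
  refine ⟨?_, ?_⟩
  · rw [show (fun (v : Fin m → ℝ) (j : Fin m) => cyclicDiff v j.succ) = Matrix.toLin' D from
      (funext hD).symm]
    exact (LinearMap.continuous_of_finiteDimensional _).measurable
  · rw [show (fun (v : Fin m → ℝ) (j : Fin m) => cyclicDiff v j.succ) = Matrix.toLin' D from
      (funext hD).symm, Real.map_matrix_volume_pi_eq_smul_volume_pi (by rw [hdet]; exact one_ne_zero)]
    simp [hdet]

theorem norm_le_mul_norm_of_cyclicDiff {m : ℕ} (v : Fin m → ℝ) (u : Fin (m + 1) → ℝ)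
    (hu : ∀ l, l ≠ Fin.last m → u l = cyclicDiff v l) : ‖v‖ ≤ m * ‖u‖ := by
  have key : ∀ i : ℕ, ∀ hi : i < m + 1,
      |(Fin.cons 0 v : Fin (m + 1) → ℝ) ⟨i, hi⟩| ≤ i * ‖u‖ := by
    intro i
    induction i with
    | zero => intro hi; simp
    | succ i ih =>
      intro hi
      have hi' : i < m + 1 := by omega
      have hne : (⟨i, hi'⟩ : Fin (m + 1)) ≠ Fin.last m := by
        intro h
        have := congrArg Fin.val h
        simp at this
        omega
      have h1 := hu ⟨i, hi'⟩ hne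
      have hsucc : (⟨i, hi'⟩ : Fin (m + 1)) + 1 = ⟨i + 1, hi⟩ := by
        ext
        rw [Fin.val_add_one, if_neg hne]
      rw [cyclicDiff, hsucc] at h1
      have h2 := ih hi'
      have h3 : |u ⟨i, hi'⟩| ≤ ‖u‖ := norm_le_pi_norm u _
      rw [show (Fin.cons 0 v : Fin (m + 1) → ℝ) ⟨i + 1, hi⟩
        = (Fin.cons 0 v : Fin (m + 1) → ℝ) ⟨i, hi'⟩ - u ⟨i, hi'⟩ by rw [h1]; ring]
      refine (abs_sub _ _).trans ?_
      push_cast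
      linarith
  refine (pi_norm_le_iff_of_nonneg (by positivity)).2 fun j => ?_
  have h := key (j + 1) (by omega)
  rw [show (⟨(j : ℕ) + 1, by omega⟩ : Fin (m + 1)) = j.succ from rfl, Fin.cons_succ] at h
  rw [Real.norm_eq_abs]
  refine h.trans ?_
  gcongr
  exact_mod_cast j.isLt

/-- A Schwartz function decays faster than any power, also in terms of a lower bound `r` of the
norm. -/
theorem exists_norm_le_rpow {E : Type*} [NormedAddCommGroup E] [NormedSpace ℝ E]
    (Φ : SchwartzMap E ℂ) (N : ℕ) :
    ∃ C : ℝ, 0 ≤ C ∧ ∀ u (r : ℝ), 0 ≤ r → r ≤ ‖u‖ → ‖Φ u‖ ≤ C * (1 + r) ^ (-(N : ℝ)) := by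
  refine ⟨2 ^ N * (Finset.Iic (N, 0)).sup (fun p => SchwartzMap.seminorm ℝ p.1 p.2) Φ,
    by positivity, fun u r h0 hr => ?_⟩
  have hΦ : (1 + ‖u‖) ^ N * ‖Φ u‖
      ≤ 2 ^ N * (Finset.Iic (N, 0)).sup (fun p => SchwartzMap.seminorm ℝ p.1 p.2) Φ := by
    simpa using SchwartzMap.one_add_le_sup_seminorm_apply (𝕜 := ℝ) (m := (N, 0))
      (k := N) (n := 0) le_rfl le_rfl Φ u
  rw [Real.rpow_neg (by positivity), Real.rpow_natCast, ← div_eq_mul_inv,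
    le_div_iff₀ (by positivity), mul_comm]
  refine le_trans ?_ hΦ
  gcongr

/-- A Schwartz function of energy differences that agree with `cyclicDiff v` except at the last
position is dominated by an integrable function of `v`. -/
theorem exists_bound_of_cyclicDiff {m : ℕ} (Φ : SchwartzMap (Fin (m + 1) → ℝ) ℂ) :
    ∃ b : (Fin m → ℝ) → ℝ, Integrable b ∧ ∀ v u,
      (∀ l, l ≠ Fin.last m → u l = cyclicDiff v l) → ‖Φ u‖ ≤ b v := by
  obtain ⟨C, -, hΦ⟩ := exists_norm_le_rpow Φ (m + 1)
  have hint : Integrable fun v : Fin m → ℝ => (1 + ‖v‖) ^ (-((m + 1 : ℕ) : ℝ)) := by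
    refine integrable_one_add_norm ?_
    rw [Module.finrank_fintype_fun_eq_card, Fintype.card_fin]
    exact_mod_cast Nat.lt_succ_self m
  have hm : ((m : ℝ) + 1) ≠ 0 := by positivity
  refine ⟨fun v => C * (1 + ‖((m : ℝ) + 1)⁻¹ • v‖) ^ (-((m + 1 : ℕ) : ℝ)),
    (hint.comp_smul (inv_ne_zero hm)).const_mul _, fun v u hu => ?_⟩
  refine hΦ u _ (norm_nonneg _) ?_
  rw [norm_smul, norm_inv, Real.norm_of_nonneg (by positivity), inv_mul_le_iff₀ (by positivity)]
  have h1 := norm_le_mul_norm_of_cyclicDiff v u hu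
  have hu0 : 0 ≤ ‖u‖ := norm_nonneg u
  linarith

/-- The integral of a Fourier transform over the hyperplane of sum zero is the integral over the
orthogonal line, the diagonal. -/
theorem integral_phaseIntegral_cyclicDiff {m : ℕ} (φ : SchwartzMap (Fin (m + 1) → ℝ) ℂ) :
    ∫ v, phaseIntegral φ (cyclicDiff v) = (2 * (Real.pi : ℂ)) ^ m * ∫ s : ℝ, φ fun _ => s := by
  obtain ⟨Φ, hΦ⟩ := exists_schwartz_phaseIntegral φ
  set χ : (Fin m → ℝ) → ℂ := fun x => ∫ s : ℝ, φ (Fin.cons s fun j => x j + s) with hχ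
  have hmp := measurePreserving_cons_add m
  have hcm : ∀ s : ℝ, Continuous fun x : Fin m → ℝ =>
      (Fin.cons s fun j => x j + s : Fin (m + 1) → ℝ) := by
    intro s
    refine continuous_pi fun l => ?_
    refine Fin.cases ?_ (fun j => ?_) l
    · simp only [Fin.cons_zero]; fun_prop
    · simp only [Fin.cons_succ]; fun_prop
  have hcs : ∀ x : Fin m → ℝ, Continuous fun s : ℝ =>
      (Fin.cons s fun j => x j + s : Fin (m + 1) → ℝ) := by
    intro x
    refine continuous_pi fun l => ?_
    refine Fin.cases ?_ (fun j => ?_) l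
    · simp only [Fin.cons_zero]; fun_prop
    · simp only [Fin.cons_succ]; fun_prop
  have hint : Integrable (fun p : ℝ × (Fin m → ℝ) => φ (Fin.cons p.1 fun j => p.2 j + p.1))
      (volume.prod volume) := hmp.integrable_comp_of_integrable φ.integrable
  have hχint : Integrable χ := hint.integral_prod_right
  have hχc : Continuous χ := by
    obtain ⟨C, -, hφ⟩ := exists_norm_le_rpow φ 2
    exact continuous_of_dominated (bound := fun s => C * (1 + ‖s‖) ^ (-((2 : ℕ) : ℝ)))
      (fun x => (φ.continuous.comp (hcs x)).aestronglyMeasurable)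
      (fun x => Eventually.of_forall fun s => hφ _ _ (norm_nonneg s)
        (norm_le_pi_norm (Fin.cons s fun j => x j + s : Fin (m + 1) → ℝ) 0))
      ((integrable_one_add_norm (by simp)).const_mul _)
      (Eventually.of_forall fun s => φ.continuous.comp (hcm s))
  -- On the hyperplane of sum zero the common translation `s` does not contribute to the phase.
  have hkey : ∀ u : Fin (m + 1) → ℝ, ∑ l, u l = 0 →
      phaseIntegral φ u = phaseIntegral χ fun j => u j.succ := by
    intro u hu
    have hph : ∀ (s : ℝ) (x : Fin m → ℝ),
        ∑ l, u l * (Fin.cons s fun j => x j + s : Fin (m + 1) → ℝ) l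
          = ∑ j : Fin m, u j.succ * x j := by
      intro s x
      rw [Fin.sum_univ_succ] at hu ⊢
      simp only [Fin.cons_zero, Fin.cons_succ, mul_add, Finset.sum_add_distrib, ← Finset.sum_mul]
      linear_combination s * hu
    have hbd : ∀ r : ℝ, ‖Complex.exp (Complex.I * r)‖ = 1 := fun r => by
      rw [mul_comm]; exact Complex.norm_exp_ofReal_mul_I r
    have h1 : Integrable (fun t : Fin (m + 1) → ℝ =>
        φ t * Complex.exp (Complex.I * (∑ l, u l * t l : ℝ))) :=
      φ.integrable.mul_bdd (c := 1) (Continuous.aestronglyMeasurable (by fun_prop))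
        (Eventually.of_forall fun t => (hbd _).le)
    have h2 := hmp.integrable_comp_of_integrable h1
    have h3 := integral_map (μ := (volume : Measure ℝ).prod (volume : Measure (Fin m → ℝ)))
      hmp.measurable.aemeasurable (by rw [hmp.map_eq]; exact h1.aestronglyMeasurable)
    rw [hmp.map_eq] at h3
    rw [phaseIntegral, h3]
    refine (integral_prod_symm _ h2).trans ?_
    rw [phaseIntegral]
    refine integral_congr_ae (Eventually.of_forall fun x => ?_)
    simp only [hph, hχ, Function.comp_apply]
    rw [integral_mul_const]
  have hχ' : Integrable (phaseIntegral χ) := by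
    have heq : phaseIntegral χ = fun w : Fin m → ℝ => Φ (Fin.cons (-∑ j, w j) w) := by
      funext w
      rw [hΦ, hkey _ (by rw [Fin.sum_univ_succ]; simp)]
      simp
    have hcont : Continuous (phaseIntegral χ) := by
      rw [heq]
      refine Φ.continuous.comp (continuous_pi fun l => ?_)
      refine Fin.cases ?_ (fun j => ?_) l
      · simp only [Fin.cons_zero]; fun_prop
      · simp only [Fin.cons_succ]; fun_prop
    obtain ⟨C, -, hC⟩ := exists_norm_le_rpow Φ (m + 1)
    refine Integrable.mono' (g := fun w : Fin m → ℝ => C * (1 + ‖w‖) ^ (-((m + 1 : ℕ) : ℝ)))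
      ((integrable_one_add_norm ?_).const_mul _) hcont.aestronglyMeasurable
      (Eventually.of_forall fun w => ?_)
    · rw [Module.finrank_fintype_fun_eq_card, Fintype.card_fin]
      exact_mod_cast Nat.lt_succ_self m
    · rw [heq]
      refine hC _ _ (norm_nonneg w) ((pi_norm_le_iff_of_nonneg (norm_nonneg _)).2 fun j => ?_)
      exact norm_le_pi_norm (Fin.cons (-∑ j, w j) w : Fin (m + 1) → ℝ) j.succ
  have hmpD := measurePreserving_cyclicDiff m
  rw [show (fun v => phaseIntegral φ (cyclicDiff v))
    = fun v => phaseIntegral χ fun j => cyclicDiff v j.succ from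
      funext fun v => hkey _ (sum_cyclicDiff v)]
  rw [← integral_map (φ := fun (v : Fin m → ℝ) (j : Fin m) => cyclicDiff v j.succ)
    hmpD.measurable.aemeasurable (by rw [hmpD.map_eq]; exact hχ'.aestronglyMeasurable), hmpD.map_eq,
    integral_phaseIntegral hχc hχint hχ']
  simp only [hχ, Pi.zero_apply, zero_add]
  congr 2
  ext s
  congr 1
  ext l
  exact Fin.cases rfl (fun _ => rfl) l

end

/-! ### The limit of the rescaled energy integral -/

section

open scoped ENNReal

namespace IsChainKernel

variable {m : ℕ} {ρ : Fin (m + 1) → ℕ → ℕ → ℝ → ℂ} {α β : Fin (m + 1) → ℕ → ℝ → ℝ≥0∞}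

/-- The substitution `x l = E + a l + ε V l` with `V = (0, v)`. -/
theorem integral_rescale (h : IsChainKernel ρ α β) {a ω : Fin (m + 1) → ℝ}
    (ha : ∀ l, a l - a (l + 1) - ω l = if l = Fin.last m then -a 0 else 0)
    (Φ : SchwartzMap (Fin (m + 1) → ℝ) ℂ) {ε : ℝ} (hε : 0 < ε) :
    ((ε : ℂ)⁻¹) ^ m * ∫ x, chainSum ρ x * Φ (fun l => (x l - x (l + 1) - ω l) / ε)
      = ∫ v : Fin m → ℝ, Φ (fun l => cyclicDiff v l + if l = Fin.last m then -a 0 / ε else 0)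
          * ∫ E : ℝ, chainSum ρ fun l => E + (a l + ε * (Fin.cons 0 v : Fin (m + 1) → ℝ) l) := by
  set V : (Fin m → ℝ) → Fin (m + 1) → ℝ := fun v => Fin.cons 0 v with hV
  set U : (Fin m → ℝ) → Fin (m + 1) → ℝ := fun v l =>
    cyclicDiff v l + if l = Fin.last m then -a 0 / ε else 0 with hU
  set G : (Fin (m + 1) → ℝ) → ℂ := fun x =>
    chainSum ρ x * Φ (fun l => (x l - x (l + 1) - ω l) / ε) with hG
  have hVm : Measurable V := by
    refine measurable_pi_lambda _ fun l => ?_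
    refine Fin.cases ?_ (fun j => ?_) l
    · simp only [hV, Fin.cons_zero]; fun_prop
    · simp only [hV, Fin.cons_succ]; fun_prop
  have hVl : ∀ l, Measurable fun v => V v l := fun l => (measurable_pi_apply l).comp hVm
  have hUm : Measurable U := measurable_pi_lambda _ fun l =>
    ((hVl l).sub (hVl (l + 1))).add_const _
  obtain ⟨C, hC⟩ : ∃ C, ∀ u, ‖Φ u‖ ≤ C := by
    obtain ⟨C, -, hC⟩ := Φ.decay 0 0
    exact ⟨C, fun E => by simpa using hC E⟩
  have hGint : Integrable G := h.integrable_chainSum.mul_bdd (c := C)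
    (Φ.continuous.comp (by fun_prop)).aestronglyMeasurable (Eventually.of_forall fun x => hC _)
  have hε' : ε ≠ 0 := hε.ne'
  have hsub : ∀ (E : ℝ), ∫ y : Fin m → ℝ, G (Fin.cons (E + a 0) y)
      = (ε : ℂ) ^ m * ∫ v : Fin m → ℝ,
        chainSum ρ (fun l => E + (a l + ε * V v l)) * Φ (U v) := by
    intro E
    rw [← integral_add_right_eq_self (fun y => G (Fin.cons (E + a 0) y))
      (fun j : Fin m => E + a j.succ)]
    have h2 := Measure.integral_comp_smul (volume : Measure (Fin m → ℝ))
      (fun y => G (Fin.cons (E + a 0) (y + fun j : Fin m => E + a j.succ))) ε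
    rw [Module.finrank_fintype_fun_eq_card, Fintype.card_fin, abs_of_pos (by positivity),
      Complex.real_smul, Complex.ofReal_inv, Complex.ofReal_pow] at h2
    rw [eq_inv_mul_iff_mul_eq₀ (pow_ne_zero _ (by exact_mod_cast hε'))] at h2
    rw [← h2]
    congr 1
    refine integral_congr_ae (Eventually.of_forall fun v => ?_)
    have hx : (Fin.cons (E + a 0) (ε • v + fun j : Fin m => E + a j.succ) : Fin (m + 1) → ℝ)
        = fun l => E + (a l + ε * V v l) := by
      ext l
      refine Fin.cases ?_ (fun j => ?_) l
      · simp [hV]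
      · simp only [Fin.cons_succ, Pi.add_apply, Pi.smul_apply, smul_eq_mul, hV]
        ring
    simp only [hx, hG]
    congr 2
    ext l
    have hal := ha l
    simp only [hU, cyclicDiff]
    rw [div_eq_iff hε']
    split_ifs at hal ⊢
    · rw [add_mul, div_mul_cancel₀ _ hε']
      linear_combination hal
    · linear_combination hal
  have hmeas : Measurable fun p : ℝ × (Fin m → ℝ) =>
      chainSum ρ (fun l => p.1 + (a l + ε * V p.2 l)) * Φ (U p.2) := by
    refine (h.measurable_chainSum.comp (measurable_pi_lambda _ fun l => ?_)).mul
      (Φ.continuous.measurable.comp (hUm.comp measurable_snd))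
    exact measurable_fst.add (((hVl l).comp measurable_snd).const_mul ε |>.const_add (a l))
  have hint : Integrable (fun p : ℝ × (Fin m → ℝ) =>
      chainSum ρ (fun l => p.1 + (a l + ε * V p.2 l)) * Φ (U p.2)) (volume.prod volume) := by
    refine ⟨hmeas.aestronglyMeasurable, ?_⟩
    rw [hasFiniteIntegral_iff_enorm, lintegral_prod_symm' _ hmeas.enorm]
    obtain ⟨b, hb, hle⟩ := exists_bound_of_cyclicDiff Φ
    have hle' : ∀ v, ∫⁻ E : ℝ, ‖chainSum ρ (fun l => E + (a l + ε * V v l)) * Φ (U v)‖ₑ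
        ≤ holderBound α β * ‖b v‖ₑ := by
      intro v
      simp only [enorm_mul]
      rw [lintegral_mul_const' _ _ enorm_ne_top]
      refine mul_le_mul' (h.lintegral_enorm_chainSum_le fun l => a l + ε * V v l) ?_
      refine enorm_le_iff_norm_le.2 ((hle v (U v) fun l hl => ?_).trans (le_abs_self _))
      simp [hU, hl]
    refine (lintegral_mono hle').trans_lt ?_
    rw [lintegral_const_mul' _ _ h.holderBound_lt_top.ne]
    exact ENNReal.mul_lt_top h.holderBound_lt_top hb.2
  rw [integral_cons G hGint,
    ← integral_add_right_eq_self (fun s => ∫ y : Fin m → ℝ, G (Fin.cons s y)) (a 0)]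
  simp_rw [hsub]
  rw [integral_const_mul, ← mul_assoc, ← mul_pow, inv_mul_cancel₀ (by exact_mod_cast hε'), one_pow,
    one_mul, integral_integral_swap hint]
  refine integral_congr_ae (Eventually.of_forall fun v => ?_)
  simp only
  rw [integral_mul_const, mul_comm]

/-- The limit of the rescaled energy integral: in the variables of `integral_rescale` the chain sum
is evaluated at a common energy in the limit, while the Fourier factor either does not depend on
`ε` or moves off to infinity. -/
theorem tendsto_integral (h : IsChainKernel ρ α β) {a ω : Fin (m + 1) → ℝ}
    (ha : ∀ l, a l - a (l + 1) - ω l = if l = Fin.last m then -a 0 else 0)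
    (φ : SchwartzMap (Fin (m + 1) → ℝ) ℂ) :
    Tendsto (fun ε : ℝ => ((ε : ℂ)⁻¹) ^ m *
        ∫ x, chainSum ρ x * phaseIntegral φ (fun l => (x l - x (l + 1) - ω l) / ε))
      (𝓝[>] 0) (𝓝 ((2 * (Real.pi : ℂ)) ^ m * (∫ s : ℝ, φ fun _ => s) *
        (if a 0 = 0 then 1 else 0) * ∫ E : ℝ, chainSum ρ fun l => E + a l)) := by
  obtain ⟨Φ, hΦ⟩ := exists_schwartz_phaseIntegral φ
  simp_rw [← hΦ]
  set I : (Fin (m + 1) → ℝ) → ℂ := fun c => ∫ E : ℝ, chainSum ρ fun l => E + c l with hI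
  have hIc : Continuous I := h.continuous_integral_translate
  have hIb : ∀ c, ‖I c‖ ≤ (holderBound α β).toReal := by
    intro c
    rw [hI, ← toReal_enorm]
    refine ENNReal.toReal_mono h.holderBound_lt_top.ne ?_
    exact (enorm_integral_le_lintegral_enorm _).trans (h.lintegral_enorm_chainSum_le c)
  set V : (Fin m → ℝ) → Fin (m + 1) → ℝ := fun v => Fin.cons 0 v with hV
  have hVc : Continuous V := by
    refine continuous_pi fun l => ?_
    refine Fin.cases ?_ (fun j => ?_) l
    · simp only [hV, Fin.cons_zero]; fun_prop
    · simp only [hV, Fin.cons_succ]; fun_prop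
  have hVl : ∀ l, Continuous fun v => V v l := fun l => (continuous_apply l).comp hVc
  obtain ⟨b, hb, hle⟩ := exists_bound_of_cyclicDiff Φ
  set U : ℝ → (Fin m → ℝ) → Fin (m + 1) → ℝ := fun ε v l =>
    cyclicDiff v l + if l = Fin.last m then -a 0 / ε else 0 with hU
  have hUc : ∀ ε, Continuous (U ε) := fun ε => continuous_pi fun l =>
    ((hVl l).sub (hVl (l + 1))).add continuous_const
  have hlim : Tendsto (fun ε : ℝ => ∫ v : Fin m → ℝ, Φ (U ε v) * I fun l => a l + ε * V v l)
      (𝓝[>] 0) (𝓝 (∫ v : Fin m → ℝ, (if a 0 = 0 then Φ (cyclicDiff v) else 0) * I a)) := by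
    refine tendsto_integral_filter_of_dominated_convergence
      (fun v => b v * (holderBound α β).toReal) ?_ ?_ (hb.mul_const _) ?_
    · refine Eventually.of_forall fun ε => Continuous.aestronglyMeasurable ?_
      exact (Φ.continuous.comp (hUc ε)).mul (hIc.comp (continuous_pi fun l =>
        continuous_const.add (continuous_const.mul (hVl l))))
    · refine Eventually.of_forall fun ε => Eventually.of_forall fun v => ?_
      rw [norm_mul]
      have h1 : ‖Φ (U ε v)‖ ≤ b v := hle v (U ε v) fun l hl => by simp [hU, hl]
      exact mul_le_mul h1 (hIb _) (norm_nonneg _) ((norm_nonneg _).trans h1)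
    · refine Eventually.of_forall fun v => Tendsto.mul ?_ ?_
      · split_ifs with h0
        · refine tendsto_const_nhds.congr fun ε => ?_
          congr 1
          ext l
          simp [hU, h0]
        · -- The last energy difference diverges.
          have hdiv : Tendsto (fun ε : ℝ => U ε v (Fin.last m)) (𝓝[>] 0) (cocompact ℝ) := by
            have h1 : Tendsto (fun ε : ℝ => -a 0 * ε⁻¹) (𝓝[>] 0) (cocompact ℝ) :=
              ((Homeomorph.mulLeft₀ (-a 0) (neg_ne_zero.2 h0)).isClosedEmbedding.tendsto_cocompact).comp
                (tendsto_inv_nhdsGT_zero.mono_right atTop_le_cocompact)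
            have h2 := ((Homeomorph.addLeft
              (cyclicDiff v (Fin.last m))).isClosedEmbedding.tendsto_cocompact).comp h1
            refine h2.congr fun ε => ?_
            simp [hU, div_eq_mul_inv]
          have hdiv' : Tendsto (fun ε : ℝ => U ε v) (𝓝[>] 0) (cocompact _) := by
            rw [← Metric.cobounded_eq_cocompact, ← tendsto_norm_atTop_iff_cobounded] at hdiv ⊢
            exact tendsto_atTop_mono (fun ε => norm_le_pi_norm (U ε v) (Fin.last m)) hdiv
          exact (zero_at_infty Φ).comp hdiv'
      · refine (hIc.tendsto a).comp (tendsto_nhdsWithin_of_tendsto_nhds ?_)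
        have : Continuous fun ε : ℝ => fun l => a l + ε * V v l := by fun_prop
        simpa using this.tendsto 0
  have hval : (∫ v : Fin m → ℝ, (if a 0 = 0 then Φ (cyclicDiff v) else 0) * I a)
      = (2 * (Real.pi : ℂ)) ^ m * (∫ s : ℝ, φ fun _ => s) * (if a 0 = 0 then 1 else 0) * I a := by
    rw [integral_mul_const]
    split_ifs
    · simp_rw [hΦ]
      rw [integral_phaseIntegral_cyclicDiff, mul_one]
    · simp
  rw [hval] at hlim
  refine hlim.congr' ?_
  filter_upwards [self_mem_nhdsWithin] with ε hε
  exact (h.integral_rescale ha Φ hε).symm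

end IsChainKernel

end

/-! ### Energy densities as chain kernels -/

section

open scoped ENNReal ComplexOrder

variable {H : Type*} [NormedAddCommGroup H] [InnerProductSpace ℂ H]

theorem isEnergyElement_energyElement {S : ℝ → H →L[ℂ] H} {g f : H}
    (h : ∃ ρ, IsEnergyElement S g f ρ) :
    IsEnergyElement S g f fun E => energyElement S E g f := by
  have : (fun E => energyElement S E g f) = h.choose := by
    funext E
    rw [energyElement, dif_pos h]
  rw [this]
  exact h.choose_spec

variable [CompleteSpace H]

/-- The energy density of `f` has total mass `‖f‖²`. -/
theorem IsEnergyElement.lintegral_enorm {S : ℝ → H →L[ℂ] H} (hS : IsUnitaryGroup S) {f : H}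
    {ρ : ℝ → ℂ} (h : IsEnergyElement S f f ρ) : ∫⁻ E, ‖ρ E‖ₑ = ENNReal.ofReal (‖f‖ ^ 2) := by
  obtain ⟨h1, h2⟩ := (isEnergyElement_iff hS).1 h
  rw [← ofReal_integral_norm_eq_lintegral_enorm h1]
  congr 1
  have h3 := h2 0
  simp only [hS.map_zero, one_apply_eq_self, Complex.ofReal_zero, mul_zero, zero_mul,
    Complex.exp_zero, mul_one, inner_self_eq_norm_sq_to_K] at h3
  have h4 : ((∫ E, ‖ρ E‖ : ℝ) : ℂ) = ∫ E, ρ E := by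
    rw [← integral_complex_ofReal]
    refine integral_congr_ae ?_
    filter_upwards [h.ae_nonneg hS] with E hE
    exact (Complex.norm_of_nonneg' hE)
  have h5 : ((∫ E, ‖ρ E‖ : ℝ) : ℂ) = ((‖f‖ ^ 2 : ℝ) : ℂ) := by
    rw [h4, ← h3, Complex.ofReal_pow]
    rfl
  exact Complex.ofReal_injective h5

/-- The matrix elements `⟨g (l - 1) j, P_E (f l k)⟩`, modified on a null set of energies, form a
chain kernel. -/
theorem exists_isChainKernel {S : ℝ → H →L[ℂ] H} (hS : IsUnitaryGroup S) {n : ℕ} [NeZero n]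
    {f g : Fin n → ℕ → H} (hf2 : ∀ l, Summable fun k => ‖f l k‖ ^ 2)
    (hg2 : ∀ l, Summable fun k => ‖g l k‖ ^ 2)
    (hf : ∀ l, HasEnergyDensity S n (f l)) (hg : ∀ l, HasEnergyDensity S n (g l)) :
    ∃ (ρ : Fin n → ℕ → ℕ → ℝ → ℂ) (α β : Fin n → ℕ → ℝ → ℝ≥0∞), IsChainKernel ρ α β ∧
      ∀ l j k, IsEnergyElement S (g (l - 1) j) (f l k) (ρ l j k) := by
  have hn : n ≠ 0 := NeZero.ne n
  have hF : ∀ l k, IsEnergyElement S (f l k) (f l k) fun E => energyElement S E (f l k) (f l k) :=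
    fun l k => isEnergyElement_energyElement ((hf l).1 k)
  have hG : ∀ l k, IsEnergyElement S (g l k) (g l k) fun E => energyElement S E (g l k) (g l k) :=
    fun l k => isEnergyElement_energyElement ((hg l).1 k)
  choose R hR using fun l j k => exists_isEnergyElement hS (hF l k) (g (l - 1) j)
  let R' : Fin n → ℕ → ℕ → ℝ → ℂ := fun l j k => (hR l j k).1.1.mk (R l j k)
  let α₀ : Fin n → ℕ → ℝ → ℝ≥0∞ := fun l k E => ‖(hF l k).1.1.mk _ E‖ₑ
  let β₀ : Fin n → ℕ → ℝ → ℝ≥0∞ := fun l k E => ‖(hG (l - 1) k).1.1.mk _ E‖ₑ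
  have hαm : ∀ l k, Measurable (α₀ l k) := fun l k =>
    (hF l k).1.1.stronglyMeasurable_mk.measurable.enorm
  have hβm : ∀ l k, Measurable (β₀ l k) := fun l k =>
    (hG (l - 1) k).1.1.stronglyMeasurable_mk.measurable.enorm
  have hαeq : ∀ l k, (fun E => ‖energyElement S E (f l k) (f l k)‖ₑ) =ᵐ[volume] α₀ l k := by
    intro l k
    filter_upwards [(hF l k).1.1.ae_eq_mk] with E hE
    simp only [α₀]
    rw [← hE]
  have hβeq : ∀ l k, (fun E => ‖energyElement S E (g (l - 1) k) (g (l - 1) k)‖ₑ)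
      =ᵐ[volume] β₀ l k := by
    intro l k
    filter_upwards [(hG (l - 1) k).1.1.ae_eq_mk] with E hE
    simp only [β₀]
    rw [← hE]
  have hone : ∀ (a : ℕ → ℝ → ℝ≥0∞) (x : ℕ → H), (∀ k, Measurable (a k)) →
      (∀ k, IsEnergyElement S (x k) (x k) fun E => energyElement S E (x k) (x k)) →
      (∀ k, (fun E => ‖energyElement S E (x k) (x k)‖ₑ) =ᵐ[volume] a k) →
      (Summable fun k => ‖x k‖ ^ 2) → ∫⁻ E, ∑' k, a k E < ⊤ := by
    intro a x ham hx hax hsum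
    rw [lintegral_tsum fun k => (ham k).aemeasurable]
    simp_rw [fun k => (lintegral_congr_ae (hax k)).symm.trans ((hx k).lintegral_enorm hS)]
    exact hsum.tsum_ofReal_lt_top
  have hpow : ∀ (a : ℕ → ℝ → ℝ≥0∞) (x : ℕ → H), HasEnergyDensity S n x →
      (∀ k, (fun E => ‖energyElement S E (x k) (x k)‖ₑ) =ᵐ[volume] a k) →
      ∫⁻ E, (∑' k, a k E) ^ n < ⊤ := by
    intro a x hx hax
    refine lt_of_le_of_lt (lintegral_mono_ae ?_) hx.2
    filter_upwards [ae_all_iff.2 hax] with E hE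
    exact pow_le_pow_left' (ENNReal.tsum_le_tsum fun k => (hE k).ge) n
  have hα1 : ∀ l, ∫⁻ E, ∑' k, α₀ l k E < ⊤ := fun l =>
    hone (α₀ l) (f l) (hαm l) (hF l) (hαeq l) (hf2 l)
  have hβ1 : ∀ l, ∫⁻ E, ∑' k, β₀ l k E < ⊤ := fun l =>
    hone (β₀ l) (g (l - 1)) (hβm l) (hG (l - 1)) (hβeq l) (hg2 (l - 1))
  have hαn : ∀ l, ∫⁻ E, (∑' k, α₀ l k E) ^ n < ⊤ := fun l =>
    hpow (α₀ l) (f l) (hf l) (hαeq l)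
  have hβn : ∀ l, ∫⁻ E, (∑' k, β₀ l k E) ^ n < ⊤ := fun l =>
    hpow (β₀ l) (g (l - 1)) (hg (l - 1)) (hβeq l)
  have hgood : ∀ᵐ E, (∀ l j k, ‖R' l j k E‖ₑ ≤ β₀ l j E ^ (1 / 2 : ℝ) * α₀ l k E ^ (1 / 2 : ℝ)) ∧
      (∀ l, ∑' k, α₀ l k E < ⊤) ∧ ∀ l, ∑' k, β₀ l k E < ⊤ := by
    refine Eventually.and ?_ (Eventually.and ?_ ?_)
    · refine ae_all_iff.2 fun l => ae_all_iff.2 fun j => ae_all_iff.2 fun k => ?_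
      have := (hR l j k).ae_norm_sq_le hS (hF l k) (hG (l - 1) j)
      filter_upwards [this, (hR l j k).1.1.ae_eq_mk, hαeq l k, hβeq l j] with E h1 h2 h3 h4
      rw [← h3, ← h4]
      simp only [R']
      rw [← h2, ← ENNReal.mul_rpow_of_nonneg _ _ (by norm_num : (0 : ℝ) ≤ 1 / 2)]
      have h5 : ‖R l j k E‖ₑ ^ (2 : ℝ) ≤ ‖energyElement S E (g (l - 1) j) (g (l - 1) j)‖ₑ
          * ‖energyElement S E (f l k) (f l k)‖ₑ := by
        rw [ENNReal.rpow_ofNat, ← enorm_pow, ← enorm_mul, enorm_le_iff_norm_le, norm_pow, norm_mul]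
        exact h1
      calc ‖R l j k E‖ₑ = (‖R l j k E‖ₑ ^ (2 : ℝ)) ^ (1 / 2 : ℝ) := by
            rw [← ENNReal.rpow_mul]; norm_num
        _ ≤ _ := ENNReal.rpow_le_rpow h5 (by norm_num)
    · exact eventually_all.2 fun l => ae_lt_top (Measurable.tsum fun k => hαm l k) (hα1 l).ne
    · exact eventually_all.2 fun l => ae_lt_top (Measurable.tsum fun k => hβm l k) (hβ1 l).ne
  obtain ⟨N, hNsub, hNm, hN0⟩ := exists_measurable_superset_of_null (ae_iff.1 hgood)
  have hN : ∀ E ∉ N, _ := fun E hE => not_not.1 fun h => hE (hNsub h)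
  have hNae : ∀ᵐ E, E ∉ N := measure_eq_zero_iff_ae_notMem.1 hN0
  have hzero : (0 : ℝ≥0∞) ^ (1 / 2 : ℝ) = 0 := ENNReal.zero_rpow_of_pos (by norm_num)
  have hle : ∀ (a : ℝ → ℝ≥0∞) E, Nᶜ.indicator a E ≤ a E := fun a E =>
    Set.indicator_le_self Nᶜ a E
  refine ⟨fun l j k => Nᶜ.indicator (R' l j k), fun l k => Nᶜ.indicator (α₀ l k),
    fun l j => Nᶜ.indicator (β₀ l j), ?_, fun l j k => ?_⟩
  · constructor
    · exact fun l j k => (hR l j k).1.1.stronglyMeasurable_mk.measurable.indicator hNm.compl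
    · exact fun l j => (hβm l j).indicator hNm.compl
    · exact fun l k => (hαm l k).indicator hNm.compl
    · intro l j k E
      by_cases hE : E ∈ N
      · simp [hE]
      · simpa [hE] using (hN E hE).1 l j k
    · intro l E
      by_cases hE : E ∈ N
      · simp [hE]
      · simpa [hE] using (hN E hE).2.2 l
    · intro l E
      by_cases hE : E ∈ N
      · simp [hE]
      · simpa [hE] using (hN E hE).2.1 l
    · exact fun l => (lintegral_mono fun E => ENNReal.tsum_le_tsum fun j => hle _ E).trans_lt (hβ1 l)
    · exact fun l => (lintegral_mono fun E => ENNReal.tsum_le_tsum fun j => hle _ E).trans_lt (hα1 l)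
    · exact fun l => (lintegral_mono fun E => pow_le_pow_left'
        (ENNReal.tsum_le_tsum fun j => hle _ E) n).trans_lt (hβn l)
    · exact fun l => (lintegral_mono fun E => pow_le_pow_left'
        (ENNReal.tsum_le_tsum fun j => hle _ E) n).trans_lt (hαn l)
  · have heq : R l j k =ᵐ[volume] Nᶜ.indicator (R' l j k) := by
      filter_upwards [(hR l j k).1.1.ae_eq_mk, hNae] with E h1 h2
      rw [Set.indicator_of_mem h2]
      exact h1
    refine ⟨(hR l j k).1.congr heq, fun φ => ?_⟩
    rw [← (hR l j k).2 φ]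
    refine integral_congr_ae ?_
    filter_upwards [heq] with E hE
    rw [hE]

section

variable {S : ℝ → H →L[ℂ] H} {n : ℕ} [NeZero n] {f g : Fin n → ℕ → H}
  {ρ : Fin n → ℕ → ℕ → ℝ → ℂ} {α β : Fin n → ℕ → ℝ → ℝ≥0∞}

theorem norm_exp_I_ofReal (r : ℝ) : ‖Complex.exp (Complex.I * r)‖ = 1 := by
  rw [mul_comm]
  exact Complex.norm_exp_ofReal_mul_I r

/-- The cyclic product of the two-point functions is the Fourier transform of the chain sum. -/
theorem IsChainKernel.hasSum_prod_inner (hS : IsUnitaryGroup S) (h : IsChainKernel ρ α β)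
    (hρ : ∀ l j k, IsEnergyElement S (g (l - 1) j) (f l k) (ρ l j k)) (s : Fin n → ℝ) :
    HasSum (fun k : Fin n → ℕ => ∏ l, inner ℂ (S (s (l - 1)) (g (l - 1) (k (l - 1))))
        (S (s l) (f l (k l))))
      (∫ x : Fin n → ℝ, chainSum ρ x * Complex.exp (Complex.I * (∑ l, x l * (s l - s (l - 1)) : ℝ)))
    := by
  have hint : ∀ k, Integrable fun x => chain ρ x k := fun k =>
    ⟨(h.measurable_chain k).aestronglyMeasurable,
      (ENNReal.le_tsum k).trans_lt h.lintegral_tsum_chain_lt_top⟩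
  set e : (Fin n → ℝ) → ℂ := fun x =>
    Complex.exp (Complex.I * (∑ l, x l * (s l - s (l - 1)) : ℝ)) with he
  have hec : Continuous e := by fun_prop
  have hint' : ∀ k, Integrable fun x => chain ρ x k * e x := fun k =>
    (hint k).mul_bdd (c := 1) hec.aestronglyMeasurable
      (Eventually.of_forall fun x => (norm_exp_I_ofReal _).le)
  have hsum : Summable fun k => ∫ x, ‖chain ρ x k * e x‖ := by
    have h1 : ∀ k, ∫ x, ‖chain ρ x k * e x‖ = (∫⁻ x, ‖chain ρ x k‖ₑ).toReal := by
      intro k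
      rw [integral_norm_eq_lintegral_enorm (hint' k).1]
      congr 1
      refine lintegral_congr fun x => ?_
      rw [enorm_mul, ← ofReal_norm (e x), he, norm_exp_I_ofReal, ENNReal.ofReal_one, mul_one]
    simp_rw [h1]
    exact ENNReal.summable_toReal h.lintegral_tsum_chain_lt_top.ne
  have key := hasSum_integral_of_summable_integral_norm hint' hsum
  have hval : ∀ k, ∫ x, chain ρ x k * e x = ∏ l, inner ℂ (S (s (l - 1)) (g (l - 1) (k (l - 1))))
        (S (s l) (f l (k l))) := by
    intro k
    have h1 : ∀ x, chain ρ x k * e x = ∏ l, ρ l (k (l - 1)) (k l) (x l)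
        * Complex.exp (Complex.I * ((s l - s (l - 1) : ℝ) : ℂ) * x l) := by
      intro x
      rw [Finset.prod_mul_distrib, ← Complex.exp_sum, chain, he]
      congr 2
      push_cast
      rw [Finset.mul_sum]
      congr 1
      exact Finset.sum_congr rfl fun l _ => by ring
    simp_rw [h1]
    rw [integral_fintype_prod_volume_eq_prod fun l E => ρ l (k (l - 1)) (k l) E
        * Complex.exp (Complex.I * ((s l - s (l - 1) : ℝ) : ℂ) * E)]
    refine Finset.prod_congr rfl fun l _ => ?_
    rw [hS.inner_apply, ((isEnergyElement_iff hS).1 (hρ l _ _)).2]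
  simp_rw [hval] at key
  simp_rw [tsum_mul_right] at key
  exact key

/-- The integral of a cyclic product of two-point functions against a test function, with the
integrations over times and energies exchanged. -/
theorem IsChainKernel.integral_phase (h : IsChainKernel ρ α β) (φ : SchwartzMap (Fin n → ℝ) ℂ)
    (ω : Fin n → ℝ) (ε : ℝ) :
    Integrable (fun t : Fin n → ℝ =>
      (∫ x : Fin n → ℝ, chainSum ρ x *
        Complex.exp (Complex.I * (∑ l, x l * (t l / ε - t (l - 1) / ε) : ℝ))) *
        (Complex.exp (-(Complex.I * (∑ l, t l * ω l / ε : ℝ))) * φ t)) ∧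
    ∫ t : Fin n → ℝ, (∫ x : Fin n → ℝ, chainSum ρ x *
        Complex.exp (Complex.I * (∑ l, x l * (t l / ε - t (l - 1) / ε) : ℝ))) *
        (Complex.exp (-(Complex.I * (∑ l, t l * ω l / ε : ℝ))) * φ t)
      = ∫ x, chainSum ρ x * phaseIntegral φ (fun l => (x l - x (l + 1) - ω l) / ε) := by
  set F : (Fin n → ℝ) × (Fin n → ℝ) → ℂ := fun p =>
    (φ p.1 * chainSum ρ p.2) * Complex.exp (Complex.I *
      (∑ l, (p.2 l - p.2 (l + 1) - ω l) / ε * p.1 l : ℝ)) with hF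
  have hint : Integrable F (volume.prod volume) := by
    refine (φ.integrable.mul_prod h.integrable_chainSum).mul_bdd (c := 1)
      (Continuous.aestronglyMeasurable (by fun_prop))
      (Eventually.of_forall fun x => (norm_exp_I_ofReal _).le)
  have hcongr : ∀ t : Fin n → ℝ, (∫ x : Fin n → ℝ, chainSum ρ x *
        Complex.exp (Complex.I * (∑ l, x l * (t l / ε - t (l - 1) / ε) : ℝ))) *
        (Complex.exp (-(Complex.I * (∑ l, t l * ω l / ε : ℝ))) * φ t) = ∫ x, F (t, x) := by
    intro t
    rw [← integral_mul_const]
    refine integral_congr_ae (Eventually.of_forall fun x => ?_)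
    simp only [hF]
    have hexp : (∑ l, (x l - x (l + 1) - ω l) / ε * t l : ℝ)
        = (∑ l, x l * (t l / ε - t (l - 1) / ε) : ℝ) - ∑ l, t l * ω l / ε := by
      have hre : ∑ l, x (l + 1) * (t l / ε) = ∑ l, x l * (t (l - 1) / ε) := by
        rw [← Equiv.sum_comp (Equiv.addRight (1 : Fin n)) fun l => x l * (t (l - 1) / ε)]
        simp
      simp only [mul_sub, Finset.sum_sub_distrib]
      rw [← hre, ← Finset.sum_sub_distrib, ← Finset.sum_sub_distrib]
      exact Finset.sum_congr rfl fun l _ => by ring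
    rw [hexp, Complex.ofReal_sub, mul_sub, sub_eq_add_neg, Complex.exp_add]
    ring
  simp_rw [hcongr]
  refine ⟨hint.integral_prod_left, ?_⟩
  rw [integral_integral_swap (f := fun t x => F (t, x)) hint]
  refine integral_congr_ae (Eventually.of_forall fun x => ?_)
  simp only [hF, phaseIntegral]
  rw [← integral_const_mul]
  refine integral_congr_ae (Eventually.of_forall fun t => ?_)
  simp only
  ring

end

end

/-! ### The limit of the cyclic sums -/

section

open scoped ENNReal

/-- The partial sums `ω̃` solve the equations of `IsChainKernel.tendsto_integral`, with a defect
`-ω̃_0` at the last position. -/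
theorem tailFreq_sub {m : ℕ} (ω : Fin (m + 1) → ℝ) (l : Fin (m + 1)) :
    tailFreq ω l - tailFreq ω (l + 1) - ω l = if l = Fin.last m then -tailFreq ω 0 else 0 := by
  split_ifs with h
  · subst h
    have h1 : tailFreq ω (Fin.last m) = ω (Fin.last m) := by
      rw [tailFreq, show Finset.Ici (Fin.last m) = {Fin.last m} by
        ext x; simp [Fin.last_le_iff], Finset.sum_singleton]
    rw [Fin.last_add_one, h1]
    ring
  · have hlt : l < l + 1 := Fin.lt_add_one_iff.2 (Fin.lt_last_iff_ne_last.2 h)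
    have h1 : Finset.Ici l = insert l (Finset.Ici (l + 1)) := by
      ext x
      simp only [Finset.mem_Ici, Finset.mem_insert]
      have hv : ((l + 1 : Fin (m + 1)) : ℕ) = l + 1 := by rw [Fin.val_add_one, if_neg h]
      rw [Fin.le_def, Fin.le_def, Fin.ext_iff, hv]
      omega
    rw [tailFreq, h1, Finset.sum_insert (by rw [Finset.mem_Ici]; exact not_le.2 hlt), tailFreq]
    ring

variable {H : Type*} [NormedAddCommGroup H] [InnerProductSpace ℂ H]

/-- The cyclic sum `∑_k ∏_l ⟨S_{s (l-1)} g (l-1) (k (l-1)), S_{s l} f l (k l)⟩`, that is the trace of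
the product of the operators `∑ k, |S_{s l} f l k⟩⟨S_{s l} g l k|`. -/
def cyclicSum (S : ℝ → H →L[ℂ] H) {n : ℕ} [NeZero n] (f g : Fin n → ℕ → H) (s : Fin n → ℝ) : ℂ :=
  ∑' k : Fin n → ℕ, ∏ l, inner ℂ (S (s (l - 1)) (g (l - 1) (k (l - 1)))) (S (s l) (f l (k l)))

variable [CompleteSpace H]

/-- The low density limit of one cyclic sum: its trace density is integrable, and the rescaled
integral against a Schwartz function tends to the integral of this density times the delta functions
and the Kronecker symbol. -/
theorem cyclicSum_limit {S : ℝ → H →L[ℂ] H} (hS : IsUnitaryGroup S) {n : ℕ} [hn : NeZero n]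
    {f g : Fin n → ℕ → H} (ω : Fin n → ℝ) (hf2 : ∀ l, Summable fun k => ‖f l k‖ ^ 2)
    (hg2 : ∀ l, Summable fun k => ‖g l k‖ ^ 2)
    (hf : ∀ l, HasEnergyDensity S n (f l)) (hg : ∀ l, HasEnergyDensity S n (g l)) :
    (∀ᵐ E : ℝ, Summable fun k : Fin n → ℕ =>
      ∏ l, energyElement S (E + tailFreq ω l) (g (l - 1) (k (l - 1))) (f l (k l))) ∧
    Integrable (fun E : ℝ => ∑' k : Fin n → ℕ,
      ∏ l, energyElement S (E + tailFreq ω l) (g (l - 1) (k (l - 1))) (f l (k l))) ∧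
    ∀ φ : SchwartzMap (Fin n → ℝ) ℂ,
      (∀ ε : ℝ, Integrable fun t : Fin n → ℝ => cyclicSum S f g (fun l => t l / ε) *
        (Complex.exp (-(Complex.I * (∑ l, t l * ω l / ε : ℝ))) * φ t)) ∧
      Tendsto (fun ε : ℝ => ((ε : ℂ)⁻¹) ^ (n - 1) * ∫ t : Fin n → ℝ,
        cyclicSum S f g (fun l => t l / ε) *
          (Complex.exp (-(Complex.I * (∑ l, t l * ω l / ε : ℝ))) * φ t))
        (𝓝[>] 0) (𝓝 ((2 * (Real.pi : ℂ)) ^ (n - 1) * (∫ s : ℝ, φ fun _ => s) *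
          (if tailFreq ω 0 = 0 then 1 else 0) * ∫ E : ℝ, ∑' k : Fin n → ℕ,
          ∏ l, energyElement S (E + tailFreq ω l) (g (l - 1) (k (l - 1))) (f l (k l)))) := by
  obtain ⟨ρ, α, β, h, hρ⟩ := exists_isChainKernel hS hf2 hg2 hf hg
  have hae : ∀ᵐ E : ℝ, ∀ l j k,
      energyElement S (E + tailFreq ω l) (g (l - 1) j) (f l k) = ρ l j k (E + tailFreq ω l) := by
    refine ae_all_iff.2 fun l => ae_all_iff.2 fun j => ae_all_iff.2 fun k => ?_
    exact (measurePreserving_add_right volume (tailFreq ω l)).quasiMeasurePreserving.ae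
      ((isEnergyElement_energyElement ⟨_, hρ l j k⟩).ae_eq (hρ l j k))
  have hterm : ∀ᵐ E : ℝ, (fun k : Fin n → ℕ =>
      ∏ l, energyElement S (E + tailFreq ω l) (g (l - 1) (k (l - 1))) (f l (k l)))
        = chain ρ fun l => E + tailFreq ω l := by
    filter_upwards [hae] with E hE
    funext k
    exact Finset.prod_congr rfl fun l _ => hE l _ _
  have hsum : (fun E : ℝ => ∑' k : Fin n → ℕ,
      ∏ l, energyElement S (E + tailFreq ω l) (g (l - 1) (k (l - 1))) (f l (k l)))
      =ᵐ[volume] fun E => chainSum ρ fun l => E + tailFreq ω l := by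
    filter_upwards [hterm] with E hE
    rw [hE, chainSum]
  refine ⟨?_, (h.integrable_chainSum_translate (tailFreq ω)).congr hsum.symm, fun φ => ?_⟩
  · filter_upwards [hterm] with E hE
    rw [hE]
    exact h.summable _
  · have hcyc : ∀ (ε : ℝ) (t : Fin n → ℝ), cyclicSum S f g (fun l => t l / ε)
        = ∫ x : Fin n → ℝ, chainSum ρ x *
          Complex.exp (Complex.I * (∑ l, x l * (t l / ε - t (l - 1) / ε) : ℝ)) :=
      fun ε t => (h.hasSum_prod_inner hS hρ (fun l => t l / ε)).tsum_eq
    simp_rw [hcyc]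
    refine ⟨fun ε => (h.integral_phase φ ω ε).1, ?_⟩
    simp_rw [fun ε => (h.integral_phase φ ω ε).2]
    rw [integral_congr_ae hsum]
    obtain ⟨m, rfl⟩ := Nat.exists_eq_succ_of_ne_zero hn.out
    exact h.tendsto_integral (tailFreq_sub ω) φ

end

/-! ### Gaussian moments as sums over bijections -/

section Matching

variable {ι R : Type*} [DecidableEq ι] [CommSemiring R]

/-- `∑ ∏ A q (σ q)` over the bijections `σ` from the members of the list `L` to the finite set `P`,
expanded along the rows in the order of `L`. -/
def listMatchingSum (A : ι → ι → R) : List ι → Finset ι → R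
  | [], P => if P = ∅ then 1 else 0
  | q :: L, P => ∑ p ∈ P, A q p * listMatchingSum A L (P.erase p)

theorem listMatchingSum_perm (A : ι → ι → R) {L L' : List ι} (h : L.Perm L') (P : Finset ι) :
    listMatchingSum A L P = listMatchingSum A L' P := by
  induction h generalizing P with
  | nil => rfl
  | cons q _ ih => simp only [listMatchingSum, ih]
  | swap q q' L =>
    simp only [listMatchingSum, Finset.mul_sum]
    rw [Finset.sum_comm' (t' := P) (s' := fun p => P.erase p)
      (by intro x y; simp only [Finset.mem_erase]; tauto)]
    refine Finset.sum_congr rfl fun p _ => Finset.sum_congr rfl fun p' _ => ?_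
    rw [Finset.erase_right_comm]
    ring
  | trans _ _ ih1 ih2 => rw [ih1, ih2]

/-- The sum of `∏ A q (σ q)` over the bijections `σ : Q → P`. -/
def matchingSum (A : ι → ι → R) (Q P : Finset ι) : R := listMatchingSum A Q.toList P

@[simp]
theorem matchingSum_empty (A : ι → ι → R) : matchingSum A ∅ ∅ = 1 := by
  simp [matchingSum, listMatchingSum]

/-- Expansion of the sum over bijections `insert q Q → P` along the row `q`. -/
theorem matchingSum_insert (A : ι → ι → R) {q : ι} {Q : Finset ι} (hq : q ∉ Q) (P : Finset ι) :
    matchingSum A (insert q Q) P = ∑ p ∈ P, A q p * matchingSum A Q (P.erase p) := by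
  rw [matchingSum, listMatchingSum_perm A (Finset.toList_insert hq)]
  rfl

/-- Expansion of the sum over bijections `Q → insert p P` along the column `p`. -/
theorem matchingSum_insert_right (A : ι → ι → R) (Q : Finset ι) {p : ι} {P : Finset ι}
    (hp : p ∉ P) :
    matchingSum A Q (insert p P) = ∑ q ∈ Q, A q p * matchingSum A (Q.erase q) P := by
  induction Q using Finset.induction_on generalizing P with
  | empty => simp [matchingSum, listMatchingSum]
  | insert q Q hq ih =>
    rw [matchingSum_insert A hq, Finset.sum_insert hp, Finset.sum_insert hq,
      Finset.erase_insert hp, Finset.erase_insert hq]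
    congr 1
    have h1 : ∀ p' ∈ P, A q p' * matchingSum A Q ((insert p P).erase p')
        = ∑ q' ∈ Q, A q p' * (A q' p * matchingSum A (Q.erase q') (P.erase p')) := by
      intro p' hp'
      have hne : p ≠ p' := fun h => hp (h ▸ hp')
      rw [Finset.erase_insert_of_ne hne, ih (fun h => hp (Finset.mem_of_mem_erase h)),
        Finset.mul_sum]
    rw [Finset.sum_congr rfl h1, Finset.sum_comm]
    refine Finset.sum_congr rfl fun q' hq' => ?_
    have hne : q ≠ q' := fun h => hq (h ▸ hq')
    rw [Finset.erase_insert_of_ne hne,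
      matchingSum_insert A (fun h => hq (Finset.mem_of_mem_erase h)), Finset.mul_sum]
    exact Finset.sum_congr rfl fun _ _ => by ring

theorem matchingSum_congr {A A' : ι → ι → R} {Q P : Finset ι}
    (h : ∀ q ∈ Q, ∀ p ∈ P, A q p = A' q p) : matchingSum A Q P = matchingSum A' Q P := by
  induction Q using Finset.induction_on generalizing P with
  | empty => simp [matchingSum, listMatchingSum]
  | insert q Q hq ih =>
    rw [matchingSum_insert A hq, matchingSum_insert A' hq]
    refine Finset.sum_congr rfl fun p hp => ?_
    rw [h q (Finset.mem_insert_self _ _) p hp, ih fun q' hq' p' hp' =>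
      h q' (Finset.mem_insert_of_mem hq') p' (Finset.mem_of_mem_erase hp')]

end Matching

section Wick

variable {H : Type*} [NormedAddCommGroup H] [InnerProductSpace ℂ H]
variable {ι : Type*} [LinearOrder ι] [Fintype ι]

/-- The symbol of a letter: `(l, false)` stands for the creation operator `A⁺(F l)`, and
`(l, true)` for the annihilation operator `A(G l)`. -/
def letterSymbol (F G : ι → H) (x : ι × Bool) : H ⊕ H :=
  if x.2 then Sum.inr (G x.1) else Sum.inl (F x.1)

/-- The operator in the contraction of `A(g_q)` with `A⁺(f_p)`: `1 + nhat` if the annihilation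
operator is to the left, that is for `q < p`, and `nhat` otherwise. -/
def contraction (nhat : H →L[ℂ] H) (q p : ι) : H →L[ℂ] H := if q < p then 1 + nhat else nhat

theorem sum_fin_get {α M : Type*} [DecidableEq α] [AddCommMonoid M] {l : List α} (hl : l.Nodup)
    (F : α → M) : ∑ i : Fin l.length, F (l.get i) = ∑ y ∈ l.toFinset, F y := by
  rw [List.sum_toFinset F hl, ← List.sum_ofFn]
  congr 1
  conv_rhs => rw [← List.ofFn_get l, List.map_ofFn]
  rfl

/-- The Gaussian moment of a word in which the letters occur in increasing order, where
`A⁺(F l)` comes before `A(G l)`, is a sum over the bijections from the annihilation operators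
to the creation operators. -/
theorem wickSum_sorted (nhat : H →L[ℂ] H) (F G : ι → H) (L : List (ι × Bool))
    (hL : L.Pairwise fun x y => toLex x < toLex y) :
    wickSum nhat (L.map (letterSymbol F G)) =
      matchingSum (fun q p => inner ℂ (G q) (contraction nhat q p (F p)))
        (Finset.univ.filter fun i => (i, true) ∈ L) (Finset.univ.filter fun i => (i, false) ∈ L) := by
  induction hn : L.length using Nat.strong_induction_on generalizing L with
  | _ n ih =>
  cases L with
  | nil => simp [wickSum, matchingSum, listMatchingSum]
  | cons x l =>
    obtain ⟨hx, hl⟩ := List.pairwise_cons.1 hL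
    have hnd : l.Nodup := hl.imp (S := (· ≠ ·)) fun h => by rintro rfl; exact lt_irrefl _ h
    have hxl : x ∉ l := fun h => lt_irrefl _ (hx x h)
    set A : ι → ι → ℂ := fun q p => inner ℂ (G q) (contraction nhat q p (F p)) with hA
    have h1 : wickSum nhat ((x :: l).map (letterSymbol F G)) =
        ∑ y : ι × Bool, if y ∈ l then twoPoint nhat (letterSymbol F G x) (letterSymbol F G y) *
          matchingSum A (Finset.univ.filter fun i => (i, true) ∈ l.erase y)
            (Finset.univ.filter fun i => (i, false) ∈ l.erase y) else 0 := by
      rw [List.map_cons, wickSum, ← Finset.sum_filter]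
      rw [show (Finset.univ.filter fun y => y ∈ l) = l.toFinset by ext; simp,
        ← sum_fin_get hnd]
      refine Fintype.sum_equiv (finCongr (List.length_map _)) _ _ fun i => ?_
      have hi : (i : ℕ) < l.length := by simpa using i.2
      have h2 : (l.map (letterSymbol F G)).eraseIdx i
          = (l.erase (l.get ⟨i, hi⟩)).map (letterSymbol F G) := by
        rw [List.Nodup.erase_get hnd ⟨i, hi⟩, List.eraseIdx_map]
      rw [h2, ih _ _ (l.erase (l.get ⟨i, hi⟩)) (hl.sublist List.erase_sublist) rfl]
      · simp
      · rw [List.length_erase_of_mem (List.get_mem _ _), ← hn, List.length_cons]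
        omega
    rw [h1, Fintype.sum_prod_type]
    simp only [Fintype.sum_bool]
    obtain ⟨q, b⟩ := x
    cases b with
    | true =>
      have h3 : (Finset.univ.filter fun i => (i, true) ∈ (q, true) :: l)
          = insert q (Finset.univ.filter fun i => (i, true) ∈ l) := by
        ext i; simp
      have h4 : (Finset.univ.filter fun i => (i, false) ∈ (q, true) :: l)
          = Finset.univ.filter fun i => (i, false) ∈ l := by
        ext i; simp
      rw [h3, h4, matchingSum_insert A (by simpa using hxl), Finset.sum_filter]
      refine Finset.sum_congr rfl fun p _ => ?_
      simp only [letterSymbol, twoPoint, zero_mul, ite_self, zero_add, if_true, Bool.false_eq_true,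
        if_false]
      split_ifs with hp
      · have hlt : q < p := by
          rcases Prod.Lex.lt_iff.1 (hx _ hp) with h | ⟨_, h⟩
          · exact h
          · exact absurd h (by simp)
        congr 2
        · simp [hA, contraction, hlt]
        · ext i; simp [hnd.mem_erase_iff]
        · ext i; simp [hnd.mem_erase_iff]
      · rfl
    | false =>
      have h3 : (Finset.univ.filter fun i => (i, false) ∈ (q, false) :: l)
          = insert q (Finset.univ.filter fun i => (i, false) ∈ l) := by
        ext i; simp
      have h4 : (Finset.univ.filter fun i => (i, true) ∈ (q, false) :: l)
          = Finset.univ.filter fun i => (i, true) ∈ l := by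
        ext i; simp
      rw [h3, h4, matchingSum_insert_right A _ (by simpa using hxl), Finset.sum_filter]
      refine Finset.sum_congr rfl fun p _ => ?_
      simp only [letterSymbol, twoPoint, zero_mul, ite_self, add_zero, if_true, Bool.false_eq_true,
        if_false]
      split_ifs with hp
      · have hlt : ¬ p < q := by
          rcases Prod.Lex.lt_iff.1 (hx _ hp) with h | ⟨h, _⟩
          · exact h.not_gt
          · exact fun h' => absurd h'.ne' (by simpa using h)
        congr 2
        · simp [contraction, hlt]
        · ext i; simp [hnd.mem_erase_iff]
        · ext i; simp [hnd.mem_erase_iff]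
      · rfl

end Wick

/-! ### The cycle through a given label -/

section Box

variable {ι : Type*} [DecidableEq ι] [Fintype ι]

/-- The multi-indices which are less than `M` on `P` and agree with `k₀` outside of `P`. -/
def boxOn (M : ℕ) (P : Finset ι) (k₀ : ι → ℕ) : Finset (ι → ℕ) :=
  Fintype.piFinset fun l => if l ∈ P then Finset.range M else {k₀ l}

theorem mem_boxOn {M : ℕ} {P : Finset ι} {k₀ k : ι → ℕ} :
    k ∈ boxOn M P k₀ ↔ (∀ l ∈ P, k l < M) ∧ ∀ l ∉ P, k l = k₀ l := by
  rw [boxOn, Fintype.mem_piFinset]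
  constructor
  · refine fun h => ⟨fun l hl => ?_, fun l hl => ?_⟩ <;> simpa [hl] using h l
  · rintro ⟨h1, h2⟩ l
    split_ifs with hl
    · simpa using h1 l hl
    · simpa using h2 l hl

@[simp]
theorem boxOn_empty (M : ℕ) (k₀ : ι → ℕ) : boxOn M ∅ k₀ = {k₀} := by
  ext k
  simp [mem_boxOn, funext_iff]

variable {A : Type*} [AddCommMonoid A]

/-- Summation over the coordinate `d` separately. -/
theorem sum_boxOn_insert (M : ℕ) {P : Finset ι} {d : ι} (hd : d ∉ P) (k₀ : ι → ℕ)
    (F : (ι → ℕ) → A) : ∑ k ∈ boxOn M (insert d P) k₀, F k =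
      ∑ j ∈ Finset.range M, ∑ k ∈ boxOn M P (Function.update k₀ d j), F k := by
  rw [Finset.sum_sigma']
  refine Finset.sum_bij' (fun k _ => (⟨k d, k⟩ : Σ _ : ℕ, ι → ℕ)) (fun x _ => x.2) ?_ ?_
    (fun _ _ => rfl) ?_ (fun _ _ => rfl)
  · intro k hk
    rw [mem_boxOn] at hk
    rw [Finset.mem_sigma, Finset.mem_range, mem_boxOn]
    refine ⟨hk.1 d (Finset.mem_insert_self _ _), fun l hl => hk.1 l (Finset.mem_insert_of_mem hl),
      fun l hl => ?_⟩
    by_cases hld : l = d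
    · subst hld; simp
    · rw [Function.update_of_ne hld]
      exact hk.2 l (by simp [hld, hl])
  · rintro ⟨j, k⟩ hx
    rw [Finset.mem_sigma, Finset.mem_range, mem_boxOn] at hx
    obtain ⟨hj, h1, h2⟩ := hx
    have hkd : k d = j := by simpa using h2 d hd
    rw [mem_boxOn]
    refine ⟨fun l hl => ?_, fun l hl => ?_⟩
    · rcases Finset.mem_insert.1 hl with rfl | hl
      · simpa [hkd] using hj
      · exact h1 l hl
    · rw [Finset.mem_insert, not_or] at hl
      simpa [Function.update_of_ne hl.1] using h2 l hl.2
  · rintro ⟨j, k⟩ hx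
    rw [Finset.mem_sigma, Finset.mem_range, mem_boxOn] at hx
    have hkd : k d = j := by simpa using hx.2.2 d hd
    simp [hkd]

/-- The coordinates of the base point outside of `P` do not matter if the summand depends on the
coordinates in `P` only. -/
theorem sum_boxOn_congr (M : ℕ) {P : Finset ι} (k₀ k₁ : ι → ℕ) {F : (ι → ℕ) → A}
    (hF : ∀ k k', (∀ l ∈ P, k l = k' l) → F k = F k') :
    ∑ k ∈ boxOn M P k₀, F k = ∑ k ∈ boxOn M P k₁, F k := by
  refine Finset.sum_bij' (fun k _ => fun l => if l ∈ P then k l else k₁ l)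
    (fun k _ => fun l => if l ∈ P then k l else k₀ l) ?_ ?_ ?_ ?_ ?_
  · intro k hk
    rw [mem_boxOn] at hk ⊢
    exact ⟨fun l hl => by simpa [hl] using hk.1 l hl, fun l hl => by simp [hl]⟩
  · intro k hk
    rw [mem_boxOn] at hk ⊢
    exact ⟨fun l hl => by simpa [hl] using hk.1 l hl, fun l hl => by simp [hl]⟩
  · intro k hk
    rw [mem_boxOn] at hk
    funext l
    by_cases hl : l ∈ P <;> simp [hl, hk.2 l]
  · intro k hk
    rw [mem_boxOn] at hk
    funext l
    by_cases hl : l ∈ P <;> simp [hl, hk.2 l]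
  · exact fun k _ => hF _ _ fun l hl => by simp [hl]

/-- Multiplying out a product, in a given order, of sums. -/
theorem list_prod_sum_eq_sum_boxOn {B : Type*} [Semiring B] (M : ℕ) (a : ι → ℕ → B) {L : List ι}
    (hL : L.Nodup) (k₀ : ι → ℕ) :
    (L.map fun l => ∑ j ∈ Finset.range M, a l j).prod
      = ∑ k ∈ boxOn M L.toFinset k₀, (L.map fun l => a l (k l)).prod := by
  induction L generalizing k₀ with
  | nil => simp
  | cons d L ih =>
    obtain ⟨hd, hL⟩ := List.nodup_cons.1 hL
    have hd' : d ∉ L.toFinset := by simpa using hd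
    rw [List.toFinset_cons, sum_boxOn_insert M hd', List.map_cons, List.prod_cons, Finset.sum_mul]
    refine Finset.sum_congr rfl fun j _ => ?_
    rw [ih hL (Function.update k₀ d j), Finset.mul_sum]
    refine Finset.sum_congr rfl fun k hk => ?_
    have hkd : k d = j := by simpa using (mem_boxOn.1 hk).2 d hd'
    rw [List.map_cons, List.prod_cons, hkd]

end Box

section Path

variable {H : Type*} [NormedAddCommGroup H] [InnerProductSpace ℂ H]
variable {ι : Type*} [DecidableEq ι]

/-- The sum of the operators `X c d₁ * T d₁ * X d₁ d₂ * T d₂ * ⋯ * T dₘ * X dₘ a` over all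
sequences of `m` distinct members `d₁, …, dₘ` of `R`. -/
def pathOpAux (X : ι → ι → H →L[ℂ] H) (T : ι → H →L[ℂ] H) (a : ι) :
    ℕ → ι → Finset ι → H →L[ℂ] H
  | 0, c, _ => X c a
  | m + 1, c, R => ∑ d ∈ R, X c d * T d * pathOpAux X T a m d (R.erase d)

/-- The sum of the operators `X c d₁ * T d₁ * X d₁ d₂ * T d₂ * ⋯ * T dₘ * X dₘ a` over all
enumerations `d₁, …, dₘ` of `R`. -/
def pathOp (X : ι → ι → H →L[ℂ] H) (T : ι → H →L[ℂ] H) (a c : ι) (R : Finset ι) : H →L[ℂ] H :=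
  pathOpAux X T a R.card c R

@[simp]
theorem pathOp_empty (X : ι → ι → H →L[ℂ] H) (T : ι → H →L[ℂ] H) (a c : ι) :
    pathOp X T a c ∅ = X c a := rfl

theorem pathOp_eq_sum (X : ι → ι → H →L[ℂ] H) (T : ι → H →L[ℂ] H) (a c : ι) {R : Finset ι}
    (hR : R.Nonempty) :
    pathOp X T a c R = ∑ d ∈ R, X c d * T d * pathOp X T a d (R.erase d) := by
  obtain ⟨m, hm⟩ := Nat.exists_eq_succ_of_ne_zero (Finset.card_ne_zero.2 hR)
  rw [pathOp, hm, pathOpAux]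
  refine Finset.sum_congr rfl fun d hd => ?_
  rw [pathOp, Finset.card_erase_of_mem hd, hm]
  rfl

/-- The finite rank operator `∑ k < M, |f k⟩⟨g k|`. -/
def partialOp (f g : ℕ → H) (M : ℕ) : H →L[ℂ] H :=
  ∑ k ∈ Finset.range M, InnerProductSpace.rankOne ℂ (f k) (g k)

theorem partialOp_apply (f g : ℕ → H) (M : ℕ) (x : H) :
    partialOp f g M x = ∑ k ∈ Finset.range M, inner ℂ (g k) x • f k := by
  simp [partialOp]

/-- A sum over the subsets `R` of `P` and the members of `R`, rearranged by the member. -/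
theorem sum_powerset_eq_empty_add {A : Type*} [AddCommMonoid A] (P : Finset ι)
    (F : ι → Finset ι → A) (F0 : A) :
    ∑ R ∈ P.powerset, (if R = ∅ then F0 else ∑ d ∈ R, F d (R.erase d)) =
      F0 + ∑ d ∈ P, ∑ R ∈ (P.erase d).powerset, F d R := by
  rw [← Finset.add_sum_erase _ _ (Finset.empty_mem_powerset P), if_pos rfl]
  congr 1
  have h1 : ∀ R ∈ P.powerset.erase ∅, (if R = ∅ then F0 else ∑ d ∈ R, F d (R.erase d))
      = ∑ d ∈ R, F d (R.erase d) := fun R hR => if_neg (Finset.mem_erase.1 hR).1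
  rw [Finset.sum_congr rfl h1, Finset.sum_sigma', Finset.sum_sigma']
  refine Finset.sum_bij' (fun x _ => ⟨x.2, x.1.erase x.2⟩) (fun x _ => ⟨insert x.1 x.2, x.1⟩)
    ?_ ?_ ?_ ?_ ?_
  · rintro ⟨R, d⟩ h
    simp only [Finset.mem_sigma, Finset.mem_erase, Finset.mem_powerset] at h ⊢
    exact ⟨h.1.2 h.2, Finset.erase_subset_erase _ h.1.2⟩
  · rintro ⟨d, R⟩ h
    simp only [Finset.mem_sigma, Finset.mem_erase, Finset.mem_powerset] at h ⊢
    exact ⟨⟨Finset.insert_ne_empty _ _, Finset.insert_subset h.1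
      (h.2.trans (Finset.erase_subset _ _))⟩, Finset.mem_insert_self _ _⟩
  · rintro ⟨R, d⟩ h
    simp only [Finset.mem_sigma] at h
    simp [Finset.insert_erase h.2]
  · rintro ⟨d, R⟩ h
    simp only [Finset.mem_sigma, Finset.mem_powerset] at h
    have : d ∉ R := fun hd => Finset.notMem_erase d P (h.2 hd)
    simp [Finset.erase_insert this]
  · exact fun _ _ => rfl

variable [Fintype ι]

/-- The sum over the indices below `M` of the sums over the bijections from the annihilation
operators to the creation operators with labels in `Q`. -/
def matchingMoment (X : ι → ι → H →L[ℂ] H) (f g : ι → ℕ → H) (M : ℕ) (Q : Finset ι) : ℂ :=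
  ∑ k ∈ boxOn M Q 0, matchingSum (fun q p => inner ℂ (g q (k q)) (X q p (f p (k p)))) Q Q

theorem sum_boxOn_matchingSum (X : ι → ι → H →L[ℂ] H) (f g : ι → ℕ → H) (M : ℕ) (Q : Finset ι)
    (k₀ : ι → ℕ) :
    ∑ k ∈ boxOn M Q k₀, matchingSum (fun q p => inner ℂ (g q (k q)) (X q p (f p (k p)))) Q Q
      = matchingMoment X f g M Q :=
  sum_boxOn_congr M k₀ 0 fun k k' h => matchingSum_congr fun q hq p hp => by rw [h q hq, h p hp]

/-- Following a bijection from the row `c` until it meets the column `a`. -/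
theorem sum_boxOn_matchingSum_insert (X : ι → ι → H →L[ℂ] H) (f g : ι → ℕ → H) (M : ℕ) (a : ι)
    (P : Finset ι) (ha : a ∉ P) (c : ι) (hc : c ∉ P) (k₀ : ι → ℕ) :
    ∑ k ∈ boxOn M P k₀, matchingSum (fun q p => inner ℂ (g q (k q)) (X q p (f p (k p))))
        (insert c P) (insert a P) =
      ∑ R ∈ P.powerset, inner ℂ (g c (k₀ c))
        (pathOp X (fun l => partialOp (f l) (g l) M) a c R (f a (k₀ a))) *
          matchingMoment X f g M (P \ R) := by
  induction hn : P.card using Nat.strong_induction_on generalizing P c k₀ with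
  | _ n ih =>
  set T : ι → H →L[ℂ] H := fun l => partialOp (f l) (g l) M with hT
  have hk : ∀ k ∈ boxOn M P k₀, k c = k₀ c ∧ k a = k₀ a := fun k hk =>
    ⟨(mem_boxOn.1 hk).2 c hc, (mem_boxOn.1 hk).2 a ha⟩
  have h1 : ∀ k ∈ boxOn M P k₀,
      matchingSum (fun q p => inner ℂ (g q (k q)) (X q p (f p (k p)))) (insert c P) (insert a P) =
      inner ℂ (g c (k₀ c)) (X c a (f a (k₀ a))) *
        matchingSum (fun q p => inner ℂ (g q (k q)) (X q p (f p (k p)))) P P +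
      ∑ d ∈ P, inner ℂ (g c (k₀ c)) (X c d (f d (k d))) *
        matchingSum (fun q p => inner ℂ (g q (k q)) (X q p (f p (k p))))
          (insert d (P.erase d)) (insert a (P.erase d)) := by
    intro k hkb
    rw [matchingSum_insert _ hc, Finset.sum_insert ha, Finset.erase_insert ha, (hk k hkb).1,
      (hk k hkb).2]
    congr 1
    refine Finset.sum_congr rfl fun d hd => ?_
    rw [Finset.insert_erase hd, Finset.erase_insert_of_ne (ne_of_mem_of_not_mem hd ha).symm]
  rw [Finset.sum_congr rfl h1, Finset.sum_add_distrib, ← Finset.mul_sum, sum_boxOn_matchingSum,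
    Finset.sum_comm]
  have h2 : ∀ d ∈ P, ∑ k ∈ boxOn M P k₀, inner ℂ (g c (k₀ c)) (X c d (f d (k d))) *
        matchingSum (fun q p => inner ℂ (g q (k q)) (X q p (f p (k p))))
          (insert d (P.erase d)) (insert a (P.erase d)) =
      ∑ R ∈ (P.erase d).powerset, inner ℂ (g c (k₀ c))
        ((X c d * T d * pathOp X T a d R) (f a (k₀ a))) *
          matchingMoment X f g M ((P.erase d) \ R) := by
    intro d hd
    have had : a ≠ d := fun h => ha (h ▸ hd)
    have hbox : boxOn M P k₀ = boxOn M (insert d (P.erase d)) k₀ := by rw [Finset.insert_erase hd]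
    rw [hbox, sum_boxOn_insert M (Finset.notMem_erase d P)]
    have h3 : ∀ j ∈ Finset.range M, ∑ k ∈ boxOn M (P.erase d) (Function.update k₀ d j),
        inner ℂ (g c (k₀ c)) (X c d (f d (k d))) *
        matchingSum (fun q p => inner ℂ (g q (k q)) (X q p (f p (k p))))
          (insert d (P.erase d)) (insert a (P.erase d)) =
        ∑ R ∈ (P.erase d).powerset, (inner ℂ (g c (k₀ c)) (X c d (f d j)) *
          inner ℂ (g d j) (pathOp X T a d R (f a (k₀ a)))) *
            matchingMoment X f g M ((P.erase d) \ R) := by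
      intro j _
      have h4 : ∀ k ∈ boxOn M (P.erase d) (Function.update k₀ d j), k d = j := fun k hk => by
        simpa using (mem_boxOn.1 hk).2 d (Finset.notMem_erase d P)
      rw [Finset.sum_congr rfl fun k hk => by rw [h4 k hk], ← Finset.mul_sum,
        ih _ (hn ▸ Finset.card_erase_lt_of_mem hd) (P.erase d)
          (fun h => ha (Finset.mem_of_mem_erase h)) d (Finset.notMem_erase d P) _ rfl,
        Finset.mul_sum]
      refine Finset.sum_congr rfl fun R _ => ?_
      rw [Function.update_self, Function.update_of_ne had, mul_assoc]
    rw [Finset.sum_congr rfl h3, Finset.sum_comm]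
    refine Finset.sum_congr rfl fun R _ => ?_
    rw [← Finset.sum_mul]
    congr 1
    rw [mul_apply_eq_comp, mul_apply_eq_comp, hT]
    simp only
    rw [partialOp_apply, map_sum, inner_sum]
    refine Finset.sum_congr rfl fun j _ => ?_
    rw [map_smul, inner_smul_right, mul_comm]
  rw [Finset.sum_congr rfl h2]
  rw [← sum_powerset_eq_empty_add P (fun d R => inner ℂ (g c (k₀ c))
        ((X c d * T d * pathOp X T a d R) (f a (k₀ a))) * matchingMoment X f g M ((P.erase d) \ R))]
  refine Finset.sum_congr rfl fun R hR => ?_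
  split_ifs with h
  · subst h; simp
  · rw [pathOp_eq_sum X T a c (Finset.nonempty_iff_ne_empty.2 h), sum_apply,
      inner_sum, Finset.sum_mul]
    refine Finset.sum_congr rfl fun d hd => ?_
    congr 2
    ext x
    simp only [Finset.mem_sdiff, Finset.mem_erase]
    by_cases hx : x = d
    · subst hx; simp [hd]
    · simp [hx]

/-- The sum over bijections of `Q`, organised by the cycle through `a ∈ Q`. -/
theorem matchingMoment_insert (X : ι → ι → H →L[ℂ] H) (f g : ι → ℕ → H) (M : ℕ) {a : ι}
    {P : Finset ι} (ha : a ∉ P) :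
    matchingMoment X f g M (insert a P) = ∑ R ∈ P.powerset,
      (∑ j ∈ Finset.range M, inner ℂ (g a j)
        (pathOp X (fun l => partialOp (f l) (g l) M) a a R (f a j))) *
          matchingMoment X f g M (P \ R) := by
  rw [matchingMoment, sum_boxOn_insert M ha]
  rw [Finset.sum_congr rfl fun j _ => sum_boxOn_matchingSum_insert X f g M a P ha a ha _,
    Finset.sum_comm]
  simp only [Function.update_self, Finset.sum_mul]

end Path

/-! ### Truncated functions of the Gaussian moments -/

section Truncated

variable {ι : Type*} [DecidableEq ι]

/-- The sum over the partitions of `I` of the products of the values of `V` on the blocks. -/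
def partitionSum (V : Finset ι → ℂ) (I : Finset ι) : ℂ :=
  ∑ π : Finpartition I, ∏ B ∈ π.parts, V B

theorem partitionSum_empty (V : Finset ι → ℂ) : partitionSum V ∅ = 1 := by
  have h : (Finset.univ : Finset (Finpartition (∅ : Finset ι))) = {⊥} := by
    ext π
    simp only [Finset.mem_univ, Finset.mem_singleton, true_iff]
    exact Subsingleton.elim (α := Finpartition (⊥ : Finset ι)) _ _
  rw [partitionSum, h, Finset.sum_singleton]
  simp

/-- Partitions of `insert a P` organised by the block of `a`. -/
theorem partitionSum_insert (V : Finset ι → ℂ) {a : ι} {P : Finset ι} (ha : a ∉ P) :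
    partitionSum V (insert a P) =
      ∑ R ∈ P.powerset, V (insert a R) * partitionSum V (P \ R) := by
  simp only [partitionSum, Finset.mul_sum]
  rw [Finset.sum_sigma']
  symm
  have hne : ∀ R : Finset ι, insert a R ≠ ⊥ := fun R => Finset.insert_ne_empty a R
  have hdisj : ∀ R : Finset ι, Disjoint (P \ R) (insert a R) := fun R => by
    rw [Finset.disjoint_insert_right]
    exact ⟨fun h => ha (Finset.mem_sdiff.1 h).1, Finset.sdiff_disjoint⟩
  have hsup : ∀ R ∈ P.powerset, (P \ R) ⊔ insert a R = insert a P := fun R hR => by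
    rw [Finset.sup_eq_union, Finset.union_insert, Finset.sdiff_union_of_subset
      (Finset.mem_powerset.1 hR)]
  have hmem : ∀ (R : Finset ι) (π : Finpartition (P \ R)), insert a R ∉ π.parts := by
    intro R π h
    exact ha (Finset.mem_sdiff.1 (π.le h (Finset.mem_insert_self a R))).1
  refine Finset.sum_bij (fun x hx => x.2.extend (hne x.1) (hdisj x.1)
    (hsup x.1 (Finset.mem_sigma.1 hx).1)) (fun _ _ => Finset.mem_univ _) ?_ ?_ ?_
  · rintro ⟨R, π⟩ h ⟨R', π'⟩ h' heq
    simp only [Finset.mem_sigma, Finset.mem_powerset, Finset.mem_univ, and_true] at h h'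
    have hparts : insert (insert a R) π.parts = insert (insert a R') π'.parts :=
      congrArg Finpartition.parts heq
    have h1 : insert a R ∈ insert (insert a R') π'.parts :=
      hparts ▸ Finset.mem_insert_self _ _
    have h2 : insert a R = insert a R' := by
      rcases Finset.mem_insert.1 h1 with h1 | h1
      · exact h1
      · exact absurd (Finset.mem_sdiff.1 (π'.le h1 (Finset.mem_insert_self a R))).1 ha
    have h3 : R = R' := by
      rw [← Finset.erase_insert (fun h4 => ha (h h4)), h2,
        Finset.erase_insert (fun h4 => ha (h' h4))]
    subst h3
    have h4 : π.parts = π'.parts := by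
      rw [← Finset.erase_insert (hmem R π), hparts, Finset.erase_insert (hmem R π')]
    rw [Finpartition.ext h4]
  · intro π _
    have haI : a ∈ insert a P := Finset.mem_insert_self a P
    set B := π.part a with hB
    have hBm : B ∈ π.parts := π.part_mem.2 haI
    have haB : a ∈ B := π.mem_part haI
    have hBP : B.erase a ⊆ P := fun x hx => by
      have := π.le hBm (Finset.mem_of_mem_erase hx)
      exact (Finset.mem_insert.1 this).resolve_left (Finset.ne_of_mem_erase hx)
    have hs : (π.parts.erase B).sup id = P \ B.erase a := by
      ext x
      simp only [Finset.mem_sup, Finset.mem_erase, id, Finset.mem_sdiff, not_and]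
      constructor
      · rintro ⟨C, ⟨hCB, hC⟩, hx⟩
        have hxB : x ∉ B := fun hxB => hCB (π.eq_of_mem_parts hC hBm hx hxB)
        refine ⟨(Finset.mem_insert.1 (π.le hC hx)).resolve_left fun h => hxB (h ▸ haB),
          fun _ h => hxB h⟩
      · rintro ⟨hxP, hxB⟩
        obtain ⟨C, hC, hxC⟩ := π.exists_mem (Finset.mem_insert_of_mem hxP : x ∈ insert a P)
        refine ⟨C, ⟨fun h => ?_, hC⟩, hxC⟩
        exact hxB (ne_of_mem_of_not_mem hxP ha) (h ▸ hxC)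
    refine ⟨⟨B.erase a, π.ofSubset (Finset.erase_subset _ _) hs⟩, ?_, ?_⟩
    · simpa using hBP
    · refine Finpartition.ext ?_
      change insert (insert a (B.erase a)) (π.parts.erase B) = π.parts
      rw [Finset.insert_erase haB, Finset.insert_erase hBm]
  · rintro ⟨R, π⟩ h
    exact (Finset.prod_insert (hmem R π)).symm

/-- The defining relation of the truncated functions, with the one-block partition included. -/
theorem eq_partitionSum_truncated (W : Finset ι → ℂ) {I : Finset ι} (hI : I.Nonempty) :
    W I = partitionSum (truncated W) I := by
  have hne : I ≠ ⊥ := Finset.nonempty_iff_ne_empty.1 hI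
  have h1 : ∀ π : Finpartition I, π.parts.card < 2 ↔ π = Finpartition.indiscrete hne := by
    intro π
    constructor
    · intro h
      have h0 : π.parts.card ≠ 0 := by
        rw [Finset.card_ne_zero]
        exact Finpartition.parts_nonempty π hne
      obtain ⟨B, hB⟩ := Finset.card_eq_one.1 (by omega : π.parts.card = 1)
      refine Finpartition.ext ?_
      have h2 := π.sup_parts
      rw [hB, Finset.sup_singleton, id] at h2
      rw [hB, h2]
      rfl
    · rintro rfl
      simp [Finpartition.indiscrete]
  have h2 := truncated.eq_def W I
  rw [eq_sub_iff_add_eq] at h2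
  rw [← h2, partitionSum, ← Finset.sum_filter_add_sum_filter_not Finset.univ
    (fun π : Finpartition I => π.parts.card < 2)]
  congr 1
  · rw [Finset.filter_congr fun π _ => h1 π, Finset.filter_eq', if_pos (Finset.mem_univ _),
      Finset.sum_singleton]
    simp [Finpartition.indiscrete]
  · simp only [not_lt]
    rw [← Finset.sum_subtype_eq_sum_filter, Finset.subtype_univ]
    refine Finset.sum_congr rfl fun π _ => ?_
    exact Finset.prod_coe_sort π.1.parts (truncated W)

/-- The truncated functions are determined by the expansion of `W` with respect to the block of one
element. -/
theorem truncated_eq_of_expansion {W : Finset ι → ℂ} {C : ι → Finset ι → ℂ} (h0 : W ∅ = 1)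
    (hW : ∀ a P, a ∉ P → W (insert a P) = ∑ R ∈ P.powerset, C a R * W (P \ R)) {a : ι}
    {P : Finset ι} (ha : a ∉ P) : truncated W (insert a P) = C a P := by
  have hall : ∀ I, W I = partitionSum (truncated W) I := by
    intro I
    rcases I.eq_empty_or_nonempty with rfl | hI
    · rw [h0, partitionSum_empty]
    · exact eq_partitionSum_truncated W hI
  induction hn : P.card using Nat.strong_induction_on generalizing P with
  | _ n ih =>
  have h1 := hW a P ha
  rw [hall, partitionSum_insert _ ha] at h1
  have h2 : ∀ R ∈ P.powerset.erase P, truncated W (insert a R) * partitionSum (truncated W) (P \ R)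
      = C a R * W (P \ R) := by
    intro R hR
    obtain ⟨hne, hR⟩ := Finset.mem_erase.1 hR
    rw [Finset.mem_powerset] at hR
    rw [← hall, ih _ (hn ▸ Finset.card_lt_card (hR.ssubset_of_ne hne)) (fun h => ha (hR h)) rfl]
  rw [← Finset.add_sum_erase _ _ (Finset.mem_powerset_self P),
    ← Finset.add_sum_erase _ _ (Finset.mem_powerset_self P), Finset.sum_congr rfl h2] at h1
  simpa [← hall, h0] using add_right_cancel h1

/-- The truncated functions of a limit of moments `W M`, when the coefficients of their expansions
with respect to the block of one element converge. -/
theorem truncated_limUnder {W : ℕ → Finset ι → ℂ} {C : ℕ → ι → Finset ι → ℂ}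
    {C' : ι → Finset ι → ℂ} (h0 : ∀ M, W M ∅ = 1)
    (hW : ∀ M a P, a ∉ P → W M (insert a P) = ∑ R ∈ P.powerset, C M a R * W M (P \ R))
    (hC : ∀ a R, a ∉ R → Tendsto (fun M => C M a R) atTop (𝓝 (C' a R))) {a : ι} {P : Finset ι}
    (ha : a ∉ P) : truncated (fun I => limUnder atTop fun M => W M I) (insert a P) = C' a P := by
  have hlim : ∀ I, ∃ x, Tendsto (fun M => W M I) atTop (𝓝 x) := by
    intro I
    induction hn : I.card using Nat.strong_induction_on generalizing I with
    | _ n ih =>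
    rcases I.eq_empty_or_nonempty with rfl | ⟨b, hb⟩
    · exact ⟨1, by simpa only [h0] using tendsto_const_nhds⟩
    · choose! x hx using ih
      have hb' : b ∉ I.erase b := Finset.notMem_erase b I
      refine ⟨∑ R ∈ (I.erase b).powerset, C' b R * x (I.erase b \ R).card (I.erase b \ R), ?_⟩
      rw [← Finset.insert_erase hb]
      simp only [hW _ b _ hb']
      rw [Finset.insert_erase hb]
      refine tendsto_finsetSum _ fun R hR => (hC b R fun h => hb' ?_).mul ?_
      · exact Finset.mem_powerset.1 hR h
      · refine hx _ (hn ▸ Finset.card_lt_card ?_) _ rfl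
        exact Finset.ssubset_of_subset_of_ssubset Finset.sdiff_subset (Finset.erase_ssubset hb)
  have hlim' : ∀ I, Tendsto (fun M => W M I) atTop (𝓝 (limUnder atTop fun M => W M I)) :=
    fun I => tendsto_nhds_limUnder (hlim I)
  refine truncated_eq_of_expansion ?_ (fun b Q hb => ?_) ha
  · refine tendsto_nhds_unique (hlim' ∅) ?_
    simpa only [h0] using tendsto_const_nhds
  · refine tendsto_nhds_unique (hlim' (insert b Q)) ?_
    simp only [hW _ b Q hb]
    exact tendsto_finsetSum _ fun R hR =>
      (hC b R fun h => hb (Finset.mem_powerset.1 hR h)).mul (hlim' _)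

end Truncated

section Correlation

variable {H : Type*} [NormedAddCommGroup H] [InnerProductSpace ℂ H]

theorem creation_smul (c : ℂ) (f : H) : creation (c • f) = c • creation f := by
  rw [creation, creation, fieldOp, fieldOp, ← map_smul]
  exact RingQuot.mkAlgHom_rel ℂ (CCRRel.cre_smul c f)

variable {ι : Type*} [LinearOrder ι] [Fintype ι]

/-- The moments of products of second quantized finite rank operators are sums over permutations of
the labels. -/
theorem gaussianState_prod_numberOp (nhat : H →L[ℂ] H) (f g : ι → ℕ → H) (M : ℕ)
    (I : Finset ι) :
    gaussianState nhat (((I.sort (· ≤ ·)).map fun l =>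
      ∑ k ∈ Finset.range M, creation (f l k) * annihilation (g l k)).prod) =
      matchingMoment (contraction nhat) f g M I := by
  rw [list_prod_sum_eq_sum_boxOn M _ (Finset.sort_nodup I _) 0, map_sum, Finset.sort_toFinset,
    matchingMoment]
  refine Finset.sum_congr rfl fun k _ => ?_
  set F : ι → H := fun l => f l (k l)
  set G : ι → H := fun l => g l (k l)
  have hsort : ∀ L : List ι, (L.map fun l => creation (F l) * annihilation (G l)).prod
      = (((L.flatMap fun l => [(l, false), (l, true)]).map (letterSymbol F G)).map fieldOp).prod := by
    intro L
    induction L with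
    | nil => simp
    | cons l L ih =>
      rw [List.map_cons, List.prod_cons, ih, List.flatMap_cons]
      simp [letterSymbol, creation, annihilation, mul_assoc]
  rw [hsort, isGaussian_gaussianState nhat, wickSum_sorted]
  · congr 1 <;> ext i <;> simp
  · have hs : (I.sort (· ≤ ·)).Pairwise (· < ·) := (Finset.sortedLT_sort I).pairwise
    generalize I.sort (· ≤ ·) = L at hs
    induction L with
    | nil => simp
    | cons l L ih =>
      obtain ⟨h1, h2⟩ := List.pairwise_cons.1 hs
      rw [List.flatMap_cons, List.pairwise_append]
      refine ⟨?_, ih h2, ?_⟩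
      · simp [Prod.Lex.toLex_lt_toLex]
      · rintro ⟨x, b⟩ hx ⟨y, b'⟩ hy
        have hxl : x = l := by
          simp only [List.mem_cons, List.not_mem_nil, Prod.mk.injEq, or_false] at hx
          tauto
        obtain ⟨z, hz, hy⟩ := List.mem_flatMap.1 hy
        have hyz : y = z := by
          simp only [List.mem_cons, List.not_mem_nil, Prod.mk.injEq, or_false] at hy
          tauto
        rw [Prod.Lex.toLex_lt_toLex]
        left
        simpa [hxl, hyz] using h1 z hz

end Correlation

/-! ### Sums over cycles and limits of finite rank truncations -/

section Sequences

variable {ι : Type*} [DecidableEq ι] [Fintype ι]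

/-- The sequences of `m` distinct members of `R`. -/
def distinctSeq (m : ℕ) (R : Finset ι) : Finset (Fin m → ι) :=
  Finset.univ.filter fun u => Function.Injective u ∧ ∀ i, u i ∈ R

theorem mem_distinctSeq {m : ℕ} {R : Finset ι} {u : Fin m → ι} :
    u ∈ distinctSeq m R ↔ Function.Injective u ∧ ∀ i, u i ∈ R := by
  simp [distinctSeq]

theorem sum_distinctSeq_succ {A : Type*} [AddCommMonoid A] (m : ℕ) (R : Finset ι)
    (F : (Fin (m + 1) → ι) → A) : ∑ u ∈ distinctSeq (m + 1) R, F u =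
      ∑ d ∈ R, ∑ u ∈ distinctSeq m (R.erase d), F (Fin.cons d u) := by
  rw [Finset.sum_sigma']
  symm
  refine Finset.sum_bij' (fun x _ => Fin.cons x.1 x.2) (fun u _ => ⟨u 0, Fin.tail u⟩)
    ?_ ?_ ?_ ?_ ?_
  · rintro ⟨d, u⟩ h
    rw [Finset.mem_sigma, mem_distinctSeq] at h
    rw [mem_distinctSeq, Fin.cons_injective_iff]
    refine ⟨⟨?_, h.2.1⟩, fun i => ?_⟩
    · rintro ⟨i, hi⟩
      exact Finset.ne_of_mem_erase (h.2.2 i) hi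
    · refine Fin.cases ?_ (fun j => ?_) i
      · exact h.1
      · exact Finset.mem_of_mem_erase (h.2.2 j)
  · intro u h
    rw [mem_distinctSeq] at h
    rw [Finset.mem_sigma, mem_distinctSeq]
    refine ⟨h.2 0, h.1.comp (Fin.succ_injective _), fun i => Finset.mem_erase.2 ⟨?_, h.2 _⟩⟩
    exact fun he => Fin.succ_ne_zero i (h.1 he)
  · rintro ⟨d, u⟩ _
    simp
  · intro u _
    exact Fin.cons_self_tail u
  · exact fun _ _ => rfl

variable {H : Type*} [NormedAddCommGroup H] [InnerProductSpace ℂ H]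

/-- The matrix elements of `pathOp` for finite rank operators, written out as sums over the indices
and over the enumerations of `R`. -/
theorem inner_pathOp_eq_sum (X : ι → ι → H →L[ℂ] H) (f g : ι → ℕ → H) (M : ℕ) (a : ι) (m : ℕ)
    (c : ι) {R : Finset ι} (hR : R.card = m) (ha : a ∉ R) (hc : c ∉ R) (k₀ : ι → ℕ) :
    inner ℂ (g c (k₀ c)) (pathOp X (fun l => partialOp (f l) (g l) M) a c R (f a (k₀ a))) =
      ∑ k ∈ boxOn M R k₀, ∑ u ∈ distinctSeq m R, ∏ i : Fin (m + 1),
        inner ℂ (g ((Fin.cons c u : Fin (m + 1) → ι) i) (k ((Fin.cons c u : Fin (m + 1) → ι) i)))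
          (X ((Fin.cons c u : Fin (m + 1) → ι) i) ((Fin.snoc u a : Fin (m + 1) → ι) i)
          (f ((Fin.snoc u a : Fin (m + 1) → ι) i) (k ((Fin.snoc u a : Fin (m + 1) → ι) i)))) := by
  set T : ι → H →L[ℂ] H := fun l => partialOp (f l) (g l) M with hT
  induction m generalizing c R k₀ with
  | zero =>
    rw [Finset.card_eq_zero] at hR
    subst hR
    have h0 : distinctSeq 0 (∅ : Finset ι) = Finset.univ := by
      ext u
      simpa [mem_distinctSeq, Function.injective_of_subsingleton] using Subsingleton.elim _ _
    simp [h0, Fin.snoc]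
  | succ m ih =>
    have hne : R.Nonempty := Finset.card_pos.1 (by omega)
    rw [pathOp_eq_sum X T a c hne, sum_apply, inner_sum]
    simp only [sum_distinctSeq_succ]
    rw [Finset.sum_comm]
    refine Finset.sum_congr rfl fun d hd => ?_
    have had : a ≠ d := fun h => ha (h ▸ hd)
    have hcd : c ≠ d := fun h => hc (h ▸ hd)
    have hbox : boxOn M R k₀ = boxOn M (insert d (R.erase d)) k₀ := by rw [Finset.insert_erase hd]
    rw [hbox, sum_boxOn_insert M (Finset.notMem_erase d R), mul_apply_eq_comp, mul_apply_eq_comp,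
      hT]
    simp only
    rw [partialOp_apply, map_sum, inner_sum]
    refine Finset.sum_congr rfl fun j _ => ?_
    have hih := ih d (R := R.erase d) (by rw [Finset.card_erase_of_mem hd, hR]; rfl)
      (fun h => ha (Finset.mem_of_mem_erase h)) (Finset.notMem_erase d R) (Function.update k₀ d j)
    rw [Function.update_self, Function.update_of_ne had] at hih
    rw [map_smul, inner_smul_right, hih, Finset.sum_mul]
    refine Finset.sum_congr rfl fun k hk => ?_
    have hkd : k d = j := by simpa using (mem_boxOn.1 hk).2 d (Finset.notMem_erase d R)
    have hkc : k c = k₀ c := by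
      rw [(mem_boxOn.1 hk).2 c (fun h => hc (Finset.mem_of_mem_erase h)),
        Function.update_of_ne hcd]
    rw [Finset.sum_mul]
    refine Finset.sum_congr rfl fun u _ => ?_
    rw [Fin.prod_univ_succ (n := m + 1), ← Fin.cons_snoc_eq_snoc_cons]
    simp only [Fin.cons_zero, Fin.cons_succ]
    rw [hkc, hkd, mul_comm]

end Sequences

section Nuclear

variable {H : Type*} [NormedAddCommGroup H] [InnerProductSpace ℂ H]

theorem IsNuclearExpansion.summable_norm_mul {T : H →L[ℂ] H} {f g : ℕ → H}
    (h : IsNuclearExpansion T f g) : Summable fun k => ‖f k‖ * ‖g k‖ := by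
  refine Summable.of_nonneg_of_le (fun k => by positivity) (fun k => ?_)
    (h.summable_left.add h.summable_right)
  nlinarith [sq_nonneg (‖f k‖ - ‖g k‖), sq_nonneg (‖f k‖), sq_nonneg (‖g k‖)]

theorem IsNuclearExpansion.tendsto_sum_inner {T : H →L[ℂ] H} {f g : ℕ → H}
    (h : IsNuclearExpansion T f g) {Y : ℕ → H →L[ℂ] H} {Y' : H →L[ℂ] H}
    (hY : Tendsto Y atTop (𝓝 Y')) :
    Tendsto (fun M => ∑ k ∈ Finset.range M, inner ℂ (g k) (Y M (f k))) atTop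
      (𝓝 (∑' k, inner ℂ (g k) (Y' (f k)))) := by
  have hs : ∀ Z : H →L[ℂ] H, ∀ k, ‖(inner ℂ (g k) (Z (f k)) : ℂ)‖ ≤ ‖Z‖ * (‖f k‖ * ‖g k‖) := by
    intro Z k
    calc ‖(inner ℂ (g k) (Z (f k)) : ℂ)‖ ≤ ‖g k‖ * ‖Z (f k)‖ := norm_inner_le_norm _ _
      _ ≤ ‖g k‖ * (‖Z‖ * ‖f k‖) := by gcongr; exact Z.le_opNorm _
      _ = _ := by ring
  have h1 : Tendsto (fun M => ∑ k ∈ Finset.range M, (inner ℂ (g k) (Y' (f k)) : ℂ)) atTop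
      (𝓝 (∑' k, inner ℂ (g k) (Y' (f k)))) :=
    (Summable.of_norm_bounded (h.summable_norm_mul.mul_left ‖Y'‖) (hs Y')).hasSum.tendsto_sum_nat
  have h2 : Tendsto (fun M => ∑ k ∈ Finset.range M, (inner ℂ (g k) ((Y M - Y') (f k)) : ℂ)) atTop
      (𝓝 0) := by
    have h3 : Tendsto (fun M => ‖Y M - Y'‖ * ∑' k, ‖f k‖ * ‖g k‖) atTop (𝓝 0) := by
      simpa using (tendsto_iff_norm_sub_tendsto_zero.1 hY).mul_const (∑' k, ‖f k‖ * ‖g k‖)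
    refine squeeze_zero_norm (fun M => ?_) h3
    refine (norm_sum_le_of_le _ fun k _ => hs _ k).trans ?_
    rw [← Finset.mul_sum]
    gcongr
    exact h.summable_norm_mul.sum_le_tsum _ fun k _ => by positivity
  refine (h1.add h2).congr' (Eventually.of_forall fun M => ?_) |>.trans (by rw [add_zero])
  rw [← Finset.sum_add_distrib]
  refine Finset.sum_congr rfl fun k _ => ?_
  rw [← inner_add_right, sub_apply, add_sub_cancel]

variable [CompleteSpace H]

/-- A nuclear expansion converges in the operator norm. -/
theorem IsNuclearExpansion.tendsto_partialOp {T : H →L[ℂ] H} {f g : ℕ → H}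
    (h : IsNuclearExpansion T f g) : Tendsto (partialOp f g) atTop (𝓝 T) := by
  have hs : Summable fun k => InnerProductSpace.rankOne ℂ (f k) (g k) :=
    Summable.of_norm (by simpa using h.summable_norm_mul)
  have h1 : ∑' k, InnerProductSpace.rankOne ℂ (f k) (g k) = T := by
    ext x
    have h2 := hs.hasSum.mapL (ContinuousLinearMap.apply ℂ H x)
    refine h2.unique ?_
    simpa using h.hasSum x
  rw [← h1]
  exact hs.hasSum.tendsto_sum_nat

/-- The trace of `Y * T`, computed from a nuclear expansion of `T`, does not depend on the
expansion. -/
theorem IsNuclearExpansion.tsum_inner_eq {T : H →L[ℂ] H} {f g f' g' : ℕ → H}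
    (h : IsNuclearExpansion T f g) (h' : IsNuclearExpansion T f' g') (Y : H →L[ℂ] H) :
    ∑' k, inner ℂ (g k) (Y (f k)) = ∑' k, inner ℂ (g' k) (Y (f' k)) := by
  obtain ⟨w, b, -⟩ := exists_hilbertBasis ℂ H
  -- In the basis `b`, the trace is the sum over `i` of `⟨b i, Y T b i⟩`.
  have key : ∀ {f g : ℕ → H}, IsNuclearExpansion T f g →
      ∑' k, inner ℂ (g k) (Y (f k)) = ∑' i, inner ℂ (b i) (Y (T (b i))) := by
    intro f g h
    have hsq : ∀ {x : ℕ → H}, (Summable fun k => ‖x k‖ ^ 2) →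
        Summable fun p : ℕ × w => ‖(inner ℂ (b p.2) (x p.1) : ℂ)‖ ^ 2 := by
      intro x hx
      rw [summable_prod_of_nonneg (fun p => by positivity)]
      refine ⟨fun k => b.orthonormal.inner_products_summable (x k), ?_⟩
      exact Summable.of_nonneg_of_le (fun k => tsum_nonneg fun i => by positivity)
        (fun k => b.orthonormal.tsum_inner_products_le (x k)) hx
    have hY : Summable fun k => ‖Y (f k)‖ ^ 2 := by
      refine Summable.of_nonneg_of_le (fun k => by positivity) (fun k => ?_)
        (h.summable_left.mul_left (‖Y‖ ^ 2))
      rw [← mul_pow]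
      exact pow_le_pow_left₀ (norm_nonneg _) (Y.le_opNorm _) 2
    have hsum : Summable fun p : ℕ × w =>
        (inner ℂ (g p.1) (b p.2) * inner ℂ (b p.2) (Y (f p.1)) : ℂ) := by
      refine Summable.of_norm_bounded ((hsq h.summable_right).add (hsq hY)) fun p => ?_
      rw [norm_mul, ← inner_conj_symm, RCLike.norm_conj]
      nlinarith [sq_nonneg (‖(inner ℂ (b p.2) (g p.1) : ℂ)‖ - ‖(inner ℂ (b p.2) (Y (f p.1)) : ℂ)‖),
        sq_nonneg ‖(inner ℂ (b p.2) (g p.1) : ℂ)‖, sq_nonneg ‖(inner ℂ (b p.2) (Y (f p.1)) : ℂ)‖]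
    calc ∑' k, inner ℂ (g k) (Y (f k))
        = ∑' k, ∑' i, (inner ℂ (g k) (b i) * inner ℂ (b i) (Y (f k)) : ℂ) :=
          tsum_congr fun k => (b.tsum_inner_mul_inner _ _).symm
      _ = ∑' i, ∑' k, (inner ℂ (g k) (b i) * inner ℂ (b i) (Y (f k)) : ℂ) :=
          (Summable.tsum_comm hsum).symm
      _ = _ := tsum_congr fun i => by
          have h2 := ((h.hasSum (b i)).mapL Y).mapL (innerSL ℂ (b i))
          refine HasSum.tsum_eq ?_
          simpa [inner_smul_right] using h2
  rw [key h, key h']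

theorem tendsto_pathOp {ι : Type*} [DecidableEq ι] (X : ι → ι → H →L[ℂ] H)
    {T : ι → H →L[ℂ] H} {f g : ι → ℕ → H} (hT : ∀ l, IsNuclearExpansion (T l) (f l) (g l)) (a c : ι)
    (R : Finset ι) :
    Tendsto (fun M => pathOp X (fun l => partialOp (f l) (g l) M) a c R) atTop
      (𝓝 (pathOp X T a c R)) := by
  have h : ∀ (m : ℕ) (c : ι) (R : Finset ι),
      Tendsto (fun M => pathOpAux X (fun l => partialOp (f l) (g l) M) a m c R) atTop
        (𝓝 (pathOpAux X T a m c R)) := by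
    intro m
    induction m with
    | zero => exact fun c R => tendsto_const_nhds
    | succ m ih =>
      exact fun c R => tendsto_finsetSum _ fun d _ =>
        (tendsto_const_nhds.mul (hT d).tendsto_partialOp).mul (ih d _)
  exact h _ _ _

end Nuclear

/-! ### Truncated correlation functions as sums over cycles -/

section

variable {H : Type*} [NormedAddCommGroup H] [InnerProductSpace ℂ H]

theorem IsNuclearExpansion.smul {T : H →L[ℂ] H} {f g : ℕ → H} (h : IsNuclearExpansion T f g)
    (c : ℂ) : IsNuclearExpansion (c • T) (fun k => c • f k) g where
  summable_left := by
    simpa only [norm_smul, mul_pow] using h.summable_left.mul_left (‖c‖ ^ 2)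
  summable_right := h.summable_right
  hasSum x := by
    change HasSum _ (c • T x)
    simpa only [smul_comm c] using (h.hasSum x).const_smul c

variable [CompleteSpace H]

theorem IsNuclearExpansion.conj {S : ℝ → H →L[ℂ] H} (hS : IsUnitaryGroup S) {T : H →L[ℂ] H}
    {f g : ℕ → H} (h : IsNuclearExpansion T f g) (s : ℝ) :
    IsNuclearExpansion (S s * T * S (-s)) (fun k => S s (f k)) (fun k => S s (g k)) where
  summable_left := by simpa only [hS.norm_apply] using h.summable_left
  summable_right := by simpa only [hS.norm_apply] using h.summable_right
  hasSum x := by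
    have h1 := (h.hasSum (S (-s) x)).mapL (S s)
    have h2 : ∀ k, inner ℂ (g k) (S (-s) x) = inner ℂ (S s (g k)) x := fun k => by
      have h3 := hS.inner_apply 0 (-s) (g k) x
      have h4 := hS.inner_apply s 0 (g k) x
      rw [hS.map_zero] at h3 h4
      simpa using h3.trans (by rw [show -s - 0 = 0 - s by ring]) |>.trans h4.symm
    simpa [h2] using h1

/-- The truncated correlation function as a limit of sums over cycles `0 → u 0 → u 1 → ⋯ → 0` of the
labels, for any nuclear expansions of the operators.  Its definition uses chosen nuclear expansions
of the evolved operators, which are replaced by `(S_{t/ε} f, S_{t/ε} g)`. -/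
theorem tendsto_truncatedCorrelation {S : ℝ → H →L[ℂ] H} (hS : IsUnitaryGroup S)
    (nhat : H →L[ℂ] H) {m : ℕ} {T : Fin (m + 1) → H →L[ℂ] H} (ω : Fin (m + 1) → ℝ)
    {f g : Fin (m + 1) → ℕ → H} (hT : ∀ l, IsNuclearExpansion (T l) (f l) (g l)) (ε : ℝ)
    (t : Fin (m + 1) → ℝ) :
    Tendsto (fun M => ∑ u ∈ distinctSeq m (Finset.univ.erase (0 : Fin (m + 1))),
      ∑ k ∈ box (m + 1) M, ∏ i : Fin (m + 1),
        inner ℂ (S (t ((Fin.cons 0 u : Fin (m + 1) → Fin (m + 1)) i) / ε)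
            (g ((Fin.cons 0 u : Fin (m + 1) → Fin (m + 1)) i)
              (k ((Fin.cons 0 u : Fin (m + 1) → Fin (m + 1)) i))))
          (contraction ((ε : ℂ) • nhat) ((Fin.cons 0 u : Fin (m + 1) → Fin (m + 1)) i)
            ((Fin.cons 0 u : Fin (m + 1) → Fin (m + 1)) (i + 1))
            ((Complex.exp (-(Complex.I * t ((Fin.cons 0 u : Fin (m + 1) → Fin (m + 1)) (i + 1)) *
              ω ((Fin.cons 0 u : Fin (m + 1) → Fin (m + 1)) (i + 1)) / ε)) / ε) •
              S (t ((Fin.cons 0 u : Fin (m + 1) → Fin (m + 1)) (i + 1)) / ε)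
                (f ((Fin.cons 0 u : Fin (m + 1) → Fin (m + 1)) (i + 1))
                  (k ((Fin.cons 0 u : Fin (m + 1) → Fin (m + 1)) (i + 1)))))))
      atTop (𝓝 (truncatedCorrelation S nhat T ω ε t)) := by
  set c : Fin (m + 1) → ℂ := fun l => Complex.exp (-(Complex.I * t l * ω l / ε)) / ε with hc
  set X := contraction (ι := Fin (m + 1)) ((ε : ℂ) • nhat) with hX
  set T' : Fin (m + 1) → H →L[ℂ] H := fun l => c l • (S (t l / ε) * T l * S (-t l / ε)) with hT'
  set P : Finset (Fin (m + 1)) := Finset.univ.erase 0 with hP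
  have h0P : (0 : Fin (m + 1)) ∉ P := Finset.notMem_erase _ _
  have hins : insert 0 P = Finset.univ := Finset.insert_erase (Finset.mem_univ _)
  have hconj : ∀ l, IsNuclearExpansion (S (t l / ε) * T l * S (-t l / ε))
      (fun k => S (t l / ε) (f l k)) (fun k => S (t l / ε) (g l k)) := fun l => by
    rw [neg_div]
    exact (hT l).conj hS _
  set f' : Fin (m + 1) → ℕ → H := fun l k => c l • S (t l / ε) (f l k)
  set g' : Fin (m + 1) → ℕ → H := fun l k => S (t l / ε) (g l k)
  have hE : ∀ l, IsNuclearExpansion (T' l) (f' l) (g' l) := fun l => (hconj l).smul (c l)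
  -- The expansions on which the definition of the correlation functions is built.
  set p : Fin (m + 1) → (ℕ → H) × (ℕ → H) :=
    fun l => nuclearExpansion (S (t l / ε) * T l * S (-t l / ε)) with hp
  have hp' : ∀ l, IsNuclearExpansion (S (t l / ε) * T l * S (-t l / ε)) (p l).1 (p l).2 := by
    intro l
    have hex : ∃ q : (ℕ → H) × (ℕ → H),
        IsNuclearExpansion (S (t l / ε) * T l * S (-t l / ε)) q.1 q.2 := ⟨(_, _), hconj l⟩
    rw [hp]
    simp only [nuclearExpansion, dif_pos hex]
    exact hex.choose_spec
  set f₀ : Fin (m + 1) → ℕ → H := fun l k => c l • (p l).1 k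
  set g₀ : Fin (m + 1) → ℕ → H := fun l => (p l).2
  have hE₀ : ∀ l, IsNuclearExpansion (T' l) (f₀ l) (g₀ l) := fun l => (hp' l).smul (c l)
  have hcorr : correlation S nhat T ω ε t
      = fun I => limUnder atTop fun M => matchingMoment X f₀ g₀ M I := by
    funext I
    rw [correlation]
    congr 1
    funext M
    rw [hX, ← gaussianState_prod_numberOp]
    congr 2
    refine List.map_congr_left fun l _ => ?_
    rw [rescaledNumberOp, numberOp, Finset.smul_sum]
    refine Finset.sum_congr rfl fun k _ => ?_
    rw [creation_smul, smul_mul_assoc]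
  have htr : truncatedCorrelation S nhat T ω ε t
      = ∑' j, inner ℂ (g₀ 0 j) (pathOp X T' 0 0 P (f₀ 0 j)) := by
    rw [truncatedCorrelation, hcorr, ← hins]
    exact truncated_limUnder (W := fun M I => matchingMoment X f₀ g₀ M I)
      (C' := fun a R => ∑' j, inner ℂ (g₀ a j) (pathOp X T' a a R (f₀ a j)))
      (fun M => by simp [matchingMoment])
      (fun M a P ha => matchingMoment_insert X f₀ g₀ M ha)
      (fun a R _ => (hE₀ a).tendsto_sum_inner (tendsto_pathOp X hE₀ a a R)) h0P
  rw [htr, (hE₀ 0).tsum_inner_eq (hE 0)]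
  refine ((hE 0).tendsto_sum_inner (tendsto_pathOp X hE 0 0 P)).congr fun M => ?_
  have hcard : P.card = m := by
    rw [hP, Finset.card_erase_of_mem (Finset.mem_univ _), Finset.card_univ, Fintype.card_fin,
      Nat.add_sub_cancel]
  have h1 := fun j : ℕ =>
    inner_pathOp_eq_sum X f' g' M 0 m 0 hcard h0P h0P (Function.update 0 0 j)
  simp only [Function.update_self] at h1
  rw [Finset.sum_congr rfl fun j _ => h1 j,
    ← sum_boxOn_insert M h0P 0, hins, Finset.sum_comm]
  refine Finset.sum_congr rfl fun u _ => ?_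
  have hbox : boxOn M (Finset.univ : Finset (Fin (m + 1))) 0 = box (m + 1) M := by
    ext k
    simp [mem_boxOn, mem_box]
  have hsnoc : ∀ i, (Fin.snoc u 0 : Fin (m + 1) → Fin (m + 1)) i
      = (Fin.cons 0 u : Fin (m + 1) → Fin (m + 1)) (i + 1) := by
    intro i
    refine Fin.lastCases ?_ (fun j => ?_) i
    · rw [Fin.last_add_one]; simp
    · rw [Fin.coeSucc_eq_succ]; simp
  rw [hbox]
  simp only [hsnoc]
  rfl

end

/-! ### Expansion in the powers of the density -/

section

open scoped ENNReal

variable {H : Type*} [NormedAddCommGroup H] [InnerProductSpace ℂ H]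

theorem summable_norm_sq_apply (K : H →L[ℂ] H) {f : ℕ → H} (hf : Summable fun k => ‖f k‖ ^ 2) :
    Summable fun k => ‖K (f k)‖ ^ 2 := by
  refine Summable.of_nonneg_of_le (fun k => by positivity) (fun k => ?_) (hf.mul_left (‖K‖ ^ 2))
  rw [← mul_pow]
  exact pow_le_pow_left₀ (norm_nonneg _) (K.le_opNorm _) 2

/-- The vectors `f l k`, with the operator `K` applied at the positions outside of `s`. -/
def dressed (K : H →L[ℂ] H) {n : ℕ} (s : Finset (Fin n)) (f : Fin n → ℕ → H) (l : Fin n) (k : ℕ) :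
    H := if l ∈ s then f l k else K (f l k)

/-- A cyclic product of contractions, expanded in the set `s` of the positions at which the summand
`1` of `1 + ε nhat` is taken. -/
theorem prod_inner_contraction {n : ℕ} [NeZero n] (nhat : H →L[ℂ] H) (ε : ℂ) (w : Fin n → Fin n)
    (F G : Fin n → H) (c : Fin n → ℂ) :
    ∏ l, inner ℂ (G (l - 1)) (contraction (ε • nhat) (w (l - 1)) (w l) (c l • F l)) =
      ∑ s : Finset (Fin n), (if ∀ l ∈ s, w (l - 1) < w l then 1 else 0) * ε ^ sᶜ.card * (∏ l, c l) *
        ∏ l, inner ℂ (G (l - 1)) (if l ∈ s then F l else nhat (F l)) := by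
  have h1 : ∀ l, inner ℂ (G (l - 1)) (contraction (ε • nhat) (w (l - 1)) (w l) (c l • F l)) =
      c l * ((if w (l - 1) < w l then 1 else 0) * inner ℂ (G (l - 1)) (F l) +
        ε * inner ℂ (G (l - 1)) (nhat (F l))) := by
    intro l
    rw [map_smul, inner_smul_right, contraction]
    split_ifs
    · simp only [add_apply, one_apply_eq_self, smul_apply, inner_add_right, inner_smul_right,
        one_mul]
    · simp [inner_smul_right]
  simp only [h1]
  rw [Finset.prod_mul_distrib, Finset.prod_add, Finset.mul_sum, Finset.powerset_univ]
  refine Finset.sum_congr rfl fun s _ => ?_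
  have h2 : ∏ l, inner ℂ (G (l - 1)) (if l ∈ s then F l else nhat (F l)) =
      (∏ l ∈ s, inner ℂ (G (l - 1)) (F l)) * ∏ l ∈ sᶜ, inner ℂ (G (l - 1)) (nhat (F l)) := by
    rw [← Finset.prod_mul_prod_compl s]
    congr 1
    · exact Finset.prod_congr rfl fun l hl => by rw [if_pos hl]
    · exact Finset.prod_congr rfl fun l hl => by rw [if_neg (Finset.mem_compl.1 hl)]
  rw [h2, Finset.prod_mul_distrib, Finset.prod_mul_distrib, Finset.prod_const,
    ← Finset.compl_eq_univ_sdiff, Finset.prod_ite_zero, Finset.prod_const_one]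
  ring_nf

/-- The enumerations of the labels that start at `0`, as permutations. -/
theorem sum_distinctSeq_eq_sum_perm {A : Type*} [AddCommMonoid A] {m : ℕ}
    (F : (Fin (m + 1) → Fin (m + 1)) → A) :
    ∑ u ∈ distinctSeq m (Finset.univ.erase (0 : Fin (m + 1))), F (Fin.cons 0 u) =
      ∑ w : Equiv.Perm (Fin (m + 1)), if w 0 = 0 then F w else 0 := by
  rw [← Finset.sum_filter]
  have hinj : ∀ u ∈ distinctSeq m (Finset.univ.erase (0 : Fin (m + 1))),
      Function.Injective (Fin.cons 0 u : Fin (m + 1) → Fin (m + 1)) := by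
    intro u hu
    rw [mem_distinctSeq] at hu
    rw [Fin.cons_injective_iff]
    exact ⟨fun ⟨i, hi⟩ => Finset.ne_of_mem_erase (hu.2 i) hi, hu.1⟩
  refine Finset.sum_bij' (fun u hu => Equiv.ofBijective _
    (Finite.injective_iff_bijective.1 (hinj u hu))) (fun w _ => Fin.tail w) ?_ ?_ ?_ ?_ ?_
  · intro u hu
    simp
  · intro w hw
    have h0 : w 0 = 0 := by simpa using hw
    rw [mem_distinctSeq]
    refine ⟨w.injective.comp (Fin.succ_injective _), fun i => Finset.mem_erase.2
      ⟨fun h => Fin.succ_ne_zero i (w.injective (h.trans h0.symm)), Finset.mem_univ _⟩⟩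
  · intro u hu
    exact Fin.tail_cons _ _
  · intro w hw
    have h0 : w 0 = 0 := by simpa using hw
    ext1 i
    change (Fin.cons 0 (Fin.tail w) : Fin (m + 1) → Fin (m + 1)) i = w i
    rw [← h0, Fin.cons_self_tail]
  · intro u hu
    rfl

variable [CompleteSpace H]

/-- Energy densities are preserved by operators that commute with the group. -/
theorem HasEnergyDensity.apply {S : ℝ → H →L[ℂ] H} (hS : IsUnitaryGroup S) {n : ℕ} {f : ℕ → H}
    (h : HasEnergyDensity S n f) {K : H →L[ℂ] H} (hK : ∀ t x, S t (K x) = K (S t x)) :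
    HasEnergyDensity S n fun k => K (f k) := by
  have hex : ∀ k, ∃ ρ, IsEnergyElement S (K (f k)) (K (f k)) ρ := by
    intro k
    obtain ⟨ρ, hρ⟩ := h.1 k
    obtain ⟨ρ', hρ'⟩ := exists_isEnergyElement hS hρ (ContinuousLinearMap.adjoint K (K (f k)))
    rw [isEnergyElement_iff hS] at hρ'
    refine ⟨ρ', (isEnergyElement_iff hS).2 ⟨hρ'.1, fun t => ?_⟩⟩
    rw [hK, ← ContinuousLinearMap.adjoint_inner_left, hρ'.2]
  refine ⟨hex, ?_⟩
  have hle : ∀ᵐ E : ℝ, ∀ k, ‖energyElement S E (K (f k)) (K (f k))‖ₑ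
      ≤ ENNReal.ofReal (‖K‖ ^ 2) * ‖energyElement S E (f k) (f k)‖ₑ := by
    refine ae_all_iff.2 fun k => ?_
    filter_upwards [(isEnergyElement_energyElement (h.1 k)).ae_norm_le_of_commute hS hK
      (isEnergyElement_energyElement (hex k))] with E hE
    rw [← ofReal_norm, ← ofReal_norm, ← ENNReal.ofReal_mul (by positivity)]
    exact ENNReal.ofReal_le_ofReal hE
  calc ∫⁻ E : ℝ, (∑' k, ‖energyElement S E (K (f k)) (K (f k))‖ₑ) ^ n
      ≤ ∫⁻ E : ℝ, ENNReal.ofReal (‖K‖ ^ 2) ^ n *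
          (∑' k, ‖energyElement S E (f k) (f k)‖ₑ) ^ n := by
        refine lintegral_mono_ae ?_
        filter_upwards [hle] with E hE
        rw [← mul_pow, ← ENNReal.tsum_mul_left]
        exact pow_le_pow_left' (ENNReal.tsum_le_tsum hE) n
    _ = ENNReal.ofReal (‖K‖ ^ 2) ^ n *
          ∫⁻ E : ℝ, (∑' k, ‖energyElement S E (f k) (f k)‖ₑ) ^ n :=
        lintegral_const_mul' _ _ (ENNReal.pow_ne_top ENNReal.ofReal_ne_top)
    _ < ⊤ := ENNReal.mul_lt_top (ENNReal.pow_lt_top ENNReal.ofReal_lt_top) h.2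

theorem hasSum_cyclicSum {S : ℝ → H →L[ℂ] H} (hS : IsUnitaryGroup S) {n : ℕ} [NeZero n]
    {f g : Fin n → ℕ → H} (hf2 : ∀ l, Summable fun k => ‖f l k‖ ^ 2)
    (hg2 : ∀ l, Summable fun k => ‖g l k‖ ^ 2)
    (hf : ∀ l, HasEnergyDensity S n (f l)) (hg : ∀ l, HasEnergyDensity S n (g l)) (s : Fin n → ℝ) :
    HasSum (fun k : Fin n → ℕ => ∏ l, inner ℂ (S (s (l - 1)) (g (l - 1) (k (l - 1))))
        (S (s l) (f l (k l)))) (cyclicSum S f g s) := by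
  obtain ⟨ρ, α, β, h, hρ⟩ := exists_isChainKernel hS hf2 hg2 hf hg
  exact (h.hasSum_prod_inner hS hρ s).summable.hasSum

/-- The limit of the cyclic sums, with the time variables permuted. -/
theorem cyclicSum_limit_perm {S : ℝ → H →L[ℂ] H} (hS : IsUnitaryGroup S) {n : ℕ} [NeZero n]
    {f g : Fin n → ℕ → H} (ω : Fin n → ℝ) (hf2 : ∀ l, Summable fun k => ‖f l k‖ ^ 2)
    (hg2 : ∀ l, Summable fun k => ‖g l k‖ ^ 2)
    (hf : ∀ l, HasEnergyDensity S n (f l)) (hg : ∀ l, HasEnergyDensity S n (g l))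
    (w : Equiv.Perm (Fin n)) (φ : SchwartzMap (Fin n → ℝ) ℂ) :
    (∀ ε : ℝ, Integrable fun t : Fin n → ℝ => cyclicSum S f g (fun l => t (w l) / ε) *
      (Complex.exp (-(Complex.I * (∑ l, t (w l) * ω l / ε : ℝ))) * φ t)) ∧
    Tendsto (fun ε : ℝ => ((ε : ℂ)⁻¹) ^ (n - 1) * ∫ t : Fin n → ℝ,
      cyclicSum S f g (fun l => t (w l) / ε) *
        (Complex.exp (-(Complex.I * (∑ l, t (w l) * ω l / ε : ℝ))) * φ t))
      (𝓝[>] 0) (𝓝 ((2 * (Real.pi : ℂ)) ^ (n - 1) * (∫ s : ℝ, φ fun _ => s) *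
        (if tailFreq ω 0 = 0 then 1 else 0) * ∫ E : ℝ, ∑' k : Fin n → ℕ,
        ∏ l, energyElement S (E + tailFreq ω l) (g (l - 1) (k (l - 1))) (f l (k l)))) := by
  set ψ : SchwartzMap (Fin n → ℝ) ℂ := SchwartzMap.compCLMOfContinuousLinearEquiv ℂ
    (ContinuousLinearEquiv.piCongrLeft ℝ (fun _ : Fin n => ℝ) w) φ with hψ
  have hψ' : ∀ t : Fin n → ℝ, ψ t = φ fun l => t (w.symm l) := fun t => by
    rw [hψ, SchwartzMap.compCLMOfContinuousLinearEquiv_apply, Function.comp_apply]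
    congr 1
    funext l
    obtain ⟨j, rfl⟩ := w.surjective l
    rw [Equiv.symm_apply_apply]
    exact Equiv.piCongrLeft_apply_apply (fun _ : Fin n => ℝ) w t j
  set e := MeasurableEquiv.piCongrLeft (fun _ : Fin n => ℝ) w.symm with he
  have he' : ∀ (t : Fin n → ℝ) l, e t l = t (w l) := fun t l => by
    obtain ⟨j, rfl⟩ := w.symm.surjective l
    rw [Equiv.apply_symm_apply]
    exact Equiv.piCongrLeft_apply_apply _ _ _ _
  have hmp : MeasurePreserving e volume volume :=
    volume_measurePreserving_piCongrLeft (fun _ : Fin n => ℝ) w.symm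
  obtain ⟨-, -, h⟩ := cyclicSum_limit hS ω hf2 hg2 hf hg
  obtain ⟨h1, h2⟩ := h ψ
  have hcomp : ∀ (ε : ℝ) (t : Fin n → ℝ), cyclicSum S f g (fun l => t (w l) / ε) *
      (Complex.exp (-(Complex.I * (∑ l, t (w l) * ω l / ε : ℝ))) * φ t) =
      cyclicSum S f g (fun l => e t l / ε) *
      (Complex.exp (-(Complex.I * (∑ l, e t l * ω l / ε : ℝ))) * ψ (e t)) := fun ε t => by
    simp only [he', hψ', Equiv.apply_symm_apply]
  simp only [hcomp]
  refine ⟨fun ε => (hmp.integrable_comp_emb e.measurableEmbedding).2 (h1 ε), ?_⟩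
  have h3 : ∀ ε : ℝ, ∫ t : Fin n → ℝ, cyclicSum S f g (fun l => e t l / ε) *
      (Complex.exp (-(Complex.I * (∑ l, e t l * ω l / ε : ℝ))) * ψ (e t)) = _ := fun ε =>
    hmp.integral_comp e.measurableEmbedding fun t => cyclicSum S f g (fun l => t l / ε) *
      (Complex.exp (-(Complex.I * (∑ l, t l * ω l / ε : ℝ))) * ψ t)
  simp only [h3]
  simpa only [hψ'] using h2

/-- The truncated correlation function as a finite sum of cyclic sums, over the cyclic orders `w` of
the labels and the sets `s` of ascents of `w` at which the factor `nhat` is absent. -/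
theorem truncatedCorrelation_eq_sum {S : ℝ → H →L[ℂ] H} (hS : IsUnitaryGroup S)
    {nhat : H →L[ℂ] H} (hcomm : ∀ t x, S t (nhat x) = nhat (S t x)) {m : ℕ}
    {T : Fin (m + 1) → H →L[ℂ] H} (ω : Fin (m + 1) → ℝ)
    {f g : Fin (m + 1) → ℕ → H} (hT : ∀ l, IsNuclearExpansion (T l) (f l) (g l))
    (hf : ∀ l, HasEnergyDensity S (m + 1) (f l)) (hg : ∀ l, HasEnergyDensity S (m + 1) (g l))
    (ε : ℝ) (t : Fin (m + 1) → ℝ) :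
    truncatedCorrelation S nhat T ω ε t =
      ∑ w : Equiv.Perm (Fin (m + 1)), ∑ s : Finset (Fin (m + 1)),
        (if w 0 = 0 ∧ ∀ l ∈ s, w (l - 1) < w l then 1 else 0) * (ε : ℂ) ^ sᶜ.card *
          (((ε : ℂ)⁻¹) ^ (m + 1) *
            Complex.exp (-(Complex.I * (∑ l, t (w l) * ω (w l) / ε : ℝ)))) *
          cyclicSum S (dressed nhat s fun l => f (w l)) (fun l => g (w l)) fun l => t (w l) / ε := by
  have hterm : ∀ (w : Equiv.Perm (Fin (m + 1))) (s : Finset (Fin (m + 1))), HasSum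
      (fun k : Fin (m + 1) → ℕ => ∏ l, inner ℂ (S (t (w (l - 1)) / ε) (g (w (l - 1)) (k (l - 1))))
        (S (t (w l) / ε) (dressed nhat s (fun l => f (w l)) l (k l))))
      (cyclicSum S (dressed nhat s fun l => f (w l)) (fun l => g (w l)) fun l => t (w l) / ε) := by
    intro w s
    refine hasSum_cyclicSum hS (fun l => ?_) (fun l => (hT _).summable_right) (fun l => ?_)
      (fun l => hg _) fun l => t (w l) / ε
    · by_cases hl : l ∈ s
      · simpa [dressed, hl] using (hT (w l)).summable_left
      · simpa [dressed, hl] using summable_norm_sq_apply nhat (hT (w l)).summable_left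
    · by_cases hl : l ∈ s
      · rw [show dressed nhat s (fun l => f (w l)) l = f (w l) from
          funext fun k => if_pos hl]
        exact hf (w l)
      · rw [show dressed nhat s (fun l => f (w l)) l = fun k => nhat (f (w l) k) from
          funext fun k => if_neg hl]
        exact (hf (w l)).apply hS hcomm
  refine tendsto_nhds_unique (tendsto_truncatedCorrelation hS nhat ω hT ε t) ?_
  set c : Fin (m + 1) → ℂ := fun l => Complex.exp (-(Complex.I * t l * ω l / ε)) / ε with hc
  have hprod : ∀ w : Equiv.Perm (Fin (m + 1)), ∏ l, c (w l) = ((ε : ℂ)⁻¹) ^ (m + 1) *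
      Complex.exp (-(Complex.I * (∑ l, t (w l) * ω (w l) / ε : ℝ))) := by
    intro w
    simp only [hc, div_eq_inv_mul]
    rw [Finset.prod_mul_distrib, Finset.prod_const, ← Complex.exp_sum, Finset.card_univ,
      Fintype.card_fin]
    congr 2
    push_cast
    rw [Finset.mul_sum, ← Finset.sum_neg_distrib]
    exact Finset.sum_congr rfl fun l _ => by ring
  refine (tendsto_congr fun M => sum_distinctSeq_eq_sum_perm (m := m)
    fun w : Fin (m + 1) → Fin (m + 1) => ∑ k ∈ box (m + 1) M, ∏ i : Fin (m + 1),
      inner ℂ (S (t (w i) / ε) (g (w i) (k (w i))))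
        (contraction ((ε : ℂ) • nhat) (w i) (w (i + 1))
          (c (w (i + 1)) • S (t (w (i + 1)) / ε) (f (w (i + 1)) (k (w (i + 1))))))).2 ?_
  refine tendsto_finsetSum _ fun w _ => ?_
  by_cases h0 : w 0 = 0
  swap
  · simp [h0]
  simp only [h0, if_true, true_and]
  have hbox : ∀ M : ℕ, ∑ k ∈ box (m + 1) M, ∏ i : Fin (m + 1),
      inner ℂ (S (t (w i) / ε) (g (w i) (k (w i))))
        (contraction ((ε : ℂ) • nhat) (w i) (w (i + 1))
          (c (w (i + 1)) • S (t (w (i + 1)) / ε) (f (w (i + 1)) (k (w (i + 1)))))) =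
      ∑ s : Finset (Fin (m + 1)), (if ∀ l ∈ s, w (l - 1) < w l then 1 else 0) *
        (ε : ℂ) ^ sᶜ.card * (∏ l, c (w l)) * ∑ k ∈ box (m + 1) M,
          ∏ l, inner ℂ (S (t (w (l - 1)) / ε) (g (w (l - 1)) (k (l - 1))))
            (S (t (w l) / ε) (dressed nhat s (fun l => f (w l)) l (k l))) := by
    intro M
    simp only [Finset.mul_sum]
    rw [Finset.sum_comm]
    refine Finset.sum_bij' (fun k _ => fun l => k (w l)) (fun k _ => fun l => k (w.symm l))
      (fun k hk => mem_box.2 fun l => mem_box.1 hk _)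
      (fun k hk => mem_box.2 fun l => mem_box.1 hk _) (fun k _ => by simp) (fun k _ => by simp) ?_
    intro k _
    rw [← (Equiv.subRight (1 : Fin (m + 1))).prod_comp]
    simp only [Equiv.subRight_apply, sub_add_cancel]
    rw [prod_inner_contraction nhat (ε : ℂ) w (fun l => S (t (w l) / ε) (f (w l) (k (w l))))
      (fun l => S (t (w l) / ε) (g (w l) (k (w l)))) fun l => c (w l)]
    refine Finset.sum_congr rfl fun s _ => ?_
    congr 1
    refine Finset.prod_congr rfl fun l _ => ?_
    rw [dressed]
    split_ifs
    · rfl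
    · rw [hcomm]
  simp only [hbox]
  refine tendsto_finsetSum _ fun s _ => ?_
  rw [← hprod]
  exact ((hterm w s).comp (tendsto_box (m + 1))).const_mul _

end

/-! ### The low density limit -/

/-- Only the increasing cyclic order has ascents at all positions but `0`. -/
theorem perm_eq_one_of_forall_sub_one_lt {m : ℕ} {w : Equiv.Perm (Fin (m + 1))}
    (h : ∀ l, l ≠ 0 → w (l - 1) < w l) : w = 1 := by
  have hmono : StrictMono w := Fin.strictMono_iff_lt_succ.2 fun i => by
    have h1 := h i.succ (Fin.succ_ne_zero i)
    rwa [← Fin.coeSucc_eq_succ, add_sub_cancel_right, Fin.coeSucc_eq_succ] at h1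
  have h2 : (w : Fin (m + 1) → Fin (m + 1)) = id :=
    (StrictMono.range_inj hmono strictMono_id).1 (by simp [w.surjective.range_eq])
  ext1 i
  exact congrFun h2 i

end LowDensity

end

theorem theorem1 {H : Type*} [NormedAddCommGroup H] [InnerProductSpace ℂ H] [CompleteSpace H]
    {S : ℝ → H →L[ℂ] H} (hS : LowDensity.IsUnitaryGroup S)
    {nhat : H →L[ℂ] H} (hpos : nhat.IsPositive) (hcomm : ∀ t : ℝ, S (-t) * nhat * S t = nhat)
    {n : ℕ} [NeZero n] (T : Fin n → H →L[ℂ] H) (ω : Fin n → ℝ) (f g : Fin n → ℕ → H)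
    (hT : ∀ l, LowDensity.IsNuclearExpansion (T l) (f l) (g l))
    (hf : ∀ l, LowDensity.HasEnergyDensity S n (f l))
    (hg : ∀ l, LowDensity.HasEnergyDensity S n (g l)) :
    (∀ᵐ E : ℝ, Summable (LowDensity.traceTerm S nhat ω f g E)) ∧
    Integrable (LowDensity.traceDensity S nhat ω f g) ∧
    ∀ φ : SchwartzMap (Fin n → ℝ) ℂ,
      (∀ ε : ℝ, 0 < ε →
        Integrable fun t : Fin n → ℝ =>
          LowDensity.truncatedCorrelation S nhat T ω ε t * φ t) ∧
      Tendsto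
        (fun ε : ℝ => ∫ t : Fin n → ℝ, LowDensity.truncatedCorrelation S nhat T ω ε t * φ t)
        (𝓝[>] 0)
        (𝓝 ((2 * (Real.pi : ℂ)) ^ (n - 1) * (∫ s : ℝ, φ fun _ => s) *
          (if LowDensity.tailFreq ω 0 = 0 then 1 else 0) *
          ∫ E : ℝ, LowDensity.traceDensity S nhat ω f g E)) := by

  obtain ⟨m, rfl⟩ := Nat.exists_eq_succ_of_ne_zero (NeZero.ne n)
  have hcomm' : ∀ t x, S t (nhat x) = nhat (S t x) := by
    intro t x
    have h1 : S t * (S (-t) * nhat * S t) = nhat * S t := by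
      rw [← mul_assoc, ← mul_assoc, ← hS.map_add, add_neg_cancel, hS.map_zero, one_mul]
    rw [hcomm] at h1
    exact congr($h1 x)
  have hf2 : ∀ l, Summable fun k => ‖f l k‖ ^ 2 := fun l => (hT l).summable_left
  have hg2 : ∀ l, Summable fun k => ‖g l k‖ ^ 2 := fun l => (hT l).summable_right
  have hd2 : ∀ (w : Equiv.Perm (Fin (m + 1))) (s : Finset (Fin (m + 1))) l,
      Summable fun k => ‖LowDensity.dressed nhat s (fun l => f (w l)) l k‖ ^ 2 := by
    intro w s l
    by_cases hl : l ∈ s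
    · simpa [LowDensity.dressed, hl] using hf2 (w l)
    · simpa [LowDensity.dressed, hl] using LowDensity.summable_norm_sq_apply nhat (hf2 (w l))
  have hd : ∀ (w : Equiv.Perm (Fin (m + 1))) (s : Finset (Fin (m + 1))) l,
      LowDensity.HasEnergyDensity S (m + 1)
        (LowDensity.dressed nhat s (fun l => f (w l)) l) := by
    intro w s l
    by_cases hl : l ∈ s
    · rw [show LowDensity.dressed nhat s (fun l => f (w l)) l = f (w l) from
        funext fun k => if_pos hl]
      exact hf (w l)
    · rw [show LowDensity.dressed nhat s (fun l => f (w l)) l = fun k => nhat (f (w l) k) from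
        funext fun k => if_neg hl]
      exact (hf (w l)).apply hS hcomm'
  have hone : ∀ E k, LowDensity.traceTerm S nhat ω f g E k =
      ∏ l, LowDensity.energyElement S (E + LowDensity.tailFreq ω l) (g (l - 1) (k (l - 1)))
        (LowDensity.dressed nhat (Finset.univ.erase 0)
          (fun l => f ((1 : Equiv.Perm (Fin (m + 1))) l)) l (k l)) := by
    intro E k
    refine Finset.prod_congr rfl fun l _ => ?_
    by_cases hl : l = 0 <;> simp [LowDensity.dressed, hl]
  obtain ⟨h1, h2, -⟩ := LowDensity.cyclicSum_limit hS ω (hd2 1 (Finset.univ.erase 0)) hg2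
    (hd 1 (Finset.univ.erase 0)) hg
  simp only [← hone] at h1 h2
  refine ⟨h1, h2, fun φ => ?_⟩
  have hlim := fun (w : Equiv.Perm (Fin (m + 1))) (s : Finset (Fin (m + 1))) =>
    LowDensity.cyclicSum_limit_perm hS (fun l => ω (w l)) (hd2 w s) (fun l => hg2 (w l)) (hd w s)
      (fun l => hg (w l)) w φ
  -- The contribution of a cycle `w` and of the set `s` of the positions without `nhat`.
  set Q : Equiv.Perm (Fin (m + 1)) → Finset (Fin (m + 1)) → ℝ → (Fin (m + 1) → ℝ) → ℂ :=
    fun w s ε t => LowDensity.cyclicSum S (LowDensity.dressed nhat s fun l => f (w l))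
      (fun l => g (w l)) (fun l => t (w l) / ε) *
      (Complex.exp (-(Complex.I * (∑ l, t (w l) * ω (w l) / ε : ℝ))) * φ t) with hQ
  have heq : ∀ (ε : ℝ) (t : Fin (m + 1) → ℝ),
      LowDensity.truncatedCorrelation S nhat T ω ε t * φ t =
      ∑ w : Equiv.Perm (Fin (m + 1)), ∑ s : Finset (Fin (m + 1)),
        ((if w 0 = 0 ∧ ∀ l ∈ s, w (l - 1) < w l then 1 else 0) * (ε : ℂ) ^ sᶜ.card *
          ((ε : ℂ)⁻¹) ^ (m + 1)) * Q w s ε t := by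
    intro ε t
    rw [LowDensity.truncatedCorrelation_eq_sum hS hcomm' ω hT hf hg, Finset.sum_mul]
    refine Finset.sum_congr rfl fun w _ => ?_
    rw [Finset.sum_mul]
    refine Finset.sum_congr rfl fun s _ => ?_
    rw [hQ]
    ring
  simp only [heq]
  have hint : ∀ (ε : ℝ) w s, Integrable fun t =>
      ((if w 0 = 0 ∧ ∀ l ∈ s, w (l - 1) < w l then 1 else 0) * (ε : ℂ) ^ sᶜ.card *
          ((ε : ℂ)⁻¹) ^ (m + 1)) * Q w s ε t :=
    fun ε w s => ((hlim w s).1 ε).const_mul _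
  refine ⟨fun ε _ => integrable_finsetSum _ fun w _ => integrable_finsetSum _ fun s _ =>
    hint ε w s, ?_⟩
  set L : ℂ := (2 * (Real.pi : ℂ)) ^ (m + 1 - 1) * (∫ s : ℝ, φ fun _ => s) *
    (if LowDensity.tailFreq ω 0 = 0 then 1 else 0) *
    ∫ E : ℝ, LowDensity.traceDensity S nhat ω f g E with hL
  have hLsum : L = ∑ w : Equiv.Perm (Fin (m + 1)), ∑ s : Finset (Fin (m + 1)),
      if w = 1 ∧ s = Finset.univ.erase 0 then L else 0 := by
    simp only [ite_and]
    simp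
  rw [hLsum]
  have hintegral : ∀ ε : ℝ, ∫ t, ∑ w : Equiv.Perm (Fin (m + 1)), ∑ s : Finset (Fin (m + 1)),
        ((if w 0 = 0 ∧ ∀ l ∈ s, w (l - 1) < w l then 1 else 0) * (ε : ℂ) ^ sᶜ.card *
          ((ε : ℂ)⁻¹) ^ (m + 1)) * Q w s ε t =
      ∑ w : Equiv.Perm (Fin (m + 1)), ∑ s : Finset (Fin (m + 1)),
        ((if w 0 = 0 ∧ ∀ l ∈ s, w (l - 1) < w l then 1 else 0) * (ε : ℂ) ^ sᶜ.card *
          ((ε : ℂ)⁻¹) ^ (m + 1)) * ∫ t, Q w s ε t := by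
    intro ε
    rw [integral_finsetSum _ fun w _ => integrable_finsetSum _ fun s _ => hint ε w s]
    refine Finset.sum_congr rfl fun w _ => ?_
    rw [integral_finsetSum _ fun s _ => hint ε w s]
    exact Finset.sum_congr rfl fun s _ => integral_const_mul _ _
  simp only [hintegral]
  refine tendsto_finsetSum _ fun w _ => tendsto_finsetSum _ fun s _ => ?_
  by_cases hws : w 0 = 0 ∧ ∀ l ∈ s, w (l - 1) < w l
  swap
  · have hne : ¬(w = 1 ∧ s = Finset.univ.erase 0) := by
      rintro ⟨rfl, rfl⟩
      refine hws ⟨rfl, fun l hl => ?_⟩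
      obtain ⟨j, rfl⟩ := Fin.exists_succ_eq.2 (Finset.ne_of_mem_erase hl)
      simp [← Fin.coeSucc_eq_succ]
    simp [hws, hne]
  -- The position `0` follows the last one, so that at least one factor `nhat` is left.
  have h0s : (0 : Fin (m + 1)) ∉ s := fun h => by
    have := hws.2 0 h
    rw [hws.1] at this
    exact absurd this (Fin.not_lt_zero _)
  obtain ⟨r, hr⟩ := Nat.exists_eq_succ_of_ne_zero
    (Finset.card_ne_zero.2 ⟨0, Finset.mem_compl.2 h0s⟩)
  have hscale : (fun ε : ℝ => ((if w 0 = 0 ∧ ∀ l ∈ s, w (l - 1) < w l then 1 else 0) *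
      (ε : ℂ) ^ sᶜ.card * ((ε : ℂ)⁻¹) ^ (m + 1)) * ∫ t, Q w s ε t) =ᶠ[𝓝[>] 0]
      fun ε : ℝ => (ε : ℂ) ^ r * (((ε : ℂ)⁻¹) ^ (m + 1 - 1) * ∫ t, Q w s ε t) := by
    filter_upwards [self_mem_nhdsWithin] with ε hε
    have hε' : (ε : ℂ) ≠ 0 := Complex.ofReal_ne_zero.2 (ne_of_gt hε)
    rw [if_pos hws, hr, Nat.add_sub_cancel, Nat.succ_eq_add_one, pow_succ _ r, pow_succ _ m]
    linear_combination ((ε : ℂ) ^ r * ((ε : ℂ)⁻¹) ^ m * ∫ t, Q w s ε t) * mul_inv_cancel₀ hε'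
  refine Tendsto.congr' hscale.symm ?_
  have hε : Tendsto (fun ε : ℝ => (ε : ℂ)) (𝓝[>] 0) (𝓝 0) :=
    (Complex.continuous_ofReal.tendsto' 0 0 (by simp)).mono_left nhdsWithin_le_nhds
  have hconv := (hε.pow r).mul (hlim w s).2
  rcases Nat.eq_zero_or_pos r with hr0 | hr0
  · subst hr0
    have hs : s = Finset.univ.erase 0 := by
      obtain ⟨x, hx⟩ := Finset.card_eq_one.1 hr
      have h0 : (0 : Fin (m + 1)) ∈ sᶜ := Finset.mem_compl.2 h0s
      rw [hx, Finset.mem_singleton] at h0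
      rw [← compl_compl s, hx, ← h0]
      ext i
      simp
    have hw : w = 1 := LowDensity.perm_eq_one_of_forall_sub_one_lt fun l hl =>
      hws.2 l (by rw [hs]; exact Finset.mem_erase.2 ⟨hl, Finset.mem_univ _⟩)
    subst hs hw
    rw [if_pos ⟨rfl, rfl⟩, hL]
    simp only [pow_zero, one_mul] at hconv ⊢
    refine hconv.trans (le_of_eq ?_)
    congr 3
    funext E
    exact tsum_congr fun k => (hone E k).symm
  · have hne : ¬(w = 1 ∧ s = Finset.univ.erase 0) := by
      rintro ⟨-, rfl⟩
      have : (Finset.univ.erase (0 : Fin (m + 1)))ᶜ = {0} := by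
        ext i
        simp
      rw [this, Finset.card_singleton] at hr
      omega
    rw [if_neg hne]
    rw [zero_pow hr0.ne', zero_mul] at hconv
    exact hconv
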